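/- Let $k$ be a field and let $\mathcal C$ be a Hom-finite Krull-Schmidt additive $k$-category: a $k$-linear additive category whose morphism spaces are finite dimensional and in which every non-zero object is a finite direct sum of objects with local endomorphism algebra. Notation. Let $\mathrm{rad}$ be the Jacobson radical of $\mathcal C$. For an indecomposable object $X$, the automorphism field is $k_X=\mathrm{End}(X)/\mathrm{rad}(X,X)$; it is trivial if $k_X\cong k$ as $k$-algebras. A morphism $f:X\to Y$ is a source morphism (for $X$) if it is left minimal (every $h\in\mathrm{End}(Y)$ with $hf=f$ is an automorphism) and left almost split ($f$ is not a split monomorphism, and every morphism $X\to M$ that is not a split monomorphism factors through $f$); sink morphisms are defined dually. A sequence $X\xrightarrow{f}Y\xrightarrow{g}Z$ with $Y\neq0$ is almost split if $f$ is a source morphism and a pseudo-kernel of $g$, and $g$ is a sink morphism and a pseudo-cokernel of $f$. A sink morphism is proper if it is a monomorphism or fits in an almost split sequence; a source morphism is proper if it is an epimorphism or fits in an almost split sequence. The Auslander-Reiten quiver $\Gamma_{\mathcal C}$ has as vertices a complete set of representatives of the isomorphism classes of indecomposable objects. Let $d_{XY}$ and $d'_{XY}$ be the dimensions of $\mathrm{irr}(X,Y)=\mathrm{rad}(X,Y)/\mathrm{rad}^2(X,Y)$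 over $k_Y$ and $k_X$. If $d_{XY}=d'_{XY}$ there are $d_{XY}$ arrows $X\to Y$; otherwise there is one arrow $X\to Y$, with valuation $(d_{XY},d'_{XY})$. The translation is defined by $\tau Z=X$ if and only if there is an almost split sequence $X\to Y\to Z$. A connected component $\Gamma$ of $\Gamma_{\mathcal C}$ is standard if every object of $\Gamma$ has trivial automorphism field and there is a $k$-linear equivalence, acting identically on the objects, from the mesh category $k(\Gamma)$ to the full subcategory of $\mathcal C$ with objects those of $\Gamma$. Here $k(\Gamma)$ is the path category $k\Gamma$ modulo the ideal generated by the mesh relations $\sum_{\alpha:Y\to Z}\alpha\,\sigma(\alpha)$, one for each $Z\in\Gamma$ with $\tau Z\in\Gamma$, where the sum is over all arrows $\alpha$ ending in $Z$ and $\sigma$ matches, bijectively for each $Y$, the arrows $Y\to Z$ with the arrows $\tau Z\to Y$. A section of $\Gamma$ is a connected full subquiver $\Delta$ of $\Gamma$ that is convex in $\Gamma$, contains no oriented cycle and meets every $\tau$-orbit of $\Gamma$ exactly once. Let $\Delta^-$ and $\Delta^+$ be the sets of vertices of $\Gamma$ of the form $\tau^nX$ with $X\in\Delta$ and $n>0$,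 respectively $n<0$. Theorem. Let $\Gamma$ be a connected component of $\Gamma_{\mathcal C}$, and let $\Delta$ be a section of $\Gamma$ in which every object has a trivial automorphism field and admits a proper sink morphism as well as a proper source morphism. If $\Delta$ has no infinite path (neither one without starting point nor one without ending point), then $\Gamma$ is standard if and only if $\mathrm{Hom}_{\mathcal C}(X,Y)=0$ for all $X\in\Delta^+$ and $Y\in\Delta^-$. -/

import Mathlib

open CategoryTheory CategoryTheory.Limits

universe w v u

noncomputable section

namespace ARTheory

/-! ### Quivers -/

section Quivers

variable {Q : Type u} [Quiver.{v} Q]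

/-- The full subquiver of `Q` generated by a set `S` of vertices. -/
def FullSubquiver (S : Set Q) : Type u := S

instance (S : Set Q) : Quiver.{v} (FullSubquiver S) where
  Hom X Y := (Subtype.val X : Q) ⟶ (Subtype.val Y : Q)

/-- The set `S` of vertices is a connected component of `Q`. -/
def IsConnectedComponent (S : Set Q) : Prop :=
  ∃ c : Quiver.WeaklyConnectedComponent Q,
    S = {X | (Quiver.WeaklyConnectedComponent.mk X) = c}

/-- The full subquiver generated by `S` is connected: it is non-empty, and any two of its vertices
are joined by a walk in it. -/
def IsConnectedOn (S : Set Q) : Prop :=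
  Nonempty (FullSubquiver S) ∧
    Subsingleton (Quiver.WeaklyConnectedComponent (FullSubquiver S))

/-- The set `D` of vertices is convex in the full subquiver generated by `G`: every path in `G`
with both end points in `D` has all its vertices in `D`. -/
def IsConvexIn (D G : Set Q) : Prop :=
  ∀ X Y Z : FullSubquiver G, Subtype.val X ∈ D → Subtype.val Z ∈ D →
    Nonempty (Quiver.Path X Y) → Nonempty (Quiver.Path Y Z) → Subtype.val Y ∈ D

/-- The full subquiver generated by `S` contains no oriented cycle. -/
def HasNoOrientedCycle (S : Set Q) : Prop :=
  ∀ (X : FullSubquiver S) (p : Quiver.Path X X), p.length = 0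

/-- The full subquiver generated by `S` contains an infinite path without starting point,
`⋯ ⟶ x 2 ⟶ x 1 ⟶ x 0`. -/
def HasLeftInfinitePath (S : Set Q) : Prop :=
  ∃ x : ℕ → FullSubquiver S, ∀ n, Nonempty (x (n + 1) ⟶ x n)

/-- The full subquiver generated by `S` contains an infinite path without ending point,
`x 0 ⟶ x 1 ⟶ x 2 ⟶ ⋯`. -/
def HasRightInfinitePath (S : Set Q) : Prop :=
  ∃ x : ℕ → FullSubquiver S, ∀ n, Nonempty (x n ⟶ x (n + 1))

/-- The full subquiver generated by `S` has no infinite path. (A path that is infinite in both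
directions contains paths of both one-sided kinds.) -/
def HasNoInfinitePath (S : Set Q) : Prop :=
  ¬ HasLeftInfinitePath S ∧ ¬ HasRightInfinitePath S

end Quivers

/-! ### Translation quivers, path categories and mesh categories

A translation `τ` is a partially defined injective map on vertices; it is encoded by the relation
`T X Z` which says that `τ Z` is defined and equal to `X`. -/

section Mesh

variable {Q : Type u} [Quiver.{v} Q] (T : Q → Q → Prop)

/-- `D` is a section of `G`: a connected full subquiver of `G` that is convex in `G`, contains no
oriented cycle and meets every `τ`-orbit of `G` exactly once. -/
structure IsSection (D G : Set Q) : Prop where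
  subset : D ⊆ G
  connected : IsConnectedOn D
  convex : IsConvexIn D G
  acyclic : HasNoOrientedCycle D
  meets_orbit : ∀ X ∈ G, ∃! Y, Y ∈ D ∧ Relation.EqvGen T X Y

/-- The vertices `τ ^ n X` with `n > 0` and `X ∈ D`. -/
def sectionMinus (D : Set Q) : Set Q :=
  {Y | ∃ X ∈ D, Relation.TransGen T Y X}

/-- The vertices `τ ^ n X` with `n < 0` and `X ∈ D`. -/
def sectionPlus (D : Set Q) : Set Q :=
  {Y | ∃ X ∈ D, Relation.TransGen T X Y}

/-- A polarization: for every vertex `Z` with `τ Z = X` defined and every vertex `Y`, a bijection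
`σ` from the arrows `Y ⟶ Z` to the arrows `X ⟶ Y`. It matches the arrows of the mesh ending
in `Z`; where there are no multiple arrows, it is unique. -/
structure Polarization where
  σ : ∀ {X Z : Q}, T X Z → ∀ Y : Q, (Y ⟶ Z) ≃ (X ⟶ Y)

variable (k : Type w) [Field k]

/-- The path category `kQ`: the `k`-linear category freely generated by the quiver. -/
abbrev PathCategory (Q : Type u) [Quiver.{v} Q] : Type u := Free k (Paths Q)

/-- A vertex of the quiver as an object of the path category. -/
def vtx (X : Q) : PathCategory k Q := Free.of k ((Paths.of Q).obj X)

/-- A path of the quiver as a morphism of the path category. -/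
def pathHom {X Y : Q} (p : Quiver.Path X Y) : vtx k X ⟶ vtx k Y :=
  (Free.embedding k (Paths Q)).map (X := (Paths.of Q).obj X) (Y := (Paths.of Q).obj Y) p

variable {T}

/-- The mesh relation at `Z`, where `X = τ Z`: the sum of all paths `X ⟶ Y ⟶ Z` of the form
`σ α` followed by `α`, with `α` running through the arrows that end in `Z`.
(For an Auslander-Reiten quiver there are only finitely many of them.) -/
def meshRelation (P : Polarization T) {X Z : Q} (h : T X Z) :
    vtx k X ⟶ vtx k Z :=
  ∑ᶠ a : (Y : Q) × (Y ⟶ Z), pathHom k ((P.σ h a.1 a.2).toPath.comp a.2.toPath)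

/-- The mesh ideal: the two-sided ideal of the path category generated by the mesh relations. -/
def meshIdeal (P : Polarization T) (A B : PathCategory k Q) : Submodule k (A ⟶ B) :=
  Submodule.span k {f | ∃ (X Z : Q) (h : T X Z) (p : A ⟶ vtx k X)
    (q : vtx k Z ⟶ B), f = p ≫ meshRelation k P h ≫ q}

theorem comp_mem_meshIdeal (P : Polarization T) {A B C : PathCategory k Q} (f : A ⟶ B)
    {g : B ⟶ C} (hg : g ∈ meshIdeal k P B C) : f ≫ g ∈ meshIdeal k P A C := by
  have : meshIdeal k P B C ≤ (meshIdeal k P A C).comap (Linear.leftComp k C f) := by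
    refine Submodule.span_le.2 ?_
    rintro _ ⟨X, Z, h, p, q, rfl⟩
    exact Submodule.subset_span ⟨X, Z, h, f ≫ p, q, by simp⟩
  exact this hg

theorem mem_meshIdeal_comp (P : Polarization T) {A B C : PathCategory k Q} {f : A ⟶ B}
    (g : B ⟶ C) (hf : f ∈ meshIdeal k P A B) : f ≫ g ∈ meshIdeal k P A C := by
  have : meshIdeal k P A B ≤ (meshIdeal k P A C).comap (Linear.rightComp k A g) := by
    refine Submodule.span_le.2 ?_
    rintro _ ⟨X, Z, h, p, q, rfl⟩
    exact Submodule.subset_span ⟨X, Z, h, p, q ≫ g, by simp⟩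
  exact this hf

/-- Two morphisms of the path category are identified if they differ by an element of the mesh
ideal. -/
def meshRel (P : Polarization T) : HomRel (PathCategory k Q) :=
  fun A B f g => f - g ∈ meshIdeal k P A B

instance (P : Polarization T) : Congruence (meshRel k P) where
  equivalence :=
    { refl := fun f => by simp [meshRel]
      symm := fun {f g} h => by
        have := (meshIdeal k P _ _).neg_mem h
        simpa [meshRel] using this
      trans := fun {f g l} h₁ h₂ => by
        have := (meshIdeal k P _ _).add_mem h₁ h₂
        simpa [meshRel] using this }
  comp_left f g g' h := by
    have := comp_mem_meshIdeal k P f h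
    simpa [meshRel, Preadditive.comp_sub] using this
  comp_right g h := by
    have := mem_meshIdeal_comp k P g h
    simpa [meshRel, Preadditive.sub_comp] using this

/-- The mesh category `k(Q)`: the quotient of the path category by the mesh ideal. -/
def MeshCategory (P : Polarization T) : Type u := CategoryTheory.Quotient (meshRel k P)

instance (P : Polarization T) : Category (MeshCategory k P) :=
  inferInstanceAs (Category (CategoryTheory.Quotient (meshRel k P)))

theorem meshRel_add (P : Polarization T) ⦃A B : PathCategory k Q⦄ (f₁ f₂ g₁ g₂ : A ⟶ B)
    (h₁ : meshRel k P f₁ f₂) (h₂ : meshRel k P g₁ g₂) : meshRel k P (f₁ + g₁) (f₂ + g₂) := by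
  have := (meshIdeal k P _ _).add_mem h₁ h₂
  rwa [sub_add_sub_comm] at this

theorem meshRel_smul (P : Polarization T) (a : k) ⦃A B : PathCategory k Q⦄ (f₁ f₂ : A ⟶ B)
    (h : meshRel k P f₁ f₂) : meshRel k P (a • f₁) (a • f₂) := by
  have := (meshIdeal k P _ _).smul_mem a h
  rwa [smul_sub] at this

instance (P : Polarization T) : Preadditive (MeshCategory k P) :=
  Quotient.preadditive (meshRel k P) (meshRel_add k P)

instance (P : Polarization T) : Linear k (MeshCategory k P) :=
  letI : Preadditive (CategoryTheory.Quotient (meshRel k P)) :=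
    Quotient.preadditive (meshRel k P) (meshRel_add k P)
  haveI : (Quotient.functor (meshRel k P)).Additive :=
    Quotient.functor_additive (meshRel k P) (meshRel_add k P)
  Quotient.linear k (meshRel k P) (meshRel_smul k P)

/-- A vertex of the quiver as an object of the mesh category. -/
def MeshCategory.of (P : Polarization T) (X : Q) : MeshCategory k P :=
  (Quotient.functor (meshRel k P)).obj (vtx k X)

end Mesh

/-! ### Almost split sequences -/

section AlmostSplit

variable {C : Type u} [Category.{v} C]

/-- `f` is left almost split: it is not a section (split monomorphism), and every morphism from `X`
that is not a section factors through `f`. -/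
structure IsLeftAlmostSplit {X Y : C} (f : X ⟶ Y) : Prop where
  not_section : ¬ IsSplitMono f
  factors : ∀ {M : C} (g : X ⟶ M), ¬ IsSplitMono g → ∃ h : Y ⟶ M, f ≫ h = g

/-- `g` is right almost split: it is not a retraction (split epimorphism), and every morphism to `Z`
that is not a retraction factors through `g`. -/
structure IsRightAlmostSplit {Y Z : C} (g : Y ⟶ Z) : Prop where
  not_retraction : ¬ IsSplitEpi g
  factors : ∀ {M : C} (f : M ⟶ Z), ¬ IsSplitEpi f → ∃ h : M ⟶ Y, h ≫ g = f

def IsLeftMinimal {X Y : C} (f : X ⟶ Y) : Prop := ∀ h : Y ⟶ Y, f ≫ h = f → IsIso h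

def IsRightMinimal {Y Z : C} (g : Y ⟶ Z) : Prop := ∀ h : Y ⟶ Y, h ≫ g = g → IsIso h

/-- `f` is a source morphism for its domain. -/
structure IsSourceMorphism {X Y : C} (f : X ⟶ Y) : Prop where
  minimal : IsLeftMinimal f
  almostSplit : IsLeftAlmostSplit f

/-- `g` is a sink morphism for its codomain. -/
structure IsSinkMorphism {Y Z : C} (g : Y ⟶ Z) : Prop where
  minimal : IsRightMinimal g
  almostSplit : IsRightAlmostSplit g

variable [HasZeroMorphisms C]

/-- The sequence `X ⟶ Y ⟶ Z` is almost split: `Y` is non-zero, `f` is a source morphism and a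
pseudo-kernel of `g`, and `g` is a sink morphism and a pseudo-cokernel of `f`. -/
structure IsAlmostSplitSeq {X Y Z : C} (f : X ⟶ Y) (g : Y ⟶ Z) : Prop where
  middle_nonzero : ¬ IsZero Y
  source : IsSourceMorphism f
  sink : IsSinkMorphism g
  comp_eq_zero : f ≫ g = 0
  pseudoKernel : ∀ {M : C} (h : M ⟶ Y), h ≫ g = 0 → ∃ l : M ⟶ X, l ≫ f = h
  pseudoCokernel : ∀ {M : C} (h : Y ⟶ M), f ≫ h = 0 → ∃ l : Z ⟶ M, g ≫ l = h

/-- `Z` admits a proper sink morphism: one that is a monomorphism or fits in an almost split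
sequence. -/
def HasProperSinkMorphism (Z : C) : Prop :=
  ∃ (Y : C) (g : Y ⟶ Z), IsSinkMorphism g ∧
    (Mono g ∨ ∃ (X : C) (f : X ⟶ Y), IsAlmostSplitSeq f g)

/-- `X` admits a proper source morphism: one that is an epimorphism or fits in an almost split
sequence. -/
def HasProperSourceMorphism (X : C) : Prop :=
  ∃ (Y : C) (f : X ⟶ Y), IsSourceMorphism f ∧
    (Epi f ∨ ∃ (Z : C) (g : Y ⟶ Z), IsAlmostSplitSeq f g)

end AlmostSplit

/-! ### Krull-Schmidt categories, radical, automorphism fields -/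

section Radical

/-- Every non-zero object is a finite direct sum of objects with a local endomorphism algebra. -/
def IsKrullSchmidt (C : Type u) [Category.{v} C] [Preadditive C] [HasFiniteBiproducts C] : Prop :=
  ∀ X : C, ¬ IsZero X → ∃ (n : ℕ) (Y : Fin n → C),
    (∀ i, IsLocalRing (End (Y i))) ∧ Nonempty (X ≅ ⨁ Y)

/-- `V` is a complete set of representatives of the isomorphism classes of the indecomposable
objects of `C`. -/
def IsCompleteSetOfIndecomposables {C : Type u} [Category.{v} C] [Preadditive C]
    [HasFiniteBiproducts C] (V : Set C) : Prop :=
  haveI := hasBinaryBiproducts_of_finite_biproducts C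
  (∀ X ∈ V, Indecomposable X) ∧
    ∀ X : C, Indecomposable X → ∃! Y, Y ∈ V ∧ Nonempty (X ≅ Y)

variable (k : Type w) [Field k] {C : Type u} [Category.{v} C] [Preadditive C] [Linear k C]

/-- The Jacobson radical `rad(X, Y)` of the category: the morphisms `f : X ⟶ Y` such that
`1 - g f` is invertible for every `g : Y ⟶ X`. -/
def rad (X Y : C) : Submodule k (X ⟶ Y) where
  carrier := {f | ∀ g : Y ⟶ X, IsIso (𝟙 X - f ≫ g)}
  zero_mem' := fun g => by
    rw [zero_comp, sub_zero]; infer_instance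
  add_mem' := fun {f f'} hf hf' g => by
    have := hf g
    have := hf' (g ≫ inv (𝟙 X - f ≫ g))
    have e : 𝟙 X - (f + f') ≫ g =
        (𝟙 X - f' ≫ g ≫ inv (𝟙 X - f ≫ g)) ≫ (𝟙 X - f ≫ g) := by
      rw [Preadditive.sub_comp (𝟙 X), Category.assoc, Category.assoc, IsIso.inv_hom_id,
        Category.comp_id, Category.id_comp, Preadditive.add_comp]
      abel
    rw [e]; infer_instance
  smul_mem' := fun c f hf g => by
    have := hf (c • g)
    rwa [Linear.comp_smul, ← Linear.smul_comp] at this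

/-- The square of the radical: finite sums of composites of two radical morphisms. -/
def radSq (X Y : C) : Submodule k (X ⟶ Y) :=
  Submodule.span k {h | ∃ (W : C) (f : X ⟶ W) (g : W ⟶ Y),
    f ∈ rad k X W ∧ g ∈ rad k W Y ∧ h = f ≫ g}

/-- `irr(X, Y) = rad(X, Y) / rad²(X, Y)`. -/
abbrev Irr (X Y : C) : Type _ := rad k X Y ⧸ (radSq k X Y).submoduleOf (rad k X Y)

/-- `rad(X, X)` as an ideal of the endomorphism algebra. -/
def radIdeal (X : C) : Ideal (End X) where
  carrier := {f | (show X ⟶ X from f) ∈ rad k X X}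
  zero_mem' := (rad k X X).zero_mem
  add_mem' := (rad k X X).add_mem
  smul_mem' := fun c f hf g => by
    have := hf ((show X ⟶ X from c) ≫ g)
    rwa [← Category.assoc] at this

instance (X : C) : (radIdeal k X).IsTwoSided where
  mul_mem_of_left := fun {f} h hf g => by
    -- `h ≫ f` is radical: `1 - h f g` is invertible because `1 - f g h` is
    have hu := hf (g ≫ (show X ⟶ X from h))
    set a : X ⟶ X := h
    set b : X ⟶ X := f
    change IsIso (𝟙 X - (a ≫ b) ≫ g)
    change IsIso (𝟙 X - b ≫ g ≫ a) at hu
    have e₁ := IsIso.hom_inv_id (𝟙 X - b ≫ g ≫ a)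
    have e₂ := IsIso.inv_hom_id (𝟙 X - b ≫ g ≫ a)
    generalize inv (𝟙 X - b ≫ g ≫ a) = u at e₁ e₂
    have h₁ : a ≫ ((𝟙 X - b ≫ g ≫ a) ≫ u) ≫ b ≫ g = a ≫ 𝟙 X ≫ b ≫ g := by rw [e₁]
    have h₂ : a ≫ (u ≫ (𝟙 X - b ≫ g ≫ a)) ≫ b ≫ g = a ≫ 𝟙 X ≫ b ≫ g := by rw [e₂]
    simp only [Preadditive.sub_comp, Preadditive.comp_sub, Category.assoc, Category.id_comp,
      Category.comp_id] at h₁ h₂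
    refine ⟨𝟙 X + a ≫ u ≫ b ≫ g, ?_, ?_⟩
    · simp only [Preadditive.sub_comp, Preadditive.comp_add, Category.assoc, Category.id_comp,
        Category.comp_id]
      generalize a ≫ b ≫ g ≫ a ≫ u ≫ b ≫ g = p at h₁ ⊢
      generalize a ≫ b ≫ g = r at h₁ ⊢
      rw [← h₁]; abel
    · simp only [Preadditive.add_comp, Preadditive.comp_sub, Category.assoc, Category.id_comp,
        Category.comp_id]
      generalize a ≫ u ≫ b ≫ g ≫ a ≫ b ≫ g = p at h₂ ⊢
      generalize a ≫ b ≫ g = r at h₂ ⊢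
      rw [← h₂]; abel

/-- The automorphism field `End(X) / rad(X, X)` of an indecomposable object `X`. -/
abbrev AutField (X : C) : Type _ := End X ⧸ radIdeal k X

/-- The automorphism field of `X` is trivial, that is, isomorphic to `k` as a `k`-algebra. -/
def HasTrivialAutField (X : C) : Prop := Nonempty (AutField k X ≃ₐ[k] k)

/-- The dimension of `irr(X, Y)` over the division algebra `k_Y`, given by
`dim_k irr(X, Y) = d · dim_k k_Y`. -/
def valRight (X Y : C) : ℕ :=
  Module.finrank k (Irr k X Y) / Module.finrank k (AutField k Y)

/-- The dimension of `irr(X, Y)` over the division algebra `k_X`, given by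
`dim_k irr(X, Y) = d' · dim_k k_X`. -/
def valLeft (X Y : C) : ℕ :=
  Module.finrank k (Irr k X Y) / Module.finrank k (AutField k X)

/-- The number of arrows from `X` to `Y` in the Auslander-Reiten quiver: if the valuation
`(d, d')` is symmetric, there are `d` unvalued arrows; otherwise there is one valued arrow. -/
def numArrows (X Y : C) : ℕ :=
  if valRight k X Y = valLeft k X Y then valRight k X Y else 1

/-- The vertex set of the Auslander-Reiten quiver of `C`, for a given complete set `V` of
representatives of the indecomposable objects. -/
def ARQuiver (_ : Type w) {C : Type u} (V : Set C) : Type u := V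

/-- A vertex of the Auslander-Reiten quiver as an object of `C`. -/
def ARQuiver.obj {k : Type w} {C : Type u} {V : Set C} (X : ARQuiver k V) : C := Subtype.val X

instance (V : Set C) : Quiver.{0} (ARQuiver k V) where
  Hom X Y := Fin (numArrows k X.obj Y.obj)

/-- The translation: `τ Z = X` if and only if `C` has an almost split sequence `X ⟶ Y ⟶ Z`. -/
def IsTranslate {k : Type w} {V : Set C} (X Z : ARQuiver k V) : Prop :=
  ∃ (Y : C) (f : X.obj ⟶ Y) (g : Y ⟶ Z.obj), IsAlmostSplitSeq f g

/-- The translation of the full translation subquiver generated by `S`. -/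
def IsTranslateOn {k : Type w} {V : Set C} (S : Set (ARQuiver k V))
    (X Z : FullSubquiver S) : Prop :=
  IsTranslate (Subtype.val X : ARQuiver k V) (Subtype.val Z : ARQuiver k V)

variable {k}

/-- The full subcategory `C(S)` of `C` generated by the objects in `S`. -/
abbrev FullSubcat {V : Set C} (S : Set (ARQuiver k V)) : Type u :=
  ObjectProperty.FullSubcategory (fun Y : C => ∃ X ∈ S, ARQuiver.obj X = Y)

/-- A full convex subquiver of the Auslander-Reiten quiver, with vertex set `S`, is standard if all
its objects have a trivial automorphism field and there is a `k`-linear equivalence from its mesh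
category to `C(S)` that acts identically on the objects. -/
def IsStandard {V : Set C} (S : Set (ARQuiver k V)) : Prop :=
  (∀ X ∈ S, HasTrivialAutField k X.obj) ∧
    ∃ (P : Polarization (IsTranslateOn S)) (F : MeshCategory k P ⥤ FullSubcat S)
      (_ : F.Additive), F.Linear k ∧ F.IsEquivalence ∧
        ∀ X : FullSubquiver S,
          (F.obj (MeshCategory.of k P X)).obj = (Subtype.val X : ARQuiver k V).obj

/-- `Hom(S, T) = 0`: there are no non-zero morphisms from an object in `S` to an object in `T`. -/
def HomVanishes {V : Set C} (S T : Set (ARQuiver k V)) : Prop :=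
  ∀ X ∈ S, ∀ Y ∈ T, ∀ f : X.obj ⟶ Y.obj, f = 0

end Radical

end ARTheory

end

open ARTheory

universe v' u'

noncomputable section

namespace ARTheory

/-! Count each vertex `X` of Γ by its level: the integer `n` with `X = τ⁻ⁿx` for the unique `x` of
the section in its orbit. Convexity and acyclicity of Δ make the level well defined. They also force
every arrow either to stay in its level, lying over an arrow of Δ, or to rise by exactly one
(`IsSectionedQuiver.arrow_cases`). Thus Δ⁺ and Δ⁻ are the vertices of positive and of negative
level, and no path leads from Δ⁺ to Δ⁻. In the mesh category every morphism is a combination of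
paths, so Hom(Δ⁺, Δ⁻) vanishes there, and a standard component inherits this.

For the converse, triviality of automorphism fields spreads from Δ to Γ along almost split
sequences. The arrows `X ⟶ Y` can then be represented by a basis of irr(X, Y), and such bases are
exactly the components of source and sink morphisms. Almost split sequences allow the bases to be
chosen, outward from Δ, so that all mesh relations hold (`exists_mesh_family`). The recursion
terminates because Δ has no infinite path. This gives a linear functor from the mesh category to `C`
that is the identity on objects.

It remains to see that the functor is bijective on Hom(X, Y) (`bijective_lift`). For X in Δ⁺ and Y
in Δ⁻ both sides are zero, by the absence of paths and by hypothesis. For Y in Δ⁻, one descends on X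
through proper source morphisms: a radical map out of X factors through the arrows out of X, and the
relations between these factorizations come from the mesh starting at X, or are trivial if the
source morphism is epi. Once every X is reached for Y in Δ⁻, the dual argument with proper sink
morphisms climbs on Y through the non-negative levels. -/

theorem isIso_of_isIso_comp {C : Type u} [Category.{v} C] {X Y : C} {h : X ⟶ Y}
    {h' : Y ⟶ X} (h₁ : IsIso (h ≫ h')) (h₂ : IsIso (h' ≫ h)) : IsIso h := by
  have : IsSplitMono h :=
    ⟨⟨h' ≫ inv (h ≫ h'), by rw [← Category.assoc, IsIso.hom_inv_id]⟩⟩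
  have : Epi h := epi_of_epi h' h
  exact isIso_of_epi_of_isSplitMono h

/-! ### The Jacobson radical of a linear category. -/

section RadicalBasics

variable {k : Type w} [Field k] {C : Type u} [Category.{v} C] [Preadditive C] [Linear k C]

/-- Jacobson's lemma: if `u` inverts `1 - f ≫ g`, then `1 + g ≫ u ≫ f` inverts `1 - g ≫ f`. It makes
the one-sided definition of `rad` symmetric, so that arguments can be dualized. -/
theorem isIso_one_sub_comp_comm {X Y : C} (f : X ⟶ Y) (g : Y ⟶ X) (h : IsIso (𝟙 X - f ≫ g)) :
    IsIso (𝟙 Y - g ≫ f) := by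
  have e₁ := IsIso.hom_inv_id (𝟙 X - f ≫ g)
  have e₂ := IsIso.inv_hom_id (𝟙 X - f ≫ g)
  generalize inv (𝟙 X - f ≫ g) = u at e₁ e₂
  have h₁ : g ≫ ((𝟙 X - f ≫ g) ≫ u) ≫ f = g ≫ f := by rw [e₁]; simp
  have h₂ : g ≫ (u ≫ (𝟙 X - f ≫ g)) ≫ f = g ≫ f := by rw [e₂]; simp
  simp only [Preadditive.sub_comp, Preadditive.comp_sub, Category.assoc, Category.id_comp,
    Category.comp_id] at h₁ h₂
  refine ⟨𝟙 Y + g ≫ u ≫ f, ?_, ?_⟩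
  · simp only [Preadditive.sub_comp, Preadditive.comp_add, Category.assoc, Category.id_comp,
      Category.comp_id]
    generalize g ≫ f ≫ g ≫ u ≫ f = p at h₁ ⊢
    generalize g ≫ f = r at h₁ ⊢
    rw [← h₁]; abel
  · simp only [Preadditive.add_comp, Preadditive.comp_sub, Category.assoc, Category.id_comp,
      Category.comp_id]
    generalize g ≫ u ≫ f ≫ g ≫ f = p at h₂ ⊢
    generalize g ≫ f = r at h₂ ⊢
    rw [← h₂]; abel

theorem mem_rad' {X Y : C} {f : X ⟶ Y} : f ∈ rad k X Y ↔ ∀ g : Y ⟶ X, IsIso (𝟙 Y - g ≫ f) :=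
  ⟨fun h g => isIso_one_sub_comp_comm _ _ (h g), fun h g => isIso_one_sub_comp_comm _ _ (h g)⟩

theorem rad_comp {X Y Z : C} {f : X ⟶ Y} (hf : f ∈ rad k X Y) (g : Y ⟶ Z) :
    f ≫ g ∈ rad k X Z := fun h => by
  simpa using hf (g ≫ h)

theorem comp_rad {X Y Z : C} (f : X ⟶ Y) {g : Y ⟶ Z} (hg : g ∈ rad k Y Z) :
    f ≫ g ∈ rad k X Z := by
  rw [mem_rad'] at hg ⊢
  intro h
  simpa using hg (h ≫ f)

theorem isIso_one_sub {X : C} {f : X ⟶ X} (hf : f ∈ rad k X X) : IsIso (𝟙 X - f) := by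
  simpa using hf (𝟙 X)

theorem isZero_of_comp_eq_id_of_mem_rad {X Y : C} {f : X ⟶ Y} {g : Y ⟶ X} (h : f ≫ g = 𝟙 X)
    (hf : f ∈ rad k X Y) : IsZero X := by
  have h₁ : f ≫ g ∈ rad k X X := rad_comp hf g
  rw [h] at h₁
  have := isIso_one_sub h₁
  rw [sub_self] at this
  rw [IsZero.iff_id_eq_zero, ← IsIso.hom_inv_id (0 : X ⟶ X), zero_comp]

theorem id_notMem_rad {X : C} (hX : ¬ IsZero X) : 𝟙 X ∉ rad k X X := fun h =>
  hX (isZero_of_comp_eq_id_of_mem_rad (Category.id_comp _) h)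

theorem smul_id_mem_rad {X : C} (hX : ¬ IsZero X) {c : k} (h : c • 𝟙 X ∈ rad k X X) : c = 0 := by
  by_contra hc
  exact id_notMem_rad hX (((rad k X X).smul_mem_iff hc).1 h)

theorem comp_mem_radSq {X Y Z : C} {f : X ⟶ Y} {g : Y ⟶ Z} (hf : f ∈ rad k X Y)
    (hg : g ∈ rad k Y Z) : f ≫ g ∈ radSq k X Z :=
  Submodule.subset_span ⟨Y, f, g, hf, hg, rfl⟩

theorem mem_rad_of_not_isSplitMono {X Y : C} [IsLocalRing (End X)] {f : X ⟶ Y}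
    (hf : ¬ IsSplitMono f) : f ∈ rad k X Y := fun g => by
  rcases IsLocalRing.isUnit_or_isUnit_of_add_one (R := End X) (a := f ≫ g) (b := 𝟙 X - f ≫ g)
    (add_sub_cancel _ _) with h | h
  · refine (hf ?_).elim
    have := (isUnit_iff_isIso (f ≫ g)).1 h
    exact ⟨⟨g ≫ inv (f ≫ g), by rw [← Category.assoc, IsIso.hom_inv_id]⟩⟩
  · exact (isUnit_iff_isIso _).1 h

theorem mem_rad_of_not_isSplitEpi {X Y : C} [IsLocalRing (End Y)] {f : X ⟶ Y}
    (hf : ¬ IsSplitEpi f) : f ∈ rad k X Y := by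
  rw [mem_rad']
  intro g
  rcases IsLocalRing.isUnit_or_isUnit_of_add_one (R := End Y) (a := g ≫ f) (b := 𝟙 Y - g ≫ f)
    (add_sub_cancel _ _) with h | h
  · refine (hf ?_).elim
    have := (isUnit_iff_isIso (g ≫ f)).1 h
    exact ⟨⟨inv (g ≫ f) ≫ g, by rw [Category.assoc, IsIso.inv_hom_id]⟩⟩
  · exact (isUnit_iff_isIso _).1 h

theorem not_isSplitMono_of_mem_rad {X Y : C} (hX : ¬ IsZero X) {f : X ⟶ Y} (hf : f ∈ rad k X Y) :
    ¬ IsSplitMono f := fun _ => hX (isZero_of_comp_eq_id_of_mem_rad (IsSplitMono.id f) hf)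

theorem not_isSplitEpi_of_mem_rad {X Y : C} (hY : ¬ IsZero Y) {f : X ⟶ Y} (hf : f ∈ rad k X Y) :
    ¬ IsSplitEpi f := fun _ => by
  have h := comp_rad (section_ f) hf
  rw [IsSplitEpi.id] at h
  exact id_notMem_rad hY h

theorem not_isZero_of_isLocalRing_end {X : C} [IsLocalRing (End X)] : ¬ IsZero X := fun h =>
  one_ne_zero (α := End X) (h.eq_of_src (𝟙 X) 0)

/-- A split monomorphism between objects with local endomorphism rings is an isomorphism. -/
theorem isIso_of_comp_eq_id {X Y : C} [IsLocalRing (End X)] [IsLocalRing (End Y)]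
    {f : X ⟶ Y} {g : Y ⟶ X} (h : f ≫ g = 𝟙 X) : IsIso f := by
  -- `g ≫ f` is idempotent. If it is a unit it is the identity; if its complement is a unit, then `f
  -- = 0` and `X` would be zero.
  rcases IsLocalRing.isUnit_or_isUnit_of_add_one (R := End Y) (a := g ≫ f) (b := 𝟙 Y - g ≫ f)
    (add_sub_cancel _ _) with hu | hu
  · have := (isUnit_iff_isIso (g ≫ f)).1 hu
    have : g ≫ f = 𝟙 Y := by
      rw [← cancel_mono (g ≫ f)]
      rw [Category.assoc, ← Category.assoc f g f, h]; simp
    exact ⟨g, h, this⟩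
  · have := (isUnit_iff_isIso (𝟙 Y - g ≫ f)).1 hu
    have hf : f = 0 := by
      rw [← cancel_mono (𝟙 Y - g ≫ f)]
      rw [Preadditive.comp_sub, ← Category.assoc f g f, h]; simp
    rw [hf, zero_comp] at h
    exact (not_isZero_of_isLocalRing_end ((IsZero.iff_id_eq_zero X).2 h.symm)).elim

end RadicalBasics

/-! ### Minimal and almost split morphisms. -/

section MinimalMorphisms

variable {k : Type w} [Field k] {C : Type u} [Category.{v} C] [Preadditive C] [Linear k C]

-- If `f ≫ p = 0`, then `1 - p ≫ q` fixes `f` for every `q`, hence is invertible. With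
-- `isLeftMinimal_of_mem_rad` this says that minimality means exactly that endomorphisms killed by
-- `f` are radical.
variable (k) in
theorem IsLeftMinimal.mem_rad {X E M : C} {f : X ⟶ E} (hf : IsLeftMinimal f) {p : E ⟶ M}
    (h : f ≫ p = 0) : p ∈ rad k E M := fun q =>
  hf _ (by rw [Preadditive.comp_sub, ← Category.assoc, h]; simp)

variable (k) in
theorem IsRightMinimal.mem_rad {E Z M : C} {g : E ⟶ Z} (hg : IsRightMinimal g) {p : M ⟶ E}
    (h : p ≫ g = 0) : p ∈ rad k M E :=
  mem_rad'.2 fun q => hg _ (by rw [Preadditive.sub_comp, Category.assoc, h]; simp)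

theorem isLeftMinimal_of_mem_rad {X E : C} {f : X ⟶ E}
    (h : ∀ p : E ⟶ E, f ≫ p = 0 → p ∈ rad k E E) : IsLeftMinimal f := fun q hq => by
  have := isIso_one_sub (h (𝟙 E - q) (by rw [Preadditive.comp_sub, hq]; simp))
  rwa [sub_sub_cancel] at this

theorem isRightMinimal_of_mem_rad {E Z : C} {g : E ⟶ Z}
    (h : ∀ p : E ⟶ E, p ≫ g = 0 → p ∈ rad k E E) : IsRightMinimal g := fun q hq => by
  have := isIso_one_sub (h (𝟙 E - q) (by rw [Preadditive.sub_comp, hq]; simp))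
  rwa [sub_sub_cancel] at this

theorem IsLeftAlmostSplit.not_isZero {X E : C} {f : X ⟶ E} (hf : IsLeftAlmostSplit f) :
    ¬ IsZero X := fun h => hf.not_section ⟨⟨0, h.eq_of_src _ _⟩⟩

theorem IsRightAlmostSplit.not_isZero {E Z : C} {g : E ⟶ Z} (hg : IsRightAlmostSplit g) :
    ¬ IsZero Z := fun h => hg.not_retraction ⟨⟨0, h.eq_of_src _ _⟩⟩

theorem IsLeftAlmostSplit.exists_of_mem_rad {X E M : C} {f : X ⟶ E} (hf : IsLeftAlmostSplit f)
    {r : X ⟶ M} (hr : r ∈ rad k X M) : ∃ l : E ⟶ M, f ≫ l = r :=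
  hf.factors r (not_isSplitMono_of_mem_rad hf.not_isZero hr)

theorem IsRightAlmostSplit.exists_of_mem_rad {E Z M : C} {g : E ⟶ Z} (hg : IsRightAlmostSplit g)
    {r : M ⟶ Z} (hr : r ∈ rad k M Z) : ∃ l : M ⟶ E, l ≫ g = r :=
  hg.factors r (not_isSplitEpi_of_mem_rad hg.not_isZero hr)

/-- In `p ≫ q` with both factors radical, only `p` has to be factored through `f`; the remaining
factor stays radical because of `q`. Radical factors are what later separates rad from rad². -/
theorem IsLeftAlmostSplit.exists_of_mem_radSq {X E M : C} {f : X ⟶ E} (hf : IsLeftAlmostSplit f)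
    {r : X ⟶ M} (hr : r ∈ radSq k X M) : ∃ l ∈ rad k E M, f ≫ l = r := by
  refine Submodule.span_induction ?_ ⟨0, zero_mem _, comp_zero⟩ ?_ ?_ hr
  · rintro _ ⟨W, p, q, hp, hq, rfl⟩
    obtain ⟨l, rfl⟩ := hf.exists_of_mem_rad hp
    exact ⟨l ≫ q, comp_rad _ hq, by simp⟩
  · rintro _ _ - - ⟨a, ha, rfl⟩ ⟨b, hb, rfl⟩
    exact ⟨a + b, add_mem ha hb, by simp⟩
  · rintro c _ - ⟨a, ha, rfl⟩
    exact ⟨c • a, Submodule.smul_mem _ _ ha, by simp⟩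

theorem IsRightAlmostSplit.exists_of_mem_radSq {E Z M : C} {g : E ⟶ Z}
    (hg : IsRightAlmostSplit g) {r : M ⟶ Z} (hr : r ∈ radSq k M Z) :
    ∃ l ∈ rad k M E, l ≫ g = r := by
  refine Submodule.span_induction ?_ ⟨0, zero_mem _, zero_comp⟩ ?_ ?_ hr
  · rintro _ ⟨W, p, q, hp, hq, rfl⟩
    obtain ⟨l, rfl⟩ := hg.exists_of_mem_rad hq
    exact ⟨p ≫ l, rad_comp hp _, by simp⟩
  · rintro _ _ - - ⟨a, ha, rfl⟩ ⟨b, hb, rfl⟩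
    exact ⟨a + b, add_mem ha hb, by simp⟩
  · rintro c _ - ⟨a, ha, rfl⟩
    exact ⟨c • a, Submodule.smul_mem _ _ ha, by simp⟩

theorem IsSourceMorphism.mem_rad {X E : C} [IsLocalRing (End X)] {f : X ⟶ E}
    (hf : IsSourceMorphism f) : f ∈ rad k X E :=
  mem_rad_of_not_isSplitMono hf.almostSplit.not_section

theorem IsSinkMorphism.mem_rad {E Z : C} [IsLocalRing (End Z)] {g : E ⟶ Z}
    (hg : IsSinkMorphism g) : g ∈ rad k E Z :=
  mem_rad_of_not_isSplitEpi hg.almostSplit.not_retraction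

end MinimalMorphisms

section Transport

variable {C : Type u} [Category.{v} C]

/-- Each source morphism factors through the other. The two composites fix `f` and `f'`, so
minimality makes them automorphisms. -/
theorem IsSourceMorphism.exists_iso {X E E' : C} {f : X ⟶ E} {f' : X ⟶ E'}
    (hf : IsSourceMorphism f) (hf' : IsSourceMorphism f') : ∃ e : E ≅ E', f ≫ e.hom = f' := by
  obtain ⟨h, hh⟩ := hf.almostSplit.factors f' hf'.almostSplit.not_section
  obtain ⟨h', hh'⟩ := hf'.almostSplit.factors f hf.almostSplit.not_section
  have : IsIso h := isIso_of_isIso_comp (h' := h')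
    (hf.minimal _ (by rw [← Category.assoc, hh, hh']))
    (hf'.minimal _ (by rw [← Category.assoc, hh', hh]))
  exact ⟨asIso h, hh⟩

theorem IsSinkMorphism.exists_iso {E E' Z : C} {g : E ⟶ Z} {g' : E' ⟶ Z}
    (hg : IsSinkMorphism g) (hg' : IsSinkMorphism g') : ∃ e : E' ≅ E, e.hom ≫ g = g' := by
  obtain ⟨h, hh⟩ := hg.almostSplit.factors g' hg'.almostSplit.not_retraction
  obtain ⟨h', hh'⟩ := hg'.almostSplit.factors g hg.almostSplit.not_retraction
  have : IsIso h := isIso_of_isIso_comp (h' := h')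
    (hg'.minimal _ (by rw [Category.assoc, hh', hh]))
    (hg.minimal _ (by rw [Category.assoc, hh, hh']))
  exact ⟨asIso h, hh⟩

theorem IsSourceMorphism.transport {X X' E E' : C} {f : X ⟶ E} (hf : IsSourceMorphism f)
    (i : X' ≅ X) (e : E ≅ E') : IsSourceMorphism (i.hom ≫ f ≫ e.hom) where
  minimal h hh := by
    have : IsIso (e.hom ≫ h ≫ e.inv) := hf.minimal _ (by
      rw [← cancel_epi i.hom, ← cancel_mono e.hom]
      simpa using hh)
    have h2 : h = e.inv ≫ (e.hom ≫ h ≫ e.inv) ≫ e.hom := by simp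
    rw [h2]; infer_instance
  almostSplit :=
    { not_section := fun h => hf.almostSplit.not_section
        ⟨⟨e.hom ≫ retraction (i.hom ≫ f ≫ e.hom) ≫ i.hom, by
          rw [← cancel_epi i.hom]
          have := IsSplitMono.id (i.hom ≫ f ≫ e.hom)
          simp only [Category.assoc] at this
          rw [reassoc_of% this]; simp⟩⟩
      factors := fun g hg => by
        obtain ⟨l, hl⟩ := hf.almostSplit.factors (i.inv ≫ g) (fun h => hg
          ⟨⟨retraction (i.inv ≫ g) ≫ i.inv, by
            rw [← cancel_epi i.inv]
            have := IsSplitMono.id (i.inv ≫ g)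
            simp only [Category.assoc] at this
            rw [reassoc_of% this]; simp⟩⟩)
        exact ⟨e.inv ≫ l, by simp [hl]⟩ }

theorem IsSinkMorphism.transport {Z Z' E E' : C} {g : E ⟶ Z} (hg : IsSinkMorphism g)
    (e : E' ≅ E) (i : Z ≅ Z') : IsSinkMorphism (e.hom ≫ g ≫ i.hom) where
  minimal h hh := by
    have : IsIso (e.inv ≫ h ≫ e.hom) := hg.minimal _ (by
      rw [← cancel_epi e.hom, ← cancel_mono i.hom]
      simpa using hh)
    have h2 : h = e.hom ≫ (e.inv ≫ h ≫ e.hom) ≫ e.inv := by simp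
    rw [h2]; infer_instance
  almostSplit :=
    { not_retraction := fun h => hg.almostSplit.not_retraction
        ⟨⟨i.hom ≫ section_ (e.hom ≫ g ≫ i.hom) ≫ e.hom, by
          rw [← cancel_mono i.hom]
          have := IsSplitEpi.id (e.hom ≫ g ≫ i.hom)
          simp [this]⟩⟩
      factors := fun f hf => by
        obtain ⟨l, hl⟩ := hg.almostSplit.factors (f ≫ i.inv) (fun h => hf
          ⟨⟨i.inv ≫ section_ (f ≫ i.inv), by
            rw [← cancel_mono i.inv]
            have := IsSplitEpi.id (f ≫ i.inv)
            simp [this]⟩⟩)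
        exact ⟨l ≫ e.inv, by simp [reassoc_of% hl]⟩ }

theorem IsAlmostSplitSeq.transport [HasZeroMorphisms C] {X X' E E' Z Z' : C} {f : X ⟶ E}
    {g : E ⟶ Z} (h : IsAlmostSplitSeq f g) (i : X' ≅ X) (e : E ≅ E') (j : Z ≅ Z') :
    IsAlmostSplitSeq (i.hom ≫ f ≫ e.hom) (e.inv ≫ g ≫ j.hom) where
  middle_nonzero hE := h.middle_nonzero (hE.of_iso e)
  source := h.source.transport i e
  sink := h.sink.transport e.symm j
  comp_eq_zero := by simp [reassoc_of% h.comp_eq_zero]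
  pseudoKernel p hp := by
    obtain ⟨l, hl⟩ := h.pseudoKernel (p ≫ e.inv) (by
      rw [← cancel_mono j.hom]; simpa using hp)
    exact ⟨l ≫ i.inv, by simp [reassoc_of% hl]⟩
  pseudoCokernel p hp := by
    obtain ⟨l, hl⟩ := h.pseudoCokernel (e.hom ≫ p) (by
      rw [← cancel_epi i.hom]; simpa using hp)
    exact ⟨j.inv ≫ l, by simp [hl]⟩

end Transport

/-- Used with `S` equal to rad²: in a sum over all arrows at a vertex, only those at the given
vertex `j` survive, since the other terms pass through an object not isomorphic to `obj j`. -/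
theorem sum_sigma_sub_sum_mem {R A : Type*} [Ring R] [AddCommGroup A] [Module R A]
    (S : Submodule R A) {J : Type*} {ι : J → Type*} [Fintype (Σ j, ι j)] (j : J)
    [Fintype (ι j)] (F : (Σ j, ι j) → A) (G : ι j → A) (h₁ : ∀ a, a.1 ≠ j → F a ∈ S)
    (h₂ : ∀ i, F ⟨j, i⟩ - G i ∈ S) : ∑ a, F a - ∑ i, G i ∈ S := by
  classical
  have h : ∑ a with a.1 = j, F a = ∑ i, F ⟨j, i⟩ := by
    symm
    refine Finset.sum_bij (fun i _ => ⟨j, i⟩) (by simp) (by simp) ?_ (by simp)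
    rintro ⟨j', i⟩ hb
    obtain rfl : j' = j := by simpa using hb
    exact ⟨i, by simp, rfl⟩
  rw [← Finset.sum_filter_add_sum_filter_not _ (fun a => a.1 = j), h, add_sub_right_comm,
    ← Finset.sum_sub_distrib]
  exact add_mem (sum_mem fun i _ => h₂ i) (sum_mem fun a ha => h₁ a (by simpa using ha))

section BiproductSums

variable {C : Type u} [Category.{v} C] [Preadditive C] {J : Type*} [Fintype J] {f : J → C}
  [HasBiproduct f]

theorem biproduct_total : ∑ j, biproduct.π f j ≫ biproduct.ι f j = 𝟙 (⨁ f) :=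
  IsBilimit.total (biproduct.isBilimit f)

theorem biproduct_lift_desc {X Y : C} (g : ∀ j, X ⟶ f j) (h : ∀ j, f j ⟶ Y) :
    biproduct.lift g ≫ biproduct.desc h = ∑ j, g j ≫ h j := by
  rw [← Category.id_comp (biproduct.desc h), ← biproduct_total, Preadditive.sum_comp,
    Preadditive.comp_sum]
  simp

end BiproductSums

/-! ### Bases of irr(X, Y) as components of source and sink morphisms. -/

section IrrBasis

variable (k : Type w) [Field k] {C : Type u} [Category.{v} C] [Preadditive C] [Linear k C]

/-- The radical morphisms `f i : X ⟶ Y` represent a basis of `irr(X, Y)`. -/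
structure IsIrrBasis {X Y : C} {ι : Type*} [Fintype ι] (f : ι → (X ⟶ Y)) : Prop where
  mem_rad : ∀ i, f i ∈ rad k X Y
  eq_zero : ∀ c : ι → k, ∑ i, c i • f i ∈ radSq k X Y → ∀ i, c i = 0
  exists_sub_mem : ∀ r ∈ rad k X Y, ∃ c : ι → k, r - ∑ i, c i • f i ∈ radSq k X Y

variable {k}

theorem IsIrrBasis.notMem_radSq {X Y : C} {ι : Type*} [Fintype ι] {f : ι → (X ⟶ Y)}
    (hf : IsIrrBasis k f) (i : ι) : f i ∉ radSq k X Y := fun h => by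
  classical
  have := hf.eq_zero (Pi.single i 1) (by simpa [Pi.single_apply, ite_smul] using h) i
  simp at this

theorem IsIrrBasis.reindex {X Y : C} {ι ι' : Type*} [Fintype ι] [Fintype ι'] {f : ι → (X ⟶ Y)}
    (hf : IsIrrBasis k f) (e : ι' ≃ ι) : IsIrrBasis k (f ∘ e) where
  mem_rad i := hf.mem_rad _
  eq_zero c hc i := by
    have := hf.eq_zero (c ∘ e.symm) (by
      rwa [← e.sum_comp, ← Finset.sum_congr rfl (fun i _ => ?_)]; simp) (e i)
    simpa using this
  exists_sub_mem r hr := by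
    obtain ⟨c, hc⟩ := hf.exists_sub_mem r hr
    refine ⟨c ∘ e, ?_⟩
    rwa [← e.sum_comp] at hc

theorem mk_irr_eq_zero {X Y : C} (f : rad k X Y) :
    (Submodule.Quotient.mk f : Irr k X Y) = 0 ↔ (f : X ⟶ Y) ∈ radSq k X Y := by
  rw [Submodule.Quotient.mk_eq_zero]; rfl

theorem IsIrrBasis.card_eq {X Y : C} {ι : Type*} [Fintype ι] {f : ι → (X ⟶ Y)}
    (hf : IsIrrBasis k f) : Fintype.card ι = Module.finrank k (Irr k X Y) := by
  let b : ι → Irr k X Y := fun i => Submodule.Quotient.mk ⟨f i, hf.mem_rad i⟩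
  have hb (c : ι → k) : ∑ i, c i • b i =
      Submodule.Quotient.mk (∑ i, c i • (⟨f i, hf.mem_rad i⟩ : rad k X Y)) := by
    simp only [b, ← Submodule.mkQ_apply, map_sum, map_smul]
  have hli : LinearIndependent k b := by
    rw [Fintype.linearIndependent_iff]
    intro c hc i
    rw [hb, mk_irr_eq_zero] at hc
    exact hf.eq_zero c (by simpa using hc) i
  have hsp : ⊤ ≤ Submodule.span k (Set.range b) := by
    rintro x -
    obtain ⟨⟨r, hr⟩, rfl⟩ := Submodule.Quotient.mk_surjective _ x
    obtain ⟨c, hc⟩ := hf.exists_sub_mem r hr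
    have : (Submodule.Quotient.mk ⟨r, hr⟩ : Irr k X Y) = ∑ i, c i • b i := by
      rw [hb, ← sub_eq_zero, ← Submodule.Quotient.mk_sub, mk_irr_eq_zero]
      simpa using hc
    rw [this]
    exact sum_mem fun i _ => Submodule.smul_mem _ _ (Submodule.subset_span ⟨i, rfl⟩)
  exact (Module.finrank_eq_card_basis (Module.Basis.mk hli hsp)).symm

theorem exists_isIrrBasis (X Y : C) [FiniteDimensional k (X ⟶ Y)] {n : ℕ}
    (hn : n = Module.finrank k (Irr k X Y)) : ∃ f : Fin n → (X ⟶ Y), IsIrrBasis k f := by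
  subst hn
  let b := Module.finBasis k (Irr k X Y)
  choose f hf using fun i => Submodule.Quotient.mk_surjective _ (b i)
  have hsum (c : Fin (Module.finrank k (Irr k X Y)) → k) :
      (Submodule.Quotient.mk (∑ i, c i • f i) : Irr k X Y) = ∑ i, c i • b i := by
    simp only [← hf, ← Submodule.mkQ_apply, map_sum, map_smul]
  refine ⟨fun i => f i, fun i => (f i).2, fun c hc i => ?_, fun r hr => ?_⟩
  · have : (Submodule.Quotient.mk (∑ i, c i • f i) : Irr k X Y) = 0 := by
      rw [mk_irr_eq_zero]; simpa using hc
    rw [hsum] at this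
    exact Fintype.linearIndependent_iff.1 b.linearIndependent c this i
  · refine ⟨b.repr (Submodule.Quotient.mk ⟨r, hr⟩), ?_⟩
    have : (Submodule.Quotient.mk (⟨r, hr⟩ -
        ∑ i, b.repr (Submodule.Quotient.mk ⟨r, hr⟩) i • f i) : Irr k X Y) = 0 := by
      rw [Submodule.Quotient.mk_sub, hsum, b.sum_repr, sub_self]
    rw [mk_irr_eq_zero] at this
    simpa using this

end IrrBasis

section ScalarFamily

variable (k : Type w) [Field k] {C : Type u} [Category.{v} C] [Preadditive C] [Linear k C]

/-- A family of pairwise non-isomorphic objects with trivial automorphism fields. -/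
structure IsScalarFamily {J : Type*} (obj : J → C) : Prop where
  isLocalRing : ∀ j, IsLocalRing (End (obj j))
  exists_sub_mem : ∀ j (h : obj j ⟶ obj j), ∃ c : k, h - c • 𝟙 (obj j) ∈ rad k (obj j) (obj j)
  mem_rad : ∀ i j, i ≠ j → ∀ h : obj i ⟶ obj j, h ∈ rad k (obj i) (obj j)

variable {k} {J : Type*} {obj : J → C} (hobj : IsScalarFamily k obj)

include hobj

theorem IsScalarFamily.not_isZero (j : J) : ¬ IsZero (obj j) :=
  have := hobj.isLocalRing j
  not_isZero_of_isLocalRing_end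

variable {ι : J → Type*} [∀ j, Fintype (ι j)] [Finite (Σ j, ι j)] [HasFiniteBiproducts C]

/-- Independence: a combination lying in rad² is `f ≫ s` with `s` radical, so by minimality the same
combination of projections is radical, and restricting it to one summand leaves a radical scalar
multiple of an identity. Spanning: a radical map factors through the source morphism, and modulo
rad² the coordinates of the second factor are scalars at `j` and vanish elsewhere. -/
theorem IsSourceMorphism.isIrrBasis {X : C} [IsLocalRing (End X)]
    {f : ∀ j, ι j → (X ⟶ obj j)}
    (hf : IsSourceMorphism (biproduct.lift (fun a : Σ j, ι j => f a.1 a.2))) (j : J) :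
    IsIrrBasis k (f j) where
  mem_rad i := by
    have := rad_comp (k := k) hf.mem_rad (biproduct.π (fun a : Σ j, ι j => obj a.1) ⟨j, i⟩)
    simpa using this
  eq_zero c hc i := by
    obtain ⟨s, hs, hs'⟩ := hf.almostSplit.exists_of_mem_radSq hc
    let p (i : ι j) : (⨁ fun a : Σ j, ι j => obj a.1) ⟶ obj j :=
      biproduct.π (fun a : Σ j, ι j => obj a.1) ⟨j, i⟩
    have h₁ : ∑ i, c i • p i ∈ rad k _ _ := by
      rw [← sub_add_cancel (∑ i, c i • p i) s]
      refine add_mem (hf.minimal.mem_rad k ?_) hs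
      rw [Preadditive.comp_sub, hs', Preadditive.comp_sum]
      simp [p]
    have h₂ := comp_rad (biproduct.ι (fun a : Σ j, ι j => obj a.1) ⟨j, i⟩) h₁
    rw [Preadditive.comp_sum, Finset.sum_eq_single i ?_ (by simp)] at h₂
    · exact smul_id_mem_rad (hobj.not_isZero j) (by simpa [p] using h₂)
    · intro i' _ hi'
      rw [Linear.comp_smul, biproduct.ι_π_ne _ (by simpa using hi'.symm), smul_zero]
  exists_sub_mem r hr := by
    have := Fintype.ofFinite (Σ j, ι j)
    obtain ⟨l, rfl⟩ := hf.almostSplit.exists_of_mem_rad hr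
    choose c hc using fun i : ι j => hobj.exists_sub_mem j (biproduct.ι
      (fun a : Σ j, ι j => obj a.1) ⟨j, i⟩ ≫ l)
    have hrad (a : Σ j, ι j) : f a.1 a.2 ∈ rad k X (obj a.1) := by
      have := rad_comp (k := k) hf.mem_rad (biproduct.π (fun a : Σ j, ι j => obj a.1) a)
      simpa using this
    refine ⟨c, ?_⟩
    have hl : l = biproduct.desc fun a => biproduct.ι (fun a : Σ j, ι j => obj a.1) a ≫ l := by
      ext; simp
    rw [hl, biproduct_lift_desc]
    refine sum_sigma_sub_sum_mem _ j _ _ (fun a ha => ?_) (fun i => ?_)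
    · exact comp_mem_radSq (hrad a) (hobj.mem_rad _ _ ha _)
    · have := comp_mem_radSq (hrad ⟨j, i⟩) (hc i)
      simpa [Preadditive.comp_sub] using this

theorem IsSinkMorphism.isIrrBasis {Z : C} [IsLocalRing (End Z)]
    {g : ∀ j, ι j → (obj j ⟶ Z)}
    (hg : IsSinkMorphism (biproduct.desc (fun a : Σ j, ι j => g a.1 a.2))) (j : J) :
    IsIrrBasis k (g j) where
  mem_rad i := by
    have := comp_rad (k := k) (biproduct.ι (fun a : Σ j, ι j => obj a.1) ⟨j, i⟩) hg.mem_rad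
    simpa using this
  eq_zero c hc i := by
    obtain ⟨s, hs, hs'⟩ := hg.almostSplit.exists_of_mem_radSq hc
    let p (i : ι j) : obj j ⟶ (⨁ fun a : Σ j, ι j => obj a.1) :=
      biproduct.ι (fun a : Σ j, ι j => obj a.1) ⟨j, i⟩
    have h₁ : ∑ i, c i • p i ∈ rad k _ _ := by
      rw [← sub_add_cancel (∑ i, c i • p i) s]
      refine add_mem (hg.minimal.mem_rad k ?_) hs
      rw [Preadditive.sub_comp, hs', Preadditive.sum_comp]
      simp [p]
    have h₂ := rad_comp h₁ (biproduct.π (fun a : Σ j, ι j => obj a.1) ⟨j, i⟩)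
    rw [Preadditive.sum_comp, Finset.sum_eq_single i ?_ (by simp)] at h₂
    · exact smul_id_mem_rad (hobj.not_isZero j) (by simpa [p] using h₂)
    · intro i' _ hi'
      rw [Linear.smul_comp, biproduct.ι_π_ne _ (by simpa using hi'), smul_zero]
  exists_sub_mem r hr := by
    have := Fintype.ofFinite (Σ j, ι j)
    obtain ⟨l, rfl⟩ := hg.almostSplit.exists_of_mem_rad hr
    choose c hc using fun i : ι j => hobj.exists_sub_mem j (l ≫ biproduct.π
      (fun a : Σ j, ι j => obj a.1) ⟨j, i⟩)
    have hrad (a : Σ j, ι j) : g a.1 a.2 ∈ rad k (obj a.1) Z := by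
      have := comp_rad (k := k) (biproduct.ι (fun a : Σ j, ι j => obj a.1) a) hg.mem_rad
      simpa using this
    refine ⟨c, ?_⟩
    have hl : l = biproduct.lift fun a => l ≫ biproduct.π (fun a : Σ j, ι j => obj a.1) a := by
      ext; simp
    rw [hl, biproduct_lift_desc]
    refine sum_sigma_sub_sum_mem _ j _ _ (fun a ha => ?_) (fun i => ?_)
    · exact comp_mem_radSq (hobj.mem_rad _ _ (Ne.symm ha) _) (hrad a)
    · have := comp_mem_radSq (hc i) (hrad ⟨j, i⟩)
      simpa [Preadditive.sub_comp] using this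

-- Composing the relation with `q` and reducing modulo rad² leaves a linear relation in irr, whose
-- scalars must vanish. This yields the minimality of the map assembled from the bases.
omit [Finite (Σ j, ι j)] [HasFiniteBiproducts C] in
theorem mem_rad_of_sum_comp_eq_zero [Fintype (Σ j, ι j)] {X M : C}
    {f : ∀ j, ι j → (X ⟶ obj j)} (hf : ∀ j, IsIrrBasis k (f j))
    {l : ∀ a : Σ j, ι j, obj a.1 ⟶ M} (hl : ∑ a : Σ j, ι j, f a.1 a.2 ≫ l a = 0)
    (a : Σ j, ι j) : l a ∈ rad k (obj a.1) M := fun q => by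
  obtain ⟨j, i₀⟩ := a
  choose c hc using fun i : ι j => hobj.exists_sub_mem j (l ⟨j, i⟩ ≫ q)
  have h := sum_sigma_sub_sum_mem (radSq k X (obj j)) j
    (fun a : Σ j, ι j => (f a.1 a.2 ≫ l a) ≫ q) (fun i => c i • f j i) (fun a ha => ?_)
    (fun i => ?_)
  · rw [← Preadditive.sum_comp, hl, zero_comp, zero_sub] at h
    have h₀ := (hf j).eq_zero c (by simpa using neg_mem h) i₀
    have h₁ := hc i₀
    rw [h₀, zero_smul, sub_zero] at h₁
    exact isIso_one_sub h₁
  · rw [Category.assoc]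
    exact comp_mem_radSq ((hf _).mem_rad _) (hobj.mem_rad _ _ ha _)
  · have := comp_mem_radSq ((hf j).mem_rad i) (hc i)
    simpa [Preadditive.comp_sub] using this

omit [Finite (Σ j, ι j)] [HasFiniteBiproducts C] in
theorem mem_rad_of_sum_comp_eq_zero' [Fintype (Σ j, ι j)] {Z M : C}
    {g : ∀ j, ι j → (obj j ⟶ Z)} (hg : ∀ j, IsIrrBasis k (g j))
    {l : ∀ a : Σ j, ι j, M ⟶ obj a.1} (hl : ∑ a : Σ j, ι j, l a ≫ g a.1 a.2 = 0)
    (a : Σ j, ι j) : l a ∈ rad k M (obj a.1) := mem_rad'.2 fun q => by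
  obtain ⟨j, i₀⟩ := a
  choose c hc using fun i : ι j => hobj.exists_sub_mem j (q ≫ l ⟨j, i⟩)
  have h := sum_sigma_sub_sum_mem (radSq k (obj j) Z) j
    (fun a : Σ j, ι j => q ≫ l a ≫ g a.1 a.2) (fun i => c i • g j i) (fun a ha => ?_)
    (fun i => ?_)
  · rw [← Preadditive.comp_sum, hl, comp_zero, zero_sub] at h
    have h₀ := (hg j).eq_zero c (by simpa using neg_mem h) i₀
    have h₁ := hc i₀
    rw [h₀, zero_smul, sub_zero] at h₁
    exact isIso_one_sub h₁
  · rw [← Category.assoc]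
    exact comp_mem_radSq (hobj.mem_rad _ _ (Ne.symm ha) _) ((hg _).mem_rad _)
  · have := comp_mem_radSq (hc i) ((hg j).mem_rad i)
    simpa [Preadditive.sub_comp] using this

/-- A Nakayama argument. Since the bases span irr, the known source morphism satisfies `f₀ = f' ≫ c
+ f₀ ≫ s` with `s` radical; as `1 - s` is invertible, `f₀` factors through `f'`, and so does
everything that factors through `f₀`. -/
theorem isSourceMorphism_lift {X E : C} [IsLocalRing (End X)] {f₀ : X ⟶ E}
    (hf₀ : IsSourceMorphism f₀) {n : ℕ} {e : Fin n → J} (hE : E ≅ ⨁ fun i => obj (e i))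
    {f : ∀ j, ι j → (X ⟶ obj j)} (hf : ∀ j, IsIrrBasis k (f j)) :
    IsSourceMorphism (biproduct.lift (fun a : Σ j, ι j => f a.1 a.2)) := by
  have := Fintype.ofFinite (Σ j, ι j)
  set f' := biproduct.lift (fun a : Σ j, ι j => f a.1 a.2) with hf'
  have hrad : f' ∈ rad k _ _ := by
    rw [← Category.comp_id f', ← biproduct_total, Preadditive.comp_sum]
    refine sum_mem fun a _ => ?_
    rw [← Category.assoc, biproduct.lift_π]
    exact rad_comp ((hf _).mem_rad _) _
  refine ⟨isLeftMinimal_of_mem_rad (k := k) fun p hp => ?_,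
    not_isSplitMono_of_mem_rad hf₀.almostSplit.not_isZero hrad, fun {M} g hg => ?_⟩
  · rw [← Category.id_comp p, ← biproduct_total, Preadditive.sum_comp]
    refine sum_mem fun a _ => ?_
    rw [Category.assoc]
    refine comp_rad _ (mem_rad_of_sum_comp_eq_zero hobj hf
      (l := fun a => biproduct.ι (fun a : Σ j, ι j => obj a.1) a ≫ p) ?_ a)
    rw [← biproduct_lift_desc, ← hp]
    congr 1
    ext; simp
  · have key : ∃ c : (⨁ fun a : Σ j, ι j => obj a.1) ⟶ E, ∃ s ∈ rad k E E,
        f₀ = f' ≫ c + f₀ ≫ s := by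
      -- One component of `f₀` at a time: it is a combination of basis elements up to rad², and the
      -- error factors through `f₀` by a radical map.
      have hm (m : Fin n) : ∃ c : (⨁ fun a : Σ j, ι j => obj a.1) ⟶ obj (e m),
          ∃ s ∈ rad k E (obj (e m)), f₀ ≫ hE.hom ≫ biproduct.π _ m = f' ≫ c + f₀ ≫ s := by
        have hr : f₀ ≫ hE.hom ≫ biproduct.π _ m ∈ rad k X (obj (e m)) :=
          rad_comp hf₀.mem_rad _
        obtain ⟨c, hc⟩ := (hf (e m)).exists_sub_mem _ hr
        obtain ⟨s, hs, hs'⟩ := hf₀.almostSplit.exists_of_mem_radSq hc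
        refine ⟨∑ i, c i • biproduct.π (fun a : Σ j, ι j => obj a.1) ⟨e m, i⟩, s, hs, ?_⟩
        rw [hs', Preadditive.comp_sum]
        simp [f']
      choose c s hs hcs using hm
      refine ⟨∑ m, c m ≫ biproduct.ι (fun i => obj (e i)) m ≫ hE.inv,
        ∑ m, s m ≫ biproduct.ι (fun i => obj (e i)) m ≫ hE.inv,
        sum_mem fun m _ => rad_comp (hs m) _, ?_⟩
      rw [Preadditive.comp_sum, Preadditive.comp_sum, ← Finset.sum_add_distrib]
      calc f₀ = f₀ ≫ hE.hom ≫ 𝟙 _ ≫ hE.inv := by simp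
        _ = _ := by
          rw [← biproduct_total, Preadditive.sum_comp, Preadditive.comp_sum,
            Preadditive.comp_sum]
          refine Finset.sum_congr rfl fun m _ => ?_
          rw [← Category.assoc (f := f'), ← Category.assoc (f := f₀) (g := s m),
            ← Preadditive.add_comp, ← hcs]
          simp
    obtain ⟨c, s, hs, hcs⟩ := key
    have hiso := isIso_one_sub hs
    obtain ⟨h, rfl⟩ := hf₀.almostSplit.factors g hg
    refine ⟨c ≫ inv (𝟙 E - s) ≫ h, ?_⟩
    have : f' ≫ c = f₀ ≫ (𝟙 E - s) := by
      rw [Preadditive.comp_sub, Category.comp_id, eq_sub_iff_add_eq, ← hcs]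
    rw [reassoc_of% this]; simp

theorem isSinkMorphism_desc {Z E : C} [IsLocalRing (End Z)] {g₀ : E ⟶ Z}
    (hg₀ : IsSinkMorphism g₀) {n : ℕ} {e : Fin n → J} (hE : E ≅ ⨁ fun i => obj (e i))
    {g : ∀ j, ι j → (obj j ⟶ Z)} (hg : ∀ j, IsIrrBasis k (g j)) :
    IsSinkMorphism (biproduct.desc (fun a : Σ j, ι j => g a.1 a.2)) := by
  have := Fintype.ofFinite (Σ j, ι j)
  set g' := biproduct.desc (fun a : Σ j, ι j => g a.1 a.2) with hg'
  have hrad : g' ∈ rad k _ _ := by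
    rw [← Category.id_comp g', ← biproduct_total, Preadditive.sum_comp]
    refine sum_mem fun a _ => ?_
    rw [Category.assoc, biproduct.ι_desc]
    exact comp_rad _ ((hg _).mem_rad _)
  refine ⟨isRightMinimal_of_mem_rad (k := k) fun p hp => ?_,
    not_isSplitEpi_of_mem_rad hg₀.almostSplit.not_isZero hrad, fun {M} f hf => ?_⟩
  · rw [← Category.comp_id p, ← biproduct_total, Preadditive.comp_sum]
    refine sum_mem fun a _ => ?_
    rw [← Category.assoc]
    refine rad_comp (mem_rad_of_sum_comp_eq_zero' hobj hg
      (l := fun a => p ≫ biproduct.π (fun a : Σ j, ι j => obj a.1) a) ?_ a) _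
    rw [← biproduct_lift_desc, ← hp]
    congr 1
    ext; simp
  · have key : ∃ c : E ⟶ (⨁ fun a : Σ j, ι j => obj a.1), ∃ s ∈ rad k E E,
        g₀ = c ≫ g' + s ≫ g₀ := by
      have hm (m : Fin n) : ∃ c : obj (e m) ⟶ (⨁ fun a : Σ j, ι j => obj a.1),
          ∃ s ∈ rad k (obj (e m)) E,
          biproduct.ι (fun i => obj (e i)) m ≫ hE.inv ≫ g₀ = c ≫ g' + s ≫ g₀ := by
        have hr : biproduct.ι (fun i => obj (e i)) m ≫ hE.inv ≫ g₀ ∈ rad k (obj (e m)) Z :=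
          comp_rad _ (comp_rad _ hg₀.mem_rad)
        obtain ⟨c, hc⟩ := (hg (e m)).exists_sub_mem _ hr
        obtain ⟨s, hs, hs'⟩ := hg₀.almostSplit.exists_of_mem_radSq hc
        refine ⟨∑ i, c i • biproduct.ι (fun a : Σ j, ι j => obj a.1) ⟨e m, i⟩, s, hs, ?_⟩
        rw [hs', Preadditive.sum_comp]
        simp [g']
      choose c s hs hcs using hm
      refine ⟨∑ m, hE.hom ≫ biproduct.π (fun i => obj (e i)) m ≫ c m,
        ∑ m, hE.hom ≫ biproduct.π (fun i => obj (e i)) m ≫ s m,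
        sum_mem fun m _ => comp_rad _ (comp_rad _ (hs m)), ?_⟩
      rw [Preadditive.sum_comp, Preadditive.sum_comp, ← Finset.sum_add_distrib]
      calc g₀ = hE.hom ≫ 𝟙 _ ≫ hE.inv ≫ g₀ := by simp
        _ = _ := by
          rw [← biproduct_total, Preadditive.sum_comp, Preadditive.comp_sum]
          refine Finset.sum_congr rfl fun m _ => ?_
          simp only [Category.assoc]
          rw [← Preadditive.comp_add, ← Preadditive.comp_add, ← hcs]
    obtain ⟨c, s, hs, hcs⟩ := key
    have hiso := isIso_one_sub hs
    obtain ⟨h, rfl⟩ := hg₀.almostSplit.factors f hf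
    refine ⟨h ≫ inv (𝟙 E - s) ≫ c, ?_⟩
    have : c ≫ g' = (𝟙 E - s) ≫ g₀ := by
      rw [Preadditive.sub_comp, Category.id_comp, eq_sub_iff_add_eq, ← hcs]
    rw [Category.assoc, Category.assoc, this, IsIso.inv_hom_id_assoc]

-- A basis element factors through `f₀`. Were its target not among the summands of `E`, the second
-- factor would be radical and the element would lie in rad². So finitely many targets carry all
-- basis elements.
omit [Finite (Σ j, ι j)] in
theorem finite_sigma_of_isSourceMorphism {X E : C} [IsLocalRing (End X)] {f₀ : X ⟶ E}
    (hf₀ : IsSourceMorphism f₀) {n : ℕ} {e : Fin n → J} (hE : E ≅ ⨁ fun i => obj (e i))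
    {f : ∀ j, ι j → (X ⟶ obj j)} (hf : ∀ j, IsIrrBasis k (f j)) : Finite (Σ j, ι j) := by
  refine Finite.of_surjective (fun a : Σ m : Fin n, ι (e m) => ⟨e a.1, a.2⟩) ?_
  rintro ⟨j, i⟩
  by_cases hj : ∃ m, e m = j
  · obtain ⟨m, rfl⟩ := hj
    exact ⟨⟨m, i⟩, rfl⟩
  · refine ((hf j).notMem_radSq i ?_).elim
    obtain ⟨l, hl⟩ := hf₀.almostSplit.exists_of_mem_rad ((hf j).mem_rad i)
    rw [← hl]
    refine comp_mem_radSq hf₀.mem_rad ?_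
    rw [← Category.id_comp l, ← hE.hom_inv_id, ← Category.comp_id hE.hom, ← biproduct_total,
      Preadditive.comp_sum, Preadditive.sum_comp, Preadditive.sum_comp]
    refine sum_mem fun m _ => ?_
    simp only [Category.assoc]
    exact comp_rad _ (comp_rad _ (hobj.mem_rad _ _ (fun h => hj ⟨m, h⟩) _))

omit [Finite (Σ j, ι j)] in
theorem finite_sigma_of_isSinkMorphism {Z E : C} [IsLocalRing (End Z)] {g₀ : E ⟶ Z}
    (hg₀ : IsSinkMorphism g₀) {n : ℕ} {e : Fin n → J} (hE : E ≅ ⨁ fun i => obj (e i))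
    {g : ∀ j, ι j → (obj j ⟶ Z)} (hg : ∀ j, IsIrrBasis k (g j)) : Finite (Σ j, ι j) := by
  refine Finite.of_surjective (fun a : Σ m : Fin n, ι (e m) => ⟨e a.1, a.2⟩) ?_
  rintro ⟨j, i⟩
  by_cases hj : ∃ m, e m = j
  · obtain ⟨m, rfl⟩ := hj
    exact ⟨⟨m, i⟩, rfl⟩
  · refine ((hg j).notMem_radSq i ?_).elim
    obtain ⟨l, hl⟩ := hg₀.almostSplit.exists_of_mem_rad ((hg j).mem_rad i)
    rw [← hl]
    refine comp_mem_radSq ?_ hg₀.mem_rad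
    rw [← Category.comp_id l, ← hE.hom_inv_id, ← Category.comp_id hE.hom, ← biproduct_total,
      Preadditive.comp_sum, Preadditive.sum_comp, Preadditive.comp_sum]
    refine sum_mem fun m _ => ?_
    simp only [← Category.assoc]
    exact rad_comp (rad_comp (hobj.mem_rad _ _ (fun h => hj ⟨m, h.symm⟩) _) _) _

end ScalarFamily

/-! ### Indecomposable objects and Krull-Schmidt decompositions. -/

section Indecomposables

variable {C : Type u} [Category.{v} C] [Preadditive C]

theorem isZero_of_isSplitMono_fst [HasBinaryBiproducts C] {X A B : C} (i : X ≅ A ⊞ B)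
    (h : Mono (i.hom ≫ biprod.fst)) : IsZero B := by
  have h₁ : biprod.inr ≫ i.inv = 0 := by
    rw [← cancel_mono (i.hom ≫ biprod.fst)]; simp
  rw [IsZero.iff_id_eq_zero, ← biprod.inr_snd (X := A), ← Category.id_comp biprod.snd,
    ← i.inv_hom_id, Category.assoc, reassoc_of% h₁, zero_comp]

theorem isZero_of_isSplitMono_snd [HasBinaryBiproducts C] {X A B : C} (i : X ≅ A ⊞ B)
    (h : Mono (i.hom ≫ biprod.snd)) : IsZero A := by
  have h₁ : biprod.inl ≫ i.inv = 0 := by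
    rw [← cancel_mono (i.hom ≫ biprod.snd)]; simp
  rw [IsZero.iff_id_eq_zero, ← biprod.inl_fst (Y := B), ← Category.id_comp biprod.fst,
    ← i.inv_hom_id, Category.assoc, reassoc_of% h₁, zero_comp]

theorem isZero_of_epi_inl [HasBinaryBiproducts C] {X A B : C} (i : A ⊞ B ≅ X)
    (h : Epi (biprod.inl ≫ i.hom)) : IsZero B := by
  have h₁ : i.inv ≫ biprod.snd = 0 := by
    rw [← cancel_epi (biprod.inl ≫ i.hom)]; simp
  rw [IsZero.iff_id_eq_zero, ← biprod.inr_snd (X := A), ← Category.id_comp biprod.snd,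
    ← i.hom_inv_id, Category.assoc, h₁, comp_zero, comp_zero]

theorem isZero_of_epi_inr [HasBinaryBiproducts C] {X A B : C} (i : A ⊞ B ≅ X)
    (h : Epi (biprod.inr ≫ i.hom)) : IsZero A := by
  have h₁ : i.inv ≫ biprod.fst = 0 := by
    rw [← cancel_epi (biprod.inr ≫ i.hom)]; simp
  rw [IsZero.iff_id_eq_zero, ← biprod.inl_fst (Y := B), ← Category.id_comp biprod.fst,
    ← i.hom_inv_id, Category.assoc, h₁, comp_zero, comp_zero]

/-- If `X` had two non-zero summands, neither projection would be a split monomorphism. Both would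
factor through `f`, and reassembling the factors would split `f`. -/
theorem IsLeftAlmostSplit.indecomposable [HasBinaryBiproducts C] {X E : C} {f : X ⟶ E}
    (hf : IsLeftAlmostSplit f) : Indecomposable X := by
  refine ⟨hf.not_isZero, fun A B i => ?_⟩
  by_contra! h
  obtain ⟨l₁, h₁⟩ := hf.factors (i.hom ≫ biprod.fst)
    (fun _ => h.2 (isZero_of_isSplitMono_fst i inferInstance))
  obtain ⟨l₂, h₂⟩ := hf.factors (i.hom ≫ biprod.snd)
    (fun _ => h.1 (isZero_of_isSplitMono_snd i inferInstance))
  refine hf.not_section ⟨⟨(l₁ ≫ biprod.inl + l₂ ≫ biprod.inr) ≫ i.inv, ?_⟩⟩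
  rw [← Category.assoc, Preadditive.comp_add, ← Category.assoc, ← Category.assoc, h₁, h₂,
    Category.assoc, Category.assoc, ← Preadditive.comp_add, biprod.total]
  simp

theorem IsRightAlmostSplit.indecomposable [HasBinaryBiproducts C] {E Z : C} {g : E ⟶ Z}
    (hg : IsRightAlmostSplit g) : Indecomposable Z := by
  refine ⟨hg.not_isZero, fun A B i => ?_⟩
  by_contra! h
  obtain ⟨l₁, h₁⟩ := hg.factors (biprod.inl ≫ i.inv)
    (fun _ => h.2 (isZero_of_epi_inl i.symm (by dsimp; infer_instance)))
  obtain ⟨l₂, h₂⟩ := hg.factors (biprod.inr ≫ i.inv)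
    (fun _ => h.1 (isZero_of_epi_inr i.symm (by dsimp; infer_instance)))
  refine hg.not_retraction ⟨⟨i.hom ≫ (biprod.fst ≫ l₁ + biprod.snd ≫ l₂), ?_⟩⟩
  rw [Category.assoc, Preadditive.add_comp, Category.assoc, Category.assoc, h₁, h₂,
    ← Category.assoc, ← Category.assoc, ← Preadditive.add_comp, biprod.total]
  simp

theorem indecomposable_of_isLocalRing [HasBinaryBiproducts C] {X : C} [IsLocalRing (End X)] :
    Indecomposable X := by
  refine ⟨not_isZero_of_isLocalRing_end, fun A B i => ?_⟩
  rcases IsLocalRing.isUnit_or_isUnit_of_add_one (R := End X)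
    (a := i.hom ≫ (biprod.fst ≫ biprod.inl) ≫ i.inv)
    (b := i.hom ≫ (biprod.snd ≫ biprod.inr) ≫ i.inv) (by
      change _ + _ = 𝟙 X
      rw [← Preadditive.comp_add, ← Preadditive.add_comp, biprod.total]; simp) with h | h
  · right
    have := (isUnit_iff_isIso _).1 h
    refine isZero_of_isSplitMono_fst i ?_
    have : Mono ((i.hom ≫ biprod.fst) ≫ biprod.inl ≫ i.inv) := by
      simpa using (inferInstance : Mono (i.hom ≫ (biprod.fst ≫ biprod.inl) ≫ i.inv))
    exact mono_of_mono _ (biprod.inl ≫ i.inv)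
  · left
    have := (isUnit_iff_isIso _).1 h
    refine isZero_of_isSplitMono_snd i ?_
    have : Mono ((i.hom ≫ biprod.snd) ≫ biprod.inr ≫ i.inv) := by
      simpa using (inferInstance : Mono (i.hom ≫ (biprod.snd ≫ biprod.inr) ≫ i.inv))
    exact mono_of_mono _ (biprod.inr ≫ i.inv)

theorem isLocalRing_end_of_iso {X Y : C} (e : X ≅ Y) (h : IsLocalRing (End X)) :
    IsLocalRing (End Y) := by
  have : Nontrivial (End Y) := ⟨𝟙 Y, 0, fun h0 => by
    have : IsZero Y := (IsZero.iff_id_eq_zero Y).2 h0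
    exact not_isZero_of_isLocalRing_end (this.of_iso e)⟩
  refine ⟨fun {a b} hab => ?_⟩
  have hab' : (show Y ⟶ Y from a) + (show Y ⟶ Y from b) = 𝟙 Y := hab
  have (c : Y ⟶ Y) (hc : IsUnit (M := End X) (e.hom ≫ c ≫ e.inv)) : IsUnit (M := End Y) c := by
    have := (isUnit_iff_isIso _).1 hc
    have h2 : c = e.inv ≫ (e.hom ≫ c ≫ e.inv) ≫ e.hom := by simp
    refine (isUnit_iff_isIso _).2 ?_
    rw [h2]; infer_instance
  rcases IsLocalRing.isUnit_or_isUnit_of_add_one (R := End X)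
    (a := e.hom ≫ (show Y ⟶ Y from a) ≫ e.inv) (b := e.hom ≫ (show Y ⟶ Y from b) ≫ e.inv) (by
      change _ + _ = 𝟙 X
      rw [← Preadditive.comp_add, ← Preadditive.add_comp, hab']; simp) with h | h
  · exact Or.inl (this _ h)
  · exact Or.inr (this _ h)

variable [HasFiniteBiproducts C]

theorem Indecomposable.isLocalRing_end (hKS : IsKrullSchmidt C) {X : C}
    (hX : haveI := hasBinaryBiproducts_of_finite_biproducts C; Indecomposable X) :
    IsLocalRing (End X) := by
  have := hasBinaryBiproducts_of_finite_biproducts C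
  obtain ⟨n, Y, hY, ⟨i⟩⟩ := hKS X hX.1
  have hn : n ≠ 0 := by
    rintro rfl
    refine hX.1 ((IsZero.iff_id_eq_zero _).2 ?_)
    rw [← i.hom_inv_id, ← Category.comp_id i.hom, ← biproduct_total]
    simp
  obtain ⟨n, rfl⟩ := Nat.exists_eq_succ_of_ne_zero hn
  classical
  -- The first summand is split off; indecomposability then annihilates the sum of all others.
  let b : BinaryBicone (Y 0) (⨁ Subtype.restrict (fun j => j ≠ 0) Y) :=
    { pt := ⨁ Y
      fst := biproduct.π Y 0
      snd := biproduct.toSubtype Y (fun j => j ≠ 0)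
      inl := biproduct.ι Y 0
      inr := biproduct.fromSubtype Y (fun j => j ≠ 0)
      inl_fst := by simp
      inl_snd := by ext; simp [biproduct.ι_toSubtype]
      inr_fst := by ext; simp [biproduct.fromSubtype_π]
      inr_snd := by simp }
  have hb : b.IsBilimit := isBinaryBilimitOfTotal b (by
    ext j l
    by_cases hj : j = 0
    · subst hj
      simp [b]
    · simp [b, biproduct.ι_π_ne Y (Ne.symm hj), hj])
  have j : X ≅ Y 0 ⊞ (⨁ Subtype.restrict (fun j => j ≠ 0) Y) :=
    i ≪≫ biprod.uniqueUpToIso _ _ hb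
  have hz : IsZero (⨁ Subtype.restrict (fun j => j ≠ 0) Y) :=
    (hX.2 _ _ j).resolve_left (have := hY 0; not_isZero_of_isLocalRing_end)
  have hid : 𝟙 (⨁ Subtype.restrict (fun j => j ≠ 0) Y) = 0 := hz.eq_of_src _ _
  have e : Y 0 ≅ X := 
    { hom := biprod.inl ≫ j.inv
      inv := j.hom ≫ biprod.fst
      inv_hom_id := by
        have h2 : biprod.fst ≫ biprod.inl =
            𝟙 (Y 0 ⊞ (⨁ Subtype.restrict (fun j => j ≠ 0) Y)) := by
          rw [← biprod.total, ← Category.id_comp biprod.inr, hid]; simp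
        rw [Category.assoc, reassoc_of% h2]; simp }
  exact isLocalRing_end_of_iso e (hY 0)

section Representatives

variable (hKS : IsKrullSchmidt C) {V : Set C} (hV : IsCompleteSetOfIndecomposables V)

include hV

theorem IsCompleteSetOfIndecomposables.eq_of_iso {X Y : C} (hX : X ∈ V) (hY : Y ∈ V) (e : X ≅ Y) :
    X = Y :=
  (hV.2 X (hV.1 X hX)).unique ⟨hX, ⟨Iso.refl _⟩⟩ ⟨hY, ⟨e⟩⟩

include hKS

theorem IsCompleteSetOfIndecomposables.isLocalRing_end {X : C} (hX : X ∈ V) :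
    IsLocalRing (End X) :=
  Indecomposable.isLocalRing_end hKS (hV.1 X hX)

theorem IsCompleteSetOfIndecomposables.exists_iso_biproduct (E : C) :
    ∃ (n : ℕ) (v : Fin n → V), Nonempty (E ≅ ⨁ fun i => (v i : C)) := by
  have := hasBinaryBiproducts_of_finite_biproducts C
  by_cases hE : IsZero E
  · refine ⟨0, Fin.elim0, ⟨hE.iso ((IsZero.iff_id_eq_zero _).2 ?_)⟩⟩
    rw [← biproduct_total]; simp
  · obtain ⟨n, Y, hY, ⟨i⟩⟩ := hKS E hE
    choose v hv using fun m => (hV.2 (Y m) (have := hY m; indecomposable_of_isLocalRing)).exists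
    exact ⟨n, fun m => ⟨v m, (hv m).1⟩, ⟨i ≪≫ biproduct.mapIso fun m => (hv m).2.some⟩⟩

theorem IsCompleteSetOfIndecomposables.mem_rad_of_ne (k : Type w) [Field k] [Linear k C]
    {X Y : C} (hX : X ∈ V) (hY : Y ∈ V) (h : X ≠ Y) (f : X ⟶ Y) : f ∈ rad k X Y := by
  have := hV.isLocalRing_end hKS hX
  have := hV.isLocalRing_end hKS hY
  refine mem_rad_of_not_isSplitMono fun hf => h (hV.eq_of_iso hX hY ?_)
  have := isIso_of_comp_eq_id (IsSplitMono.id f)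
  exact asIso f

/-- Comparing through the pseudo-kernels gives `a ≫ b` fixing `f`. If `X ≠ X'`, then `a` is radical
and `1 - a ≫ b` is invertible, so `f = 0`; minimality then makes the middle term zero. -/
theorem IsAlmostSplitSeq.left_unique (k : Type w) [Field k]
    [Linear k C] {X X' E E' Z : C}
    (hX : X ∈ V) (hX' : X' ∈ V) {f : X ⟶ E} {g : E ⟶ Z} {f' : X' ⟶ E'} {g' : E' ⟶ Z}
    (h : IsAlmostSplitSeq f g) (h' : IsAlmostSplitSeq f' g') : X = X' := by
  by_contra hne
  obtain ⟨e, he⟩ := h.sink.exists_iso h'.sink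
  obtain ⟨b, hb⟩ := h.pseudoKernel (f' ≫ e.hom) (by rw [Category.assoc, he, h'.comp_eq_zero])
  obtain ⟨a, ha⟩ := h'.pseudoKernel (f ≫ e.inv) (by rw [← he]; simp [h.comp_eq_zero])
  have hab : (a ≫ b) ≫ f = f := by
    rw [Category.assoc, hb, reassoc_of% ha]; simp
  have := isIso_one_sub (rad_comp (hV.mem_rad_of_ne hKS k hX hX' hne a) b)
  have hf : f = 0 := by
    rw [← cancel_epi (𝟙 X - a ≫ b), Preadditive.sub_comp, hab]; simp
  have := h.source.minimal 0 (by simp [hf])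
  exact h.middle_nonzero ((IsZero.iff_id_eq_zero _).2 (by
    rw [← IsIso.hom_inv_id (0 : E ⟶ E), zero_comp]))

theorem IsAlmostSplitSeq.right_unique (k : Type w) [Field k]
    [Linear k C] {X E E' Z Z' : C}
    (hZ : Z ∈ V) (hZ' : Z' ∈ V) {f : X ⟶ E} {g : E ⟶ Z} {f' : X ⟶ E'} {g' : E' ⟶ Z'}
    (h : IsAlmostSplitSeq f g) (h' : IsAlmostSplitSeq f' g') : Z = Z' := by
  by_contra hne
  obtain ⟨e, he⟩ := h.source.exists_iso h'.source
  obtain ⟨b, hb⟩ := h.pseudoCokernel (e.hom ≫ g') (by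
    rw [← Category.assoc, he, h'.comp_eq_zero])
  obtain ⟨a, ha⟩ := h'.pseudoCokernel (e.inv ≫ g) (by rw [← he]; simp [h.comp_eq_zero])
  have hab : g ≫ (b ≫ a) = g := by
    rw [← Category.assoc, hb, Category.assoc, ha]; simp
  have := isIso_one_sub (rad_comp (hV.mem_rad_of_ne hKS k hZ hZ' hne b) a)
  have hg : g = 0 := by
    rw [← cancel_mono (𝟙 Z - b ≫ a), Preadditive.comp_sub, hab]; simp
  have := h.sink.minimal 0 (by simp [hg])
  exact h.middle_nonzero ((IsZero.iff_id_eq_zero _).2 (by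
    rw [← IsIso.hom_inv_id (0 : E ⟶ E), zero_comp]))

end Representatives

end Indecomposables

/-! ### Trivial automorphism fields and the existence of arrows. -/

section TrivialAutField

variable {k : Type w} [Field k] {C : Type u} [Category.{v} C] [Preadditive C] [Linear k C]

theorem HasTrivialAutField.exists_sub_mem {X : C} (h : HasTrivialAutField k X) (f : X ⟶ X) :
    ∃ c : k, f - c • 𝟙 X ∈ rad k X X := by
  obtain ⟨e⟩ := h
  let q : AutField k X := Ideal.Quotient.mk (radIdeal k X) f
  refine ⟨e q, ?_⟩
  have h₁ : q = algebraMap k (AutField k X) (e q) := by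
    apply e.injective
    rw [e.commutes]; rfl
  have h₂ : Ideal.Quotient.mk (radIdeal k X) f =
      Ideal.Quotient.mk (radIdeal k X) (algebraMap k (End X) (e q)) := h₁
  rw [Ideal.Quotient.mk_eq_mk_iff_sub_mem, Algebra.algebraMap_eq_smul_one] at h₂
  exact h₂

theorem hasTrivialAutField_of_exists_sub_mem {X : C} (hX : ¬ IsZero X)
    (h : ∀ f : X ⟶ X, ∃ c : k, f - c • 𝟙 X ∈ rad k X X) : HasTrivialAutField k X := by
  have : Nontrivial (AutField k X) := Ideal.Quotient.nontrivial_iff.2 fun h => by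
    have h1 : (1 : End X) ∈ radIdeal k X := by rw [h]; trivial
    exact id_notMem_rad (k := k) hX h1
  refine ⟨(AlgEquiv.ofBijective (Algebra.ofId k (AutField k X))
    ⟨(algebraMap k (AutField k X)).injective, fun q => ?_⟩).symm⟩
  obtain ⟨f, rfl⟩ := Ideal.Quotient.mk_surjective q
  obtain ⟨c, hc⟩ := h f
  refine ⟨c, ?_⟩
  have : Ideal.Quotient.mk (radIdeal k X) f =
      Ideal.Quotient.mk (radIdeal k X) (algebraMap k (End X) c) := by
    rw [Ideal.Quotient.mk_eq_mk_iff_sub_mem, Algebra.algebraMap_eq_smul_one]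
    exact hc
  exact this.symm

theorem HasTrivialAutField.finrank_eq {X : C} (h : HasTrivialAutField k X) :
    Module.finrank k (AutField k X) = 1 := by
  obtain ⟨e⟩ := h
  rw [e.toLinearEquiv.finrank_eq, Module.finrank_self]

theorem numArrows_eq_finrank {X Y : C} (hX : HasTrivialAutField k X)
    (hY : HasTrivialAutField k Y) : numArrows k X Y = Module.finrank k (Irr k X Y) := by
  simp [numArrows, valLeft, valRight, hX.finrank_eq, hY.finrank_eq]

/-- One trivial side suffices: if the two valuations agree, their common value is dim irr(X, Y) > 0,
computed on the trivial side; if they differ, there is one arrow by definition. -/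
theorem numArrows_pos [∀ X Y : C, FiniteDimensional k (X ⟶ Y)] {X Y : C}
    (h : HasTrivialAutField k X ∨ HasTrivialAutField k Y) {r : X ⟶ Y} (hr : r ∈ rad k X Y)
    (hr' : r ∉ radSq k X Y) : 0 < numArrows k X Y := by
  have : Nontrivial (Irr k X Y) := ⟨Submodule.Quotient.mk ⟨r, hr⟩, 0, fun h => hr' (by
    rwa [mk_irr_eq_zero] at h)⟩
  have hpos : 0 < Module.finrank k (Irr k X Y) := Module.finrank_pos
  unfold numArrows
  split_ifs with heq
  · rcases h with h | h
    · rw [heq, valLeft, h.finrank_eq, Nat.div_one]; exact hpos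
    · rw [valRight, h.finrank_eq, Nat.div_one]; exact hpos
  · exact one_pos

theorem IsAlmostSplitSeq.not_mono_of_comp_eq_zero {X E Z M : C} {f : X ⟶ E} {g : E ⟶ Z}
    (h : IsAlmostSplitSeq f g) {p : Z ⟶ M} (hp : g ≫ p = 0) : ¬ Mono p := fun hm => by
  have hg : g = 0 := by rw [← cancel_mono p, hp, zero_comp]
  have := h.sink.minimal 0 (by simp [hg])
  exact h.middle_nonzero ((IsZero.iff_id_eq_zero _).2 (by
    rw [← IsIso.hom_inv_id (0 : E ⟶ E), zero_comp]))

theorem IsAlmostSplitSeq.not_epi_of_comp_eq_zero {X E Z M : C} {f : X ⟶ E} {g : E ⟶ Z}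
    (h : IsAlmostSplitSeq f g) {p : M ⟶ X} (hp : p ≫ f = 0) : ¬ Epi p := fun hm => by
  have hf : f = 0 := by rw [← cancel_epi p, hp, comp_zero]
  have := h.source.minimal 0 (by simp [hf])
  exact h.middle_nonzero ((IsZero.iff_id_eq_zero _).2 (by
    rw [← IsIso.hom_inv_id (0 : E ⟶ E), zero_comp]))

/-- An endomorphism `h` of `Z` lifts to `u` on `E` and then to `v` on `X`, where `v` is a scalar `c`
plus a radical map. Extending that radical map over `f` and subtracting, `h - c` agrees with some `m
≫ g` up to a map killed by `g`. Such a map is not a monomorphism, hence it is radical, so `h` is `c`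
modulo the radical. -/
theorem IsAlmostSplitSeq.hasTrivialAutField_right {X E Z : C} [IsLocalRing (End X)]
    [IsLocalRing (End Z)] {f : X ⟶ E} {g : E ⟶ Z} (hfg : IsAlmostSplitSeq f g)
    (hX : HasTrivialAutField k X) : HasTrivialAutField k Z := by
  refine hasTrivialAutField_of_exists_sub_mem not_isZero_of_isLocalRing_end fun h => ?_
  have hg : g ∈ rad k E Z := hfg.sink.mem_rad
  obtain ⟨u, hu⟩ := hfg.sink.almostSplit.exists_of_mem_rad (rad_comp hg h)
  obtain ⟨v, hv⟩ := hfg.pseudoKernel (f ≫ u) (by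
    rw [Category.assoc, hu, ← Category.assoc, hfg.comp_eq_zero, zero_comp])
  obtain ⟨c, hc⟩ := hX.exists_sub_mem v
  obtain ⟨l, hl⟩ := hfg.source.almostSplit.exists_of_mem_rad hc
  obtain ⟨m, hm⟩ := hfg.pseudoCokernel (u - c • 𝟙 E - l ≫ f) (by
    rw [Preadditive.comp_sub, Preadditive.comp_sub, ← hv, ← Category.assoc f l, hl,
      Preadditive.sub_comp]
    simp)
  refine ⟨c, ?_⟩
  have h₁ : g ≫ (h - c • 𝟙 Z - m ≫ g) = 0 := by
    rw [Preadditive.comp_sub, Preadditive.comp_sub, ← hu, ← Category.assoc g m, hm,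
      Preadditive.sub_comp, Preadditive.sub_comp, Category.assoc, hfg.comp_eq_zero]
    simp
  have h₂ : h - c • 𝟙 Z - m ≫ g ∈ rad k Z Z :=
    mem_rad_of_not_isSplitMono fun _ => hfg.not_mono_of_comp_eq_zero h₁ inferInstance
  rw [← sub_add_cancel (h - c • 𝟙 Z) (m ≫ g)]
  exact add_mem h₂ (comp_rad _ hg)

theorem IsAlmostSplitSeq.hasTrivialAutField_left {X E Z : C} [IsLocalRing (End X)]
    [IsLocalRing (End Z)] {f : X ⟶ E} {g : E ⟶ Z} (hfg : IsAlmostSplitSeq f g)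
    (hZ : HasTrivialAutField k Z) : HasTrivialAutField k X := by
  refine hasTrivialAutField_of_exists_sub_mem not_isZero_of_isLocalRing_end fun h => ?_
  have hf : f ∈ rad k X E := hfg.source.mem_rad
  obtain ⟨u, hu⟩ := hfg.source.almostSplit.exists_of_mem_rad (comp_rad h hf)
  obtain ⟨v, hv⟩ := hfg.pseudoCokernel (u ≫ g) (by
    rw [← Category.assoc, hu, Category.assoc, hfg.comp_eq_zero, comp_zero])
  obtain ⟨c, hc⟩ := hZ.exists_sub_mem v
  obtain ⟨l, hl⟩ := hfg.sink.almostSplit.exists_of_mem_rad hc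
  obtain ⟨m, hm⟩ := hfg.pseudoKernel (u - c • 𝟙 E - g ≫ l) (by
    rw [Preadditive.sub_comp, Preadditive.sub_comp, ← hv, Category.assoc g l, hl,
      Preadditive.comp_sub]
    simp)
  refine ⟨c, ?_⟩
  have h₁ : (h - c • 𝟙 X - f ≫ m) ≫ f = 0 := by
    rw [Preadditive.sub_comp, Preadditive.sub_comp, ← hu, Category.assoc f m, hm,
      Preadditive.comp_sub, Preadditive.comp_sub, ← Category.assoc f g, hfg.comp_eq_zero]
    simp
  have h₂ : h - c • 𝟙 X - f ≫ m ∈ rad k X X :=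
    mem_rad_of_not_isSplitEpi fun _ => hfg.not_epi_of_comp_eq_zero h₁ inferInstance
  rw [← sub_add_cancel (h - c • 𝟙 X) (f ≫ m)]
  exact add_mem h₂ (rad_comp hf _)

/-- If a component were in rad², it would be `f ≫ s` with `s` radical, and by minimality the
projection itself would be radical, which is impossible on a non-zero summand. -/
theorem IsSourceMorphism.component_notMem_radSq [HasFiniteBiproducts C] {X E : C}
    {f : X ⟶ E} (hf : IsSourceMorphism f) {n : ℕ} {v : Fin n → C}
    (hv : ∀ i, ¬ IsZero (v i)) (e : E ≅ ⨁ v) (i : Fin n) :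
    f ≫ e.hom ≫ biproduct.π v i ∉ radSq k X (v i) := fun h => by
  obtain ⟨s, hs, hs'⟩ := hf.almostSplit.exists_of_mem_radSq h
  have h₁ : e.hom ≫ biproduct.π v i ∈ rad k _ _ := by
    rw [← sub_add_cancel (e.hom ≫ biproduct.π v i) s]
    exact add_mem (hf.minimal.mem_rad k (by rw [Preadditive.comp_sub, hs', sub_self])) hs
  have h₂ := comp_rad (biproduct.ι v i ≫ e.inv) h₁
  simp only [Category.assoc, Iso.inv_hom_id_assoc, biproduct.ι_π_self] at h₂
  exact id_notMem_rad (hv i) h₂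

theorem IsSinkMorphism.component_notMem_radSq [HasFiniteBiproducts C] {E Z : C}
    {g : E ⟶ Z} (hg : IsSinkMorphism g) {n : ℕ} {v : Fin n → C}
    (hv : ∀ i, ¬ IsZero (v i)) (e : E ≅ ⨁ v) (i : Fin n) :
    biproduct.ι v i ≫ e.inv ≫ g ∉ radSq k (v i) Z := fun h => by
  obtain ⟨s, hs, hs'⟩ := hg.almostSplit.exists_of_mem_radSq h
  have h₁ : biproduct.ι v i ≫ e.inv ∈ rad k _ _ := by
    rw [← sub_add_cancel (biproduct.ι v i ≫ e.inv) s]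
    exact add_mem (hg.minimal.mem_rad k (by
      rw [Preadditive.sub_comp, hs', Category.assoc, sub_self])) hs
  have h₂ := rad_comp h₁ (e.hom ≫ biproduct.π v i)
  simp only [Category.assoc, Iso.inv_hom_id_assoc, biproduct.ι_π_self] at h₂
  exact id_notMem_rad (hv i) h₂

end TrivialAutField

/-! ### Levels in a translation quiver with a section. -/

section Shift

variable {Q : Type u} (T : Q → Q → Prop)

/-- `Y = τ ^ (-n) X`, for an integer `n`. -/
inductive IsShift : ℤ → Q → Q → Prop
  | refl (X : Q) : IsShift 0 X X
  | up {n : ℤ} {X Y Z : Q} : IsShift n X Y → T Y Z → IsShift (n + 1) X Z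
  | down {n : ℤ} {X Y Z : Q} : IsShift n X Z → T Y Z → IsShift (n - 1) X Y

/-- `X = τ ^ n Y`, for a natural number `n`. -/
def TranslatePow : ℕ → Q → Q → Prop
  | 0 => Eq
  | n + 1 => fun X Z => ∃ Y, TranslatePow n X Y ∧ T Y Z

variable {T}

theorem IsShift.trans {m n : ℤ} {X Y Z : Q} (h : IsShift T m X Y) (h' : IsShift T n Y Z) :
    IsShift T (m + n) X Z := by
  induction h' with
  | refl => simpa using h
  | up _ t ih => rw [← add_assoc]; exact (ih h).up t
  | down _ t ih => rw [← add_sub_assoc]; exact (ih h).down t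

theorem IsShift.symm {n : ℤ} {X Y : Q} (h : IsShift T n X Y) : IsShift T (-n) Y X := by
  induction h with
  | refl => exact .refl _
  | @up n X Y Z _ t ih =>
    have := ((IsShift.refl Z).down t).trans ih
    rwa [show (0 : ℤ) - 1 + -n = -(n + 1) by ring] at this
  | @down n X Y Z _ t ih =>
    have := ((IsShift.refl Y).up t).trans ih
    rwa [show (0 : ℤ) + 1 + -n = -(n - 1) by ring] at this

theorem IsShift.eqvGen {n : ℤ} {X Y : Q} (h : IsShift T n X Y) : Relation.EqvGen T X Y := by
  induction h with
  | refl => exact .refl _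
  | up _ t ih => exact ih.trans _ _ _ (.rel _ _ t)
  | down _ t ih => exact ih.trans _ _ _ (.symm _ _ (.rel _ _ t))

theorem TranslatePow.cons {n : ℕ} {X Y Z : Q} (t : T X Y) (h : TranslatePow T n Y Z) :
    TranslatePow T (n + 1) X Z := by
  induction n generalizing Z with
  | zero => obtain rfl : Y = Z := h; exact ⟨X, rfl, t⟩
  | succ n ih => obtain ⟨W, hW, t'⟩ := h; exact ⟨W, ih hW, t'⟩

theorem TranslatePow.exists_cons {n : ℕ} {X Z : Q} (h : TranslatePow T (n + 1) X Z) :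
    ∃ Y, T X Y ∧ TranslatePow T n Y Z := by
  induction n generalizing Z with
  | zero => obtain ⟨_, rfl, t⟩ := h; exact ⟨Z, t, rfl⟩
  | succ n ih =>
    obtain ⟨W, hW, t'⟩ := h
    obtain ⟨Y, t, hY⟩ := ih hW
    exact ⟨Y, t, W, hY, t'⟩

theorem TranslatePow.transGen {n : ℕ} {X Y : Q} (h : TranslatePow T (n + 1) X Y) :
    Relation.TransGen T X Y := by
  induction n generalizing Y with
  | zero => obtain ⟨_, rfl, t⟩ := h; exact .single t
  | succ n ih => obtain ⟨W, hW, t⟩ := h; exact (ih hW).tail t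

/-- As `τ` is a partial injection, a step up followed by a step down cancels, so a zigzag in an
orbit reduces to a run in one direction. -/
theorem IsShift.exists_translatePow (hfun : ∀ {X X' Z}, T X Z → T X' Z → X = X')
    (hinj : ∀ {X Z Z'}, T X Z → T X Z' → Z = Z') {n : ℤ} {X Y : Q} (h : IsShift T n X Y) :
    (∃ m : ℕ, n = m ∧ TranslatePow T m X Y) ∨ ∃ m : ℕ, n = -m ∧ TranslatePow T m Y X := by
  induction h with
  | refl => exact .inl ⟨0, rfl, rfl⟩
  | @up n X Y Z _ t ih =>
    obtain ⟨m, rfl, h⟩ | ⟨m, rfl, h⟩ := ih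
    · exact .inl ⟨m + 1, by simp, Y, h, t⟩
    · cases m with
      | zero => obtain rfl : Y = X := h; exact .inl ⟨1, by simp, Y, rfl, t⟩
      | succ m =>
        obtain ⟨Y', t', h'⟩ := h.exists_cons
        obtain rfl := hinj t t'
        exact .inr ⟨m, by push_cast; ring, h'⟩
  | @down n X Y Z _ t ih =>
    obtain ⟨m, rfl, h⟩ | ⟨m, rfl, h⟩ := ih
    · cases m with
      | zero => obtain rfl : X = Z := h; exact .inr ⟨1, by simp, Y, rfl, t⟩
      | succ m =>
        obtain ⟨Y', h', t'⟩ := h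
        obtain rfl := hfun t t'
        exact .inl ⟨m, by push_cast; ring, h'⟩
    · exact .inr ⟨m + 1, by push_cast; ring, h.cons t⟩

end Shift

/-- The combinatorial properties of a translation quiver with a section `D` without infinite
paths. -/
structure IsSectionedQuiver {Q : Type u} [Quiver.{v} Q] (T : Q → Q → Prop) (D : Set Q) :
    Prop where
  left_unique : ∀ {X X' Z}, T X Z → T X' Z → X = X'
  right_unique : ∀ {X Z Z'}, T X Z → T X Z' → Z = Z'
  nonempty_iff : ∀ {X Z}, T X Z → ∀ Y, Nonempty (Y ⟶ Z) ↔ Nonempty (X ⟶ Y)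
  exists_middle : ∀ {X Z}, T X Z → ∃ Y, Nonempty (X ⟶ Y)
  convex : ∀ {X Y Z}, X ∈ D → Z ∈ D → Nonempty (Quiver.Path X Y) → Nonempty (Quiver.Path Y Z) →
    Y ∈ D
  acyclic : ∀ {X Y}, X ∈ D → Y ∈ D → Nonempty (X ⟶ Y) → Nonempty (Quiver.Path Y X) → False
  exists_shift : ∀ X, ∃ x ∈ D, ∃ n, IsShift T n x X
  eq_of_shift : ∀ {x y n}, x ∈ D → y ∈ D → IsShift T n x y → x = y
  wf : WellFounded fun X Y : Q => X ∈ D ∧ Y ∈ D ∧ Nonempty (X ⟶ Y)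
  wf_swap : WellFounded fun X Y : Q => X ∈ D ∧ Y ∈ D ∧ Nonempty (Y ⟶ X)

namespace IsSectionedQuiver

variable {Q : Type u} [Quiver.{v} Q] {T : Q → Q → Prop} {D : Set Q}
  (h : IsSectionedQuiver T D)

/-- The vertex of the section in the `τ`-orbit of `X`. -/
def base (X : Q) : Q := (h.exists_shift X).choose

/-- The integer `n` with `X = τ ^ (-n) (base X)`. -/
def level (X : Q) : ℤ := (h.exists_shift X).choose_spec.2.choose

include h

theorem base_mem (X : Q) : h.base X ∈ D := (h.exists_shift X).choose_spec.1

theorem isShift (X : Q) : IsShift T (h.level X) (h.base X) X :=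
  (h.exists_shift X).choose_spec.2.choose_spec

theorem nonempty_path_of_translatePow {n : ℕ} {X Y : Q} (hn : TranslatePow T n X Y) :
    Nonempty (Quiver.Path X Y) := by
  induction n generalizing Y with
  | zero => obtain rfl : X = Y := hn; exact ⟨.nil⟩
  | succ n ih =>
    obtain ⟨W, hW, t⟩ := hn
    obtain ⟨p⟩ := ih hW
    obtain ⟨Z, ⟨a⟩⟩ := h.exists_middle t
    obtain ⟨b⟩ := (h.nonempty_iff t Z).2 ⟨a⟩
    exact ⟨(p.cons a).cons b⟩

/-- A `τ`-periodic section vertex lies on an oriented cycle through the middle of a mesh. Convexity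
puts that middle vertex into the section, against acyclicity. -/
theorem not_translatePow_self {n : ℕ} {x : Q} (hx : x ∈ D) : ¬ TranslatePow T (n + 1) x x := by
  intro hn
  obtain ⟨Y, t, hY⟩ := hn.exists_cons
  obtain ⟨p⟩ := h.nonempty_path_of_translatePow hY
  obtain ⟨Z, ⟨a⟩⟩ := h.exists_middle t
  obtain ⟨b⟩ := (h.nonempty_iff t Z).2 ⟨a⟩
  have hp : Nonempty (Quiver.Path Z x) := ⟨b.toPath.comp p⟩
  exact h.acyclic hx (h.convex hx hx ⟨a.toPath⟩ hp) ⟨a⟩ hp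

theorem eq_of_isShift {n : ℤ} {x X : Q} (hx : x ∈ D) (hn : IsShift T n x X) :
    h.level X = n ∧ h.base X = x := by
  -- A shift between two section vertices joins a vertex to itself, and by the absence of
  -- periodicity it must be the zero shift.
  have hs := hn.trans (h.isShift X).symm
  obtain rfl : x = h.base X := h.eq_of_shift hx (h.base_mem X) hs
  refine ⟨?_, rfl⟩
  obtain ⟨m, hm, hs'⟩ | ⟨m, hm, hs'⟩ :=
    hs.exists_translatePow (T := T) h.left_unique h.right_unique <;>
  · cases m with
    | zero => simp at hm; lia
    | succ m => exact (h.not_translatePow_self hx hs').elim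

theorem level_of_translate {X Z : Q} (t : T X Z) : h.level Z = h.level X + 1 :=
  (h.eq_of_isShift (h.base_mem X) ((h.isShift X).up t)).1

theorem base_of_translate {X Z : Q} (t : T X Z) : h.base Z = h.base X :=
  (h.eq_of_isShift (h.base_mem X) ((h.isShift X).up t)).2

theorem level_of_mem {X : Q} (hX : X ∈ D) : h.level X = 0 :=
  (h.eq_of_isShift hX (.refl X)).1

theorem base_of_mem {X : Q} (hX : X ∈ D) : h.base X = X :=
  (h.eq_of_isShift hX (.refl X)).2

theorem translatePow_level (X : Q) :
    (∃ m : ℕ, h.level X = m ∧ TranslatePow T m (h.base X) X) ∨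
      ∃ m : ℕ, h.level X = -m ∧ TranslatePow T m X (h.base X) :=
  (h.isShift X).exists_translatePow (T := T) h.left_unique h.right_unique

theorem exists_translatePow_of_nonneg {X : Q} (hX : 0 ≤ h.level X) :
    ∃ m : ℕ, h.level X = m ∧ TranslatePow T m (h.base X) X := by
  obtain hm | ⟨m, hm, hs⟩ := h.translatePow_level X
  · exact hm
  · obtain rfl : m = 0 := by lia
    exact ⟨0, by simpa using hm, Eq.symm hs⟩

theorem exists_translatePow_of_nonpos {X : Q} (hX : h.level X ≤ 0) :
    ∃ m : ℕ, h.level X = -m ∧ TranslatePow T m X (h.base X) := by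
  obtain ⟨m, hm, hs⟩ | hm := h.translatePow_level X
  · obtain rfl : m = 0 := by lia
    exact ⟨0, by simpa using hm, Eq.symm hs⟩
  · exact hm

theorem mem_of_level_eq_zero {X : Q} (hX : h.level X = 0) : X ∈ D := by
  obtain ⟨m, hm, hs⟩ := h.exists_translatePow_of_nonneg hX.ge
  obtain rfl : m = 0 := by lia
  rw [← show h.base X = X from hs]
  exact h.base_mem X

theorem exists_translate_of_pos {Z : Q} (hZ : 0 < h.level Z) : ∃ X, T X Z := by
  obtain ⟨m, hm, hs⟩ := h.exists_translatePow_of_nonneg hZ.le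
  cases m with
  | zero => lia
  | succ m => exact ⟨_, hs.choose_spec.2⟩

theorem exists_translate_of_neg {X : Q} (hX : h.level X < 0) : ∃ Z, T X Z := by
  obtain ⟨m, hm, hs⟩ := h.exists_translatePow_of_nonpos hX.le
  cases m with
  | zero => lia
  | succ m => exact ⟨_, hs.exists_cons.choose_spec.1⟩

theorem path_from_base {X : Q} (hX : 0 ≤ h.level X) : Nonempty (Quiver.Path (h.base X) X) := by
  obtain ⟨m, -, hs⟩ := h.exists_translatePow_of_nonneg hX
  exact h.nonempty_path_of_translatePow hs

theorem path_to_base {X : Q} (hX : h.level X ≤ 0) : Nonempty (Quiver.Path X (h.base X)) := by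
  obtain ⟨m, -, hs⟩ := h.exists_translatePow_of_nonpos hX
  exact h.nonempty_path_of_translatePow hs

/-- `τ`-orbits run along paths, so the path through `Y` extends to one from `base X` to `base Z`,
and convexity applies. -/
theorem mem_of_arrow {X Y Z : Q} (hX : 0 ≤ h.level X) (hZ : h.level Z ≤ 0)
    (hXY : Nonempty (Quiver.Path X Y)) (hYZ : Nonempty (Quiver.Path Y Z)) : Y ∈ D := by
  obtain ⟨p⟩ := h.path_from_base hX
  obtain ⟨q⟩ := h.path_to_base hZ
  obtain ⟨a⟩ := hXY
  obtain ⟨b⟩ := hYZ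
  exact h.convex (h.base_mem X) (h.base_mem Z) ⟨p.comp a⟩ ⟨b.comp q⟩

/-- Arrows stay in a translate of the section, or go to the next one. -/
theorem arrow_cases {X Y : Q} (hXY : Nonempty (X ⟶ Y)) :
    (h.level X = h.level Y ∧ Nonempty (h.base X ⟶ h.base Y)) ∨ h.level Y = h.level X + 1 := by
  -- Induction on the distance of `X` from the section. When both ends lie strictly on the same
  -- side, the arrow is moved one mesh towards the section by applying `nonempty_iff` twice; when
  -- they do not, `mem_of_arrow` places the relevant vertices in the section.
  obtain ⟨n, hn⟩ : ∃ n, (h.level X).natAbs = n := ⟨_, rfl⟩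
  induction n using Nat.strong_induction_on generalizing X Y with
  | _ n ih =>
    have hp : Nonempty (Quiver.Path X Y) := ⟨hXY.some.toPath⟩
    have hX₀ : Nonempty (Quiver.Path X X) := ⟨.nil⟩
    have hY₀ : Nonempty (Quiver.Path Y Y) := ⟨.nil⟩
    by_cases hX : 0 ≤ h.level X
    · by_cases hY : h.level Y ≤ 0
      · have h₁ := h.mem_of_arrow hX hY hX₀ hp
        have h₂ := h.mem_of_arrow hX hY hp hY₀
        left
        rw [h.level_of_mem h₁, h.level_of_mem h₂, h.base_of_mem h₁, h.base_of_mem h₂]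
        exact ⟨rfl, hXY⟩
      · obtain ⟨Y', tY⟩ := h.exists_translate_of_pos (not_le.1 hY)
        have hYX := (h.nonempty_iff tY X).1 hXY
        have hlY := h.level_of_translate tY
        obtain hX | hX := hX.lt_or_eq
        · obtain ⟨X', tX⟩ := h.exists_translate_of_pos hX
          have hlX := h.level_of_translate tX
          rw [h.base_of_translate tX, h.base_of_translate tY, hlX, hlY]
          have := ih _ (by lia) ((h.nonempty_iff tX Y').1 hYX) rfl
          lia
        · right
          have h₁ := h.mem_of_arrow (X := Y') (Y := Y') (Z := X) (by lia) hX.ge ⟨.nil⟩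
            ⟨hYX.some.toPath⟩
          have := h.level_of_mem h₁
          lia
    · obtain ⟨X', tX⟩ := h.exists_translate_of_neg (not_le.1 hX)
      have hYX := (h.nonempty_iff tX Y).2 hXY
      have hlX := h.level_of_translate tX
      by_cases hY : 0 ≤ h.level Y
      · have h₁ := h.mem_of_arrow (X := Y) (Y := Y) (Z := X') hY (by lia) hY₀
          ⟨hYX.some.toPath⟩
        have h₂ := h.mem_of_arrow (X := Y) (Y := X') (Z := X') hY (by lia)
          ⟨hYX.some.toPath⟩ ⟨.nil⟩
        have := h.level_of_mem h₁
        have := h.level_of_mem h₂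
        right
        lia
      · obtain ⟨Y', tY⟩ := h.exists_translate_of_neg (not_le.1 hY)
        have hlY := h.level_of_translate tY
        have := ih _ (by lia) ((h.nonempty_iff tY X').2 hYX) rfl
        rw [← h.base_of_translate tX, ← h.base_of_translate tY]
        lia

theorem level_le_of_path {X Y : Q} (p : Quiver.Path X Y) : h.level X ≤ h.level Y := by
  induction p with
  | nil => rfl
  | cons _ a ih =>
    have := h.arrow_cases ⟨a⟩
    lia

/-- A well-founded relation for which the arrows of non-negative level go up. -/
def Below (X Y : Q) : Prop :=
  InvImage (Prod.Lex (· < ·) fun x y : Q => x ∈ D ∧ y ∈ D ∧ Nonempty (x ⟶ y))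
    (fun X => ((h.level X).toNat, h.base X)) X Y

/-- A well-founded relation for which the arrows of non-positive level go down. -/
def Above (X Y : Q) : Prop :=
  InvImage (Prod.Lex (· < ·) fun x y : Q => x ∈ D ∧ y ∈ D ∧ Nonempty (y ⟶ x))
    (fun X => ((-h.level X).toNat, h.base X)) X Y

theorem wellFounded_below : WellFounded h.Below :=
  InvImage.wf (fun X => ((h.level X).toNat, h.base X)) (WellFounded.prod_lex wellFounded_lt h.wf)

theorem wellFounded_above : WellFounded h.Above :=
  InvImage.wf (fun X => ((-h.level X).toNat, h.base X))
    (WellFounded.prod_lex wellFounded_lt h.wf_swap)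

theorem below_of_arrow {X Y : Q} (a : X ⟶ Y) (hY : 0 ≤ h.level Y) (hX : 0 ≤ h.level X) :
    h.Below X Y := by
  unfold Below InvImage
  rw [Prod.lex_def]
  dsimp only
  obtain ⟨h₁, h₂⟩ | h₁ := h.arrow_cases ⟨a⟩
  · exact .inr ⟨by rw [h₁], h.base_mem X, h.base_mem Y, h₂⟩
  · exact .inl (by lia)

theorem below_of_translate {X Y : Q} (t : T X Y) (hY : 0 ≤ h.level Y) (hX : 0 ≤ h.level X) :
    h.Below X Y := by
  unfold Below InvImage
  rw [Prod.lex_def]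
  have := h.level_of_translate t
  exact .inl (by dsimp only; lia)

theorem above_of_arrow {X Y : Q} (a : X ⟶ Y) (hX : h.level X ≤ 0) (hY : h.level Y ≤ 0) :
    h.Above Y X := by
  unfold Above InvImage
  rw [Prod.lex_def]
  dsimp only
  obtain ⟨h₁, h₂⟩ | h₁ := h.arrow_cases ⟨a⟩
  · exact .inr ⟨by rw [h₁], h.base_mem Y, h.base_mem X, h₂⟩
  · exact .inl (by lia)

theorem above_of_translate {X Y : Q} (t : T X Y) (hX : h.level X ≤ 0) (hY : h.level Y ≤ 0) :
    h.Above Y X := by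
  unfold Above InvImage
  rw [Prod.lex_def]
  have := h.level_of_translate t
  exact .inl (by dsimp only; lia)

end IsSectionedQuiver

/-- Dependent choice along a well-founded relation. -/
theorem exists_forall_of_wellFounded {ι : Type*} {r : ι → ι → Prop} (hr : WellFounded r)
    {A : ι → Type*} (P : ∀ i, (∀ j, r j i → A j) → A i → Prop)
    (hP : ∀ i f, ∃ a, P i f a) : ∃ F : ∀ i, A i, ∀ i, P i (fun j _ => F j) (F i) := by
  choose c hc using hP
  refine ⟨hr.fix c, fun i => ?_⟩
  conv => arg 3; rw [hr.fix_eq]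
  exact hc i _

/-! ### Components with trivial automorphism fields. -/

section Component

variable {k : Type w} [Field k] {C : Type u} [Category.{v} C] [Preadditive C] [Linear k C]

section Basic

variable {V : Set C} {Γ : Set (ARQuiver k V)}

/-- The object of `C` given by a vertex of a full subquiver of the Auslander-Reiten quiver. -/
def vertexObj (X : FullSubquiver Γ) : C := (Subtype.val X : ARQuiver k V).obj

omit [Field k] [Category.{v} C] [Preadditive C] [Linear k C] in
theorem vertexObj_mem (X : FullSubquiver Γ) : vertexObj X ∈ V :=
  (Subtype.val X : ARQuiver k V).2

instance fintypeArrow (X Y : FullSubquiver Γ) : Fintype (X ⟶ Y) :=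
  inferInstanceAs (Fintype (Fin (numArrows k (vertexObj X) (vertexObj Y))))

theorem card_arrow (X Y : FullSubquiver Γ) :
    Fintype.card (X ⟶ Y) = numArrows k (vertexObj X) (vertexObj Y) :=
  Fintype.card_fin _

variable (Γ) in
/-- The vertex set `Γ` is closed under neighbours, and its objects have trivial automorphism
fields. -/
structure IsTrivialComponent : Prop where
  mem_iff : ∀ {X Y : ARQuiver k V}, Nonempty (X ⟶ Y) → (X ∈ Γ ↔ Y ∈ Γ)
  trivial : ∀ X ∈ Γ, HasTrivialAutField k X.obj

theorem IsConnectedComponent.mem_iff (hΓ : IsConnectedComponent Γ) {X Y : ARQuiver k V}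
    (h : Nonempty (X ⟶ Y)) : X ∈ Γ ↔ Y ∈ Γ := by
  obtain ⟨c, rfl⟩ := hΓ
  obtain ⟨a⟩ := h
  have : (Quiver.WeaklyConnectedComponent.mk X) = Quiver.WeaklyConnectedComponent.mk Y :=
    (Quiver.WeaklyConnectedComponent.eq X Y).2 ⟨(Quiver.Hom.toPos a).toPath⟩
  simp only [Set.mem_ofPred_eq, this]

end Basic

variable [HasFiniteBiproducts C] [hfin : ∀ X Y : C, FiniteDimensional k (X ⟶ Y)]
  (hKS : IsKrullSchmidt C) {V : Set C} (hV : IsCompleteSetOfIndecomposables V)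

include hKS hV

omit hfin [Field k] [Linear k C] in
theorem ARQuiver.isLocalRing_end (X : ARQuiver k V) : IsLocalRing (End X.obj) :=
  hV.isLocalRing_end hKS X.2

theorem IsSourceMorphism.exists_arrows {X : ARQuiver k V} (hX : HasTrivialAutField k X.obj)
    {E : C} {f : X.obj ⟶ E} (hf : IsSourceMorphism f) :
    ∃ (n : ℕ) (e : Fin n → ARQuiver k V), (∀ i, Nonempty (X ⟶ e i)) ∧
      Nonempty (E ≅ ⨁ fun i => (e i).obj) := by
  have := X.isLocalRing_end hKS hV
  obtain ⟨n, e, ⟨i⟩⟩ := hV.exists_iso_biproduct hKS E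
  refine ⟨n, e, fun m => ⟨(⟨0, ?_⟩ : Fin _)⟩, ⟨i⟩⟩
  refine numArrows_pos (Or.inl hX) (rad_comp hf.mem_rad _)
    (hf.component_notMem_radSq (fun l => ?_) i m)
  exact (hV.1 _ (e l).2).1

theorem IsSinkMorphism.exists_arrows {Z : ARQuiver k V} (hZ : HasTrivialAutField k Z.obj)
    {E : C} {g : E ⟶ Z.obj} (hg : IsSinkMorphism g) :
    ∃ (n : ℕ) (e : Fin n → ARQuiver k V), (∀ i, Nonempty (e i ⟶ Z)) ∧
      Nonempty (E ≅ ⨁ fun i => (e i).obj) := by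
  have := Z.isLocalRing_end hKS hV
  obtain ⟨n, e, ⟨i⟩⟩ := hV.exists_iso_biproduct hKS E
  refine ⟨n, e, fun m => ⟨(⟨0, ?_⟩ : Fin _)⟩, ⟨i⟩⟩
  refine numArrows_pos (Or.inr hZ) (comp_rad _ (comp_rad _ hg.mem_rad))
    (hg.component_notMem_radSq (fun l => ?_) i m)
  exact (hV.1 _ (e l).2).1

theorem IsAlmostSplitSeq.exists_arrows {X Z : ARQuiver k V} (hX : HasTrivialAutField k X.obj)
    (hZ : HasTrivialAutField k Z.obj) {E : C} {f : X.obj ⟶ E} {g : E ⟶ Z.obj}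
    (h : IsAlmostSplitSeq f g) : ∃ Y : ARQuiver k V, Nonempty (X ⟶ Y) ∧ Nonempty (Y ⟶ Z) := by
  have := X.isLocalRing_end hKS hV
  have := Z.isLocalRing_end hKS hV
  obtain ⟨n, e, ⟨i⟩⟩ := hV.exists_iso_biproduct hKS E
  have hne (l : Fin n) : ¬ IsZero (e l : C) := (hV.1 _ (e l).2).1
  cases n with
  | zero =>
    refine (h.middle_nonzero (IsZero.of_iso ((IsZero.iff_id_eq_zero _).2 ?_) i)).elim
    rw [← biproduct_total]; simp
  | succ n =>
    exact ⟨e 0, ⟨(⟨0, numArrows_pos (Or.inl hX) (rad_comp h.source.mem_rad _)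
      (h.source.component_notMem_radSq hne i 0)⟩ : Fin _)⟩,
      ⟨(⟨0, numArrows_pos (Or.inr hZ) (comp_rad _ (comp_rad _ h.sink.mem_rad))
      (h.sink.component_notMem_radSq hne i 0)⟩ : Fin _)⟩⟩

omit hfin in
theorem IsTranslate.trivial_iff {X Z : ARQuiver k V} (h : IsTranslate X Z) :
    HasTrivialAutField k X.obj ↔ HasTrivialAutField k Z.obj := by
  obtain ⟨E, f, g, h⟩ := h
  have := X.isLocalRing_end hKS hV
  have := Z.isLocalRing_end hKS hV
  exact ⟨h.hasTrivialAutField_right, h.hasTrivialAutField_left⟩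

/-- Membership and triviality travel together: the arrows that connect `X` to `Z` through the middle
term are obtained from triviality of the automorphism fields. -/
theorem IsTranslate.mem_iff {Γ : Set (ARQuiver k V)} (hΓ : IsConnectedComponent Γ)
    {X Z : ARQuiver k V} (h : IsTranslate X Z) :
    X ∈ Γ ∧ HasTrivialAutField k X.obj ↔ Z ∈ Γ ∧ HasTrivialAutField k Z.obj := by
  rw [← h.trivial_iff hKS hV]
  refine and_congr_left fun hX => ?_
  have hZ := (h.trivial_iff hKS hV).1 hX
  obtain ⟨E, f, g, h⟩ := h
  obtain ⟨Y, a, b⟩ := h.exists_arrows hKS hV hX hZ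
  exact (hΓ.mem_iff a).trans (hΓ.mem_iff b)

theorem IsSection.isTrivialComponent {Γ Δ : Set (ARQuiver k V)} (hΓ : IsConnectedComponent Γ)
    (hΔ : IsSection IsTranslate Δ Γ) (haut : ∀ X ∈ Δ, HasTrivialAutField k X.obj) :
    IsTrivialComponent Γ where
  mem_iff := hΓ.mem_iff
  trivial X hX := by
    obtain ⟨Y, ⟨hY, hXY⟩, -⟩ := hΔ.meets_orbit X hX
    have : X ∈ Γ ∧ HasTrivialAutField k X.obj ↔ Y ∈ Γ ∧ HasTrivialAutField k Y.obj := by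
      clear hX hY
      induction hXY with
      | rel _ _ h => exact h.mem_iff hKS hV hΓ
      | refl => rfl
      | symm _ _ _ ih => exact ih.symm
      | trans _ _ _ _ _ ih₁ ih₂ => exact ih₁.trans ih₂
    exact (this.2 ⟨hΔ.subset hY, haut Y hY⟩).2

variable {Γ : Set (ARQuiver k V)} (hΓ : IsTrivialComponent Γ)

omit hfin in
theorem IsTranslateOn.left_unique {X X' Z : FullSubquiver Γ}
    (h : IsTranslateOn Γ X Z) (h' : IsTranslateOn Γ X' Z) : X = X' := by
  obtain ⟨_, _, _, h⟩ := h
  obtain ⟨_, _, _, h'⟩ := h'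
  exact Subtype.ext (Subtype.ext
    (h.left_unique hKS hV k (vertexObj_mem X) (vertexObj_mem X') h'))

omit hfin in
theorem IsTranslateOn.right_unique {X Z Z' : FullSubquiver Γ}
    (h : IsTranslateOn Γ X Z) (h' : IsTranslateOn Γ X Z') : Z = Z' := by
  obtain ⟨_, _, _, h⟩ := h
  obtain ⟨_, _, _, h'⟩ := h'
  exact Subtype.ext (Subtype.ext
    (h.right_unique hKS hV k (vertexObj_mem Z) (vertexObj_mem Z') h'))

include hΓ

theorem isTranslate_mem_iff {X Z : ARQuiver k V} (h : IsTranslate X Z) : X ∈ Γ ↔ Z ∈ Γ := by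
  have hiff := h.trivial_iff hKS hV
  obtain ⟨E, f, g, h⟩ := h
  constructor
  · intro hX
    have hX' := hΓ.trivial X hX
    obtain ⟨Y, a, b⟩ := h.exists_arrows hKS hV hX' (hiff.1 hX')
    exact (hΓ.mem_iff b).1 ((hΓ.mem_iff a).1 hX)
  · intro hZ
    have hZ' := hΓ.trivial Z hZ
    obtain ⟨Y, a, b⟩ := h.exists_arrows hKS hV (hiff.2 hZ') hZ'
    exact (hΓ.mem_iff a).2 ((hΓ.mem_iff b).2 hZ)

omit hfin in
theorem IsTrivialComponent.isScalarFamily :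
    IsScalarFamily k (vertexObj : FullSubquiver Γ → C) where
  isLocalRing X := hV.isLocalRing_end hKS (vertexObj_mem X)
  exists_sub_mem X := (hΓ.trivial _ X.2).exists_sub_mem
  mem_rad X Y h := hV.mem_rad_of_ne hKS k (vertexObj_mem X) (vertexObj_mem Y)
    (fun h' => h (Subtype.ext (Subtype.ext h')))

omit hKS hV [HasFiniteBiproducts C] hfin in
theorem IsTrivialComponent.card_arrow_eq (X Y : FullSubquiver Γ) :
    Fintype.card (X ⟶ Y) = Module.finrank k (Irr k (vertexObj X) (vertexObj Y)) := by
  have hX : HasTrivialAutField k (vertexObj X) := hΓ.trivial _ X.2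
  have hY : HasTrivialAutField k (vertexObj Y) := hΓ.trivial _ Y.2
  rw [card_arrow, numArrows_eq_finrank hX hY]

omit hKS hV [HasFiniteBiproducts C] in
theorem IsTrivialComponent.exists_isIrrBasis (X Y : FullSubquiver Γ) :
    ∃ f : (X ⟶ Y) → (vertexObj X ⟶ vertexObj Y), IsIrrBasis k f := by
  obtain ⟨f, hf⟩ := ARTheory.exists_isIrrBasis (k := k) (vertexObj X) (vertexObj Y) rfl
  exact ⟨_, hf.reindex (Fintype.equivFinOfCardEq (hΓ.card_arrow_eq X Y))⟩

theorem IsSourceMorphism.exists_iso_vertices {X : FullSubquiver Γ} {E : C}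
    {f : vertexObj X ⟶ E} (hf : IsSourceMorphism f) :
    ∃ (n : ℕ) (e : Fin n → FullSubquiver Γ), Nonempty (E ≅ ⨁ fun i => vertexObj (e i)) := by
  obtain ⟨n, e, he, hE⟩ := hf.exists_arrows (X := (Subtype.val X : ARQuiver k V)) hKS hV
    (hΓ.trivial _ X.2)
  exact ⟨n, fun i => ⟨e i, (hΓ.mem_iff (he i)).1 X.2⟩, hE⟩

theorem IsSinkMorphism.exists_iso_vertices {Z : FullSubquiver Γ} {E : C}
    {g : E ⟶ vertexObj Z} (hg : IsSinkMorphism g) :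
    ∃ (n : ℕ) (e : Fin n → FullSubquiver Γ), Nonempty (E ≅ ⨁ fun i => vertexObj (e i)) := by
  obtain ⟨n, e, he, hE⟩ := hg.exists_arrows (Z := (Subtype.val Z : ARQuiver k V)) hKS hV
    (hΓ.trivial _ Z.2)
  exact ⟨n, fun i => ⟨e i, (hΓ.mem_iff (he i)).2 Z.2⟩, hE⟩

theorem IsSourceMorphism.finite_arrows {X : FullSubquiver Γ} {E : C}
    {f : vertexObj X ⟶ E} (hf : IsSourceMorphism f) : Finite (Σ Y : FullSubquiver Γ, (X ⟶ Y)) := by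
  have := hV.isLocalRing_end hKS (vertexObj_mem X)
  obtain ⟨n, e, ⟨hE⟩⟩ := hf.exists_iso_vertices hKS hV hΓ
  choose φ hφ using hΓ.exists_isIrrBasis X
  exact finite_sigma_of_isSourceMorphism (hΓ.isScalarFamily hKS hV) hf hE hφ

theorem IsSinkMorphism.finite_arrows {Z : FullSubquiver Γ} {E : C}
    {g : E ⟶ vertexObj Z} (hg : IsSinkMorphism g) : Finite (Σ Y : FullSubquiver Γ, (Y ⟶ Z)) := by
  have := hV.isLocalRing_end hKS (vertexObj_mem Z)
  obtain ⟨n, e, ⟨hE⟩⟩ := hg.exists_iso_vertices hKS hV hΓ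
  choose φ hφ using fun Y => hΓ.exists_isIrrBasis Y Z
  exact finite_sigma_of_isSinkMorphism (hΓ.isScalarFamily hKS hV) hg hE hφ

theorem IsSourceMorphism.exists_iso_lift {X : FullSubquiver Γ} {E : C}
    {f : vertexObj X ⟶ E} (hf : IsSourceMorphism f) [Finite (Σ Y : FullSubquiver Γ, (X ⟶ Y))]
    {φ : ∀ Y : FullSubquiver Γ, (X ⟶ Y) → (vertexObj X ⟶ vertexObj Y)}
    (hφ : ∀ Y, IsIrrBasis k (φ Y)) :
    ∃ e : E ≅ ⨁ fun a : Σ Y : FullSubquiver Γ, (X ⟶ Y) => vertexObj a.1,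
      f ≫ e.hom = biproduct.lift fun a : Σ Y : FullSubquiver Γ, (X ⟶ Y) => φ a.1 a.2 := by
  have := hV.isLocalRing_end hKS (vertexObj_mem X)
  obtain ⟨n, e, ⟨hE⟩⟩ := hf.exists_iso_vertices hKS hV hΓ
  exact hf.exists_iso (isSourceMorphism_lift (hΓ.isScalarFamily hKS hV) hf hE hφ)

theorem IsSinkMorphism.exists_iso_desc {Z : FullSubquiver Γ} {E : C}
    {g : E ⟶ vertexObj Z} (hg : IsSinkMorphism g) [Finite (Σ Y : FullSubquiver Γ, (Y ⟶ Z))]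
    {φ : ∀ Y : FullSubquiver Γ, (Y ⟶ Z) → (vertexObj Y ⟶ vertexObj Z)}
    (hφ : ∀ Y, IsIrrBasis k (φ Y)) :
    ∃ e : E ≅ ⨁ fun a : Σ Y : FullSubquiver Γ, (Y ⟶ Z) => vertexObj a.1,
      e.inv ≫ g = biproduct.desc fun a : Σ Y : FullSubquiver Γ, (Y ⟶ Z) => φ a.1 a.2 := by
  have := hV.isLocalRing_end hKS (vertexObj_mem Z)
  obtain ⟨n, e, ⟨hE⟩⟩ := hg.exists_iso_vertices hKS hV hΓ
  obtain ⟨e, he⟩ := hg.exists_iso (isSinkMorphism_desc (hΓ.isScalarFamily hKS hV) hg hE hφ)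
  exact ⟨e.symm, he⟩

/-- The source morphism may be replaced by any chosen basis of arrows out of `X`. The sink morphism
then determines the complementary basis into `Z`, making the mesh relation an almost split sequence.
-/
theorem IsAlmostSplitSeq.exists_desc {X Z : FullSubquiver Γ} {E : C} {f : vertexObj X ⟶ E}
    {g : E ⟶ vertexObj Z} (h : IsAlmostSplitSeq f g)
    [Finite (Σ Y : FullSubquiver Γ, (X ⟶ Y))]
    {φ : ∀ Y : FullSubquiver Γ, (X ⟶ Y) → (vertexObj X ⟶ vertexObj Y)}
    (hφ : ∀ Y, IsIrrBasis k (φ Y)) :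
    ∃ ψ : ∀ Y : FullSubquiver Γ, (X ⟶ Y) → (vertexObj Y ⟶ vertexObj Z),
      (∀ Y, IsIrrBasis k (ψ Y)) ∧
      IsAlmostSplitSeq (biproduct.lift fun a : Σ Y : FullSubquiver Γ, (X ⟶ Y) => φ a.1 a.2)
        (biproduct.desc fun a : Σ Y : FullSubquiver Γ, (X ⟶ Y) => ψ a.1 a.2) := by
  have := hV.isLocalRing_end hKS (vertexObj_mem Z)
  obtain ⟨e, he⟩ := h.source.exists_iso_lift hKS hV hΓ hφ
  have h' := h.transport (Iso.refl _) e (Iso.refl _)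
  simp only [Iso.refl_hom, Category.id_comp, Category.comp_id, he] at h'
  have hd : e.inv ≫ g = biproduct.desc fun a : Σ Y : FullSubquiver Γ, (X ⟶ Y) =>
      biproduct.ι (fun a : Σ Y : FullSubquiver Γ, (X ⟶ Y) => vertexObj a.1) a ≫ e.inv ≫ g := by
    ext; simp
  rw [hd] at h'
  refine ⟨fun Y a => biproduct.ι (fun a : Σ Y : FullSubquiver Γ, (X ⟶ Y) => vertexObj a.1)
    ⟨Y, a⟩ ≫ e.inv ≫ g, fun Y => ?_, h'⟩
  exact IsSinkMorphism.isIrrBasis (hΓ.isScalarFamily hKS hV) (g := fun Y a =>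
    biproduct.ι (fun a : Σ Y : FullSubquiver Γ, (X ⟶ Y) => vertexObj a.1)
    ⟨Y, a⟩ ≫ e.inv ≫ g) h'.sink Y

theorem IsAlmostSplitSeq.exists_lift {X Z : FullSubquiver Γ} {E : C} {f : vertexObj X ⟶ E}
    {g : E ⟶ vertexObj Z} (h : IsAlmostSplitSeq f g)
    [Finite (Σ Y : FullSubquiver Γ, (Y ⟶ Z))]
    {φ : ∀ Y : FullSubquiver Γ, (Y ⟶ Z) → (vertexObj Y ⟶ vertexObj Z)}
    (hφ : ∀ Y, IsIrrBasis k (φ Y)) :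
    ∃ ψ : ∀ Y : FullSubquiver Γ, (Y ⟶ Z) → (vertexObj X ⟶ vertexObj Y),
      (∀ Y, IsIrrBasis k (ψ Y)) ∧
      IsAlmostSplitSeq (biproduct.lift fun a : Σ Y : FullSubquiver Γ, (Y ⟶ Z) => ψ a.1 a.2)
        (biproduct.desc fun a : Σ Y : FullSubquiver Γ, (Y ⟶ Z) => φ a.1 a.2) := by
  have := hV.isLocalRing_end hKS (vertexObj_mem X)
  obtain ⟨e, he⟩ := h.sink.exists_iso_desc hKS hV hΓ hφ
  have h' := h.transport (Iso.refl _) e (Iso.refl _)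
  simp only [Iso.refl_hom, Category.id_comp, Category.comp_id, he] at h'
  have hd : f ≫ e.hom = biproduct.lift fun a : Σ Y : FullSubquiver Γ, (Y ⟶ Z) =>
      f ≫ e.hom ≫ biproduct.π (fun a : Σ Y : FullSubquiver Γ, (Y ⟶ Z) => vertexObj a.1) a := by
    ext; simp
  rw [hd] at h'
  refine ⟨fun Y a => f ≫ e.hom ≫ biproduct.π
    (fun a : Σ Y : FullSubquiver Γ, (Y ⟶ Z) => vertexObj a.1) ⟨Y, a⟩, fun Y => ?_, h'⟩
  exact IsSourceMorphism.isIrrBasis (hΓ.isScalarFamily hKS hV) (f := fun Y a =>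
    f ≫ e.hom ≫ biproduct.π
    (fun a : Σ Y : FullSubquiver Γ, (Y ⟶ Z) => vertexObj a.1) ⟨Y, a⟩) h'.source Y

/-- Both numbers count the copies of `Y` in the middle term of the almost split sequence. -/
theorem IsTranslateOn.numArrows_eq {X Z : FullSubquiver Γ} (h : IsTranslateOn Γ X Z)
    (Y : FullSubquiver Γ) :
    numArrows k (vertexObj Y) (vertexObj Z) = numArrows k (vertexObj X) (vertexObj Y) := by
  obtain ⟨E, f, g, h⟩ := h
  have := IsSourceMorphism.finite_arrows (X := X) hKS hV hΓ h.source
  choose φ hφ using hΓ.exists_isIrrBasis X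
  obtain ⟨ψ, hψ, -⟩ := IsAlmostSplitSeq.exists_desc (X := X) (Z := Z) hKS hV hΓ h hφ
  rw [← card_arrow, hΓ.card_arrow_eq, ← (hψ Y).card_eq, card_arrow]

/-- A polarization of a component with trivial automorphism fields. -/
def IsTrivialComponent.polarization : Polarization (IsTranslateOn Γ) where
  σ h Y := finCongr (h.numArrows_eq hKS hV hΓ Y)

theorem IsShift.exists_of_eqvGen {X Y : ARQuiver k V} (h : Relation.EqvGen IsTranslate X Y) :
    (X ∈ Γ ↔ Y ∈ Γ) ∧ ∀ (hX : X ∈ Γ) (hY : Y ∈ Γ),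
      ∃ n, IsShift (IsTranslateOn Γ) n (⟨X, hX⟩ : FullSubquiver Γ) ⟨Y, hY⟩ := by
  induction h with
  | rel X Y h =>
    exact ⟨isTranslate_mem_iff hKS hV hΓ h, fun hX hY => ⟨0 + 1, (IsShift.refl _).up h⟩⟩
  | refl X => exact ⟨Iff.rfl, fun hX hY => ⟨0, .refl _⟩⟩
  | symm X Y _ ih => exact ⟨ih.1.symm, fun hX hY => ⟨_, (ih.2 hY hX).choose_spec.symm⟩⟩
  | trans X Y Z _ _ ih₁ ih₂ =>
    exact ⟨ih₁.1.trans ih₂.1, fun hX hZ => ⟨_, (ih₁.2 hX (ih₁.1.1 hX)).choose_spec.trans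
      (ih₂.2 (ih₁.1.1 hX) hZ).choose_spec⟩⟩

end Component

/-! ### Linear extension of functors and the universal property of the mesh category. -/

section FreeLift

variable (k : Type w) [Field k] {A : Type u} [Category.{v} A] {C : Type u'} [Category.{v'} C]
  [Preadditive C]
  [Linear k C]

/-- A functor to a `k`-linear category on the homomorphisms of the free `k`-linear category. -/
def freeLiftMap (F : A ⥤ C) (X Y : A) :
    (Free.of k X ⟶ Free.of k Y) →ₗ[k] (F.obj X ⟶ F.obj Y) :=
  Finsupp.linearCombination k (fun p : X ⟶ Y => F.map p)

theorem freeLiftMap_single (F : A ⥤ C) {X Y : A} (p : X ⟶ Y) (c : k) :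
    freeLiftMap k F X Y (Finsupp.single p c) = c • F.map p :=
  Finsupp.linearCombination_single k c p

theorem freeLiftMap_comp (F : A ⥤ C) {X Y Z : A} (f : Free.of k X ⟶ Free.of k Y)
    (g : Free.of k Y ⟶ Free.of k Z) :
    freeLiftMap k F X Z (f ≫ g) = freeLiftMap k F X Y f ≫ freeLiftMap k F Y Z g := by
  refine Finsupp.induction_linear (motive := fun f : (X ⟶ Y) →₀ k =>
    freeLiftMap k F X Z ((show Free.of k X ⟶ Free.of k Y from f) ≫ g) =
      freeLiftMap k F X Y f ≫ freeLiftMap k F Y Z g) f ?_ (fun f₁ f₂ h₁ h₂ => ?_)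
    (fun p c => ?_)
  · exact ((congrArg _ zero_comp).trans (map_zero _)).trans
      ((congrArg (· ≫ _) (map_zero (freeLiftMap k F X Y))).trans zero_comp).symm
  · refine (congrArg _ (Preadditive.add_comp _ _ _ _ _ _)).trans ?_
    rw [map_add, h₁, h₂]
    exact (Preadditive.add_comp _ _ _ _ _ _).symm.trans
      (congrArg (· ≫ _) (map_add (freeLiftMap k F X Y) _ _).symm)
  · refine Finsupp.induction_linear (motive := fun g : (Y ⟶ Z) →₀ k =>
      freeLiftMap k F X Z ((show Free.of k X ⟶ Free.of k Y from Finsupp.single p c) ≫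
        (show Free.of k Y ⟶ Free.of k Z from g)) =
        freeLiftMap k F X Y (Finsupp.single p c) ≫ freeLiftMap k F Y Z g) g ?_
      (fun f₁ f₂ h₁ h₂ => ?_) (fun q d => ?_)
    · exact ((congrArg _ comp_zero).trans (map_zero _)).trans
        ((congrArg (_ ≫ ·) (map_zero (freeLiftMap k F Y Z))).trans comp_zero).symm
    · refine (congrArg _ (Preadditive.comp_add _ _ _ _ _ _)).trans ?_
      rw [map_add, h₁, h₂]
      exact (Preadditive.comp_add _ _ _ _ _ _).symm.trans
        (congrArg (_ ≫ ·) (map_add (freeLiftMap k F Y Z) _ _).symm)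
    · refine (congrArg _ (Free.single_comp_single k A p q c d)).trans ?_
      refine (freeLiftMap_single k F (p ≫ q) (c * d)).trans ?_
      refine Eq.trans ?_ (congrArg₂ (· ≫ ·) (freeLiftMap_single k F p c)
        (freeLiftMap_single k F q d)).symm
      simp only [F.map_comp, Linear.smul_comp, Linear.comp_smul, smul_smul, mul_comm]

/-- A functor to a `k`-linear category extends to the free `k`-linear category on its domain. -/
def freeLift (F : A ⥤ C) : Free k A ⥤ C where
  obj X := F.obj X
  map {X Y} f := freeLiftMap k F X Y f
  map_id X := by
    refine (freeLiftMap_single k F (X := X) (𝟙 _) 1).trans ?_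
    rw [one_smul]
    exact F.map_id _
  map_comp f g := freeLiftMap_comp k F f g

instance (F : A ⥤ C) : (freeLift k F).Additive where
  map_add {X Y _ _} := map_add (freeLiftMap k F X Y) _ _

instance (F : A ⥤ C) : (freeLift k F).Linear k where
  map_smul {X Y} f r := map_smul (freeLiftMap k F X Y) r f

theorem freeLift_map_embedding (F : A ⥤ C) {X Y : A} (f : X ⟶ Y) :
    (freeLift k F).map ((Free.embedding k A).map f) = F.map f :=
  (freeLiftMap_single k F f 1).trans (one_smul _ _)

end FreeLift

section MeshCategory

variable (k : Type w) [Field k] {Q : Type u} [Quiver.{v} Q] {T : Q → Q → Prop}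
  (P : Polarization T)

theorem pathHom_comp {X Y Z : Q} (p : Quiver.Path X Y) (q : Quiver.Path Y Z) :
    pathHom k (p.comp q) = pathHom k p ≫ pathHom k q :=
  (Free.embedding k (Paths Q)).map_comp (X := (Paths.of Q).obj X) (Y := (Paths.of Q).obj Y)
    (Z := (Paths.of Q).obj Z) p q

theorem pathHom_nil (X : Q) : pathHom k (Quiver.Path.nil : Quiver.Path X X) = 𝟙 (vtx k X) :=
  (Free.embedding k (Paths Q)).map_id _

theorem mem_span_pathHom {X Y : Q} (f : vtx k X ⟶ vtx k Y) :
    f ∈ Submodule.span k (Set.range fun p : Quiver.Path X Y => pathHom k p) := by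
  change Quiver.Path X Y →₀ k at f
  induction f using Finsupp.induction_linear with
  | zero => exact zero_mem _
  | add f g hf hg => exact add_mem hf hg
  | single p c =>
    have : (Finsupp.single p c : Quiver.Path X Y →₀ k) = c • Finsupp.single p 1 := by simp
    rw [this]
    exact Submodule.smul_mem _ c (Submodule.subset_span ⟨p, rfl⟩)

namespace MeshCategory

/-- The projection from the path category to the mesh category. -/
def proj : PathCategory k Q ⥤ MeshCategory k P := Quotient.functor (meshRel k P)

instance : (proj k P).Additive :=
  Quotient.functor_additive (meshRel k P) (meshRel_add k P)

instance : (proj k P).Linear k where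
  map_smul _ _ := rfl

instance : (proj k P).Full := inferInstanceAs (Quotient.functor (meshRel k P)).Full

/-- The morphism of the mesh category given by a path. -/
def path {X Y : Q} (p : Quiver.Path X Y) : of k P X ⟶ of k P Y := (proj k P).map (pathHom k p)

theorem path_nil (X : Q) : path k P (Quiver.Path.nil : Quiver.Path X X) = 𝟙 (of k P X) :=
  (congrArg (proj k P).map (pathHom_nil k X)).trans ((proj k P).map_id _)

theorem path_comp {X Y Z : Q} (p : Quiver.Path X Y) (q : Quiver.Path Y Z) :
    path k P (p.comp q) = path k P p ≫ path k P q :=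
  (congrArg (proj k P).map (pathHom_comp k p q)).trans ((proj k P).map_comp _ _)

/-- The morphism of the mesh category given by an arrow. -/
def arrow {X Y : Q} (a : X ⟶ Y) : of k P X ⟶ of k P Y := path k P a.toPath

/-- The identity as a morphism between possibly different vertices, zero if they differ. -/
def idOrZero (X Y : Q) : of k P X ⟶ of k P Y :=
  open Classical in if h : X = Y then eqToHom (by rw [h]) else 0

theorem idOrZero_self (X : Q) : idOrZero k P X X = 𝟙 _ := by simp [idOrZero]

theorem idOrZero_of_ne {X Y : Q} (h : X ≠ Y) : idOrZero k P X Y = 0 := by simp [idOrZero, h]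

theorem span_induction {X Y : Q} {p : (of k P X ⟶ of k P Y) → Prop}
    (path : ∀ q : Quiver.Path X Y, p (path k P q)) (zero : p 0)
    (add : ∀ f g, p f → p g → p (f + g)) (smul : ∀ (c : k) f, p f → p (c • f))
    (f : of k P X ⟶ of k P Y) : p f := by
  obtain ⟨f, rfl⟩ := (proj k P).map_surjective (X := vtx k X) (Y := vtx k Y) f
  refine Submodule.span_induction (p := fun f _ => p ((proj k P).map f)) ?_ ?_ ?_ ?_
    (mem_span_pathHom k f)
  · rintro _ ⟨q, rfl⟩; exact path q
  · rw [Functor.map_zero]; exact zero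
  · intro f g _ _ hf hg; rw [Functor.map_add]; exact add _ _ hf hg
  · intro c f _ hf; rw [Functor.map_smul]; exact smul _ _ hf

theorem eq_zero_of_isEmpty {X Y : Q} (h : IsEmpty (Quiver.Path X Y))
    (f : of k P X ⟶ of k P Y) : f = 0 := by
  induction f using span_induction with
  | path q => exact h.elim q
  | zero => rfl
  | add f g hf hg => rw [hf, hg, add_zero]
  | smul c f hf => rw [hf, smul_zero]

/-- A path of positive length begins with an arrow, and a trivial path gives the scalar term.
`idOrZero` lets the cases `X = Y` and `X ≠ Y` share one formula; this mirrors factoring radical maps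
through a source morphism in `C`. -/
theorem exists_eq_sum_arrow_comp {X : Q} [Fintype (Σ Y, (X ⟶ Y))] {Y : Q}
    (f : of k P X ⟶ of k P Y) :
    ∃ (c : k) (l : ∀ a : Σ Y, (X ⟶ Y), of k P a.1 ⟶ of k P Y),
      f = c • idOrZero k P X Y + ∑ a, arrow k P a.2 ≫ l a := by
  classical
  induction f using span_induction with
  | path q =>
    by_cases hq : q.length = 0
    · obtain rfl := q.eq_of_length_zero hq
      obtain rfl := q.eq_nil_of_length_zero hq
      refine ⟨1, 0, ?_⟩
      rw [path_nil, idOrZero_self]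
      simp
    · obtain ⟨Z, a, q, -, rfl⟩ := q.eq_toPath_comp_of_length_eq_succ
        (Nat.succ_pred_eq_of_ne_zero hq).symm
      refine ⟨0, Pi.single (⟨Z, a⟩ : Σ Y, (X ⟶ Y)) (path k P q), ?_⟩
      rw [Finset.sum_eq_single ⟨Z, a⟩ (fun b _ hb => by rw [Pi.single_eq_of_ne hb, comp_zero])
        (by simp), Pi.single_eq_same, zero_smul, zero_add, path_comp]
      rfl
  | zero => exact ⟨0, 0, by simp⟩
  | add f g hf hg =>
    obtain ⟨c, l, rfl⟩ := hf
    obtain ⟨c', l', rfl⟩ := hg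
    refine ⟨c + c', l + l', ?_⟩
    simp only [add_smul, Pi.add_apply, Preadditive.comp_add, Finset.sum_add_distrib]
    abel
  | smul r f hf =>
    obtain ⟨c, l, rfl⟩ := hf
    exact ⟨r * c, r • l, by
      simp only [smul_add, smul_smul, Pi.smul_apply, Linear.comp_smul, Finset.smul_sum]⟩

theorem exists_eq_sum_comp_arrow {Y : Q} [Fintype (Σ X, (X ⟶ Y))] {X : Q}
    (f : of k P X ⟶ of k P Y) :
    ∃ (c : k) (l : ∀ a : Σ X, (X ⟶ Y), of k P X ⟶ of k P a.1),
      f = c • idOrZero k P X Y + ∑ a, l a ≫ arrow k P a.2 := by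
  classical
  induction f using span_induction with
  | path q =>
    cases q with
    | nil =>
      refine ⟨1, 0, ?_⟩
      rw [path_nil, idOrZero_self]
      simp
    | @cons Z _ q a =>
      refine ⟨0, Pi.single (⟨Z, a⟩ : Σ X, (X ⟶ Y)) (path k P q), ?_⟩
      rw [Finset.sum_eq_single ⟨Z, a⟩ (fun b _ hb => by rw [Pi.single_eq_of_ne hb, zero_comp])
        (by simp), Pi.single_eq_same, zero_smul, zero_add, ← Quiver.Path.comp_toPath_eq_cons,
        path_comp]
      rfl
  | zero => exact ⟨0, 0, by simp⟩
  | add f g hf hg =>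
    obtain ⟨c, l, rfl⟩ := hf
    obtain ⟨c', l', rfl⟩ := hg
    refine ⟨c + c', l + l', ?_⟩
    simp only [add_smul, Pi.add_apply, Preadditive.add_comp, Finset.sum_add_distrib]
    abel
  | smul r f hf =>
    obtain ⟨c, l, rfl⟩ := hf
    exact ⟨r * c, r • l, by
      simp only [smul_add, smul_smul, Pi.smul_apply, Linear.smul_comp, Finset.smul_sum]⟩

theorem sum_arrow_comp_arrow {X Z : Q} (t : T X Z) [Fintype (Σ Y, (Y ⟶ Z))] :
    ∑ a : Σ Y, (Y ⟶ Z), arrow k P (P.σ t a.1 a.2) ≫ arrow k P a.2 = 0 := by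
  have h : (proj k P).map (meshRelation k P t) = (proj k P).map 0 := by
    refine (Quotient.functor_map_eq_iff _ _ _).2 ?_
    change meshRelation k P t - 0 ∈ _
    rw [sub_zero]
    exact Submodule.subset_span ⟨X, Z, t, 𝟙 _, 𝟙 _, by simp⟩
  rw [Functor.map_zero, meshRelation, finsum_eq_sum_of_fintype, Functor.map_sum] at h
  exact (Finset.sum_congr rfl fun a _ => (path_comp k P _ _).symm).trans h

variable {C : Type u'} [Category.{v'} C] [Preadditive C] [Linear k C] {obj : Q → C}
  (φ : ∀ X Y : Q, (X ⟶ Y) → (obj X ⟶ obj Y))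
  (hφ : ∀ {X Z : Q} (t : T X Z), Finite (Σ Y, (Y ⟶ Z)) ∧
    ∑ᶠ a : Σ Y, (Y ⟶ Z), φ X a.1 (P.σ t a.1 a.2) ≫ φ a.1 Z a.2 = 0)

/-- The functor on the path category given by its values on arrows. -/
def pathFunctor : PathCategory k Q ⥤ C :=
  freeLift k (Paths.lift { obj := obj, map := fun {X Y} a => φ X Y a })

instance : (pathFunctor k φ).Additive :=
  inferInstanceAs (freeLift k (Paths.lift
    { obj := obj, map := fun {X Y} a => φ X Y a : Q ⥤q C })).Additive

instance : (pathFunctor k φ).Linear k :=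
  inferInstanceAs ((freeLift k (Paths.lift
    { obj := obj, map := fun {X Y} a => φ X Y a : Q ⥤q C })).Linear k)

theorem pathFunctor_map_toPath {X Y : Q} (a : X ⟶ Y) :
    (pathFunctor k φ).map (pathHom k a.toPath) = φ X Y a :=
  (freeLift_map_embedding k _ (X := (Paths.of Q).obj X) (Y := (Paths.of Q).obj Y) a.toPath).trans
    (Paths.lift_toPath _ a)

-- A linear functor need only kill the generators of the mesh ideal. The finiteness in `hφ` turns
-- the `finsum`s into genuine sums, which the functor preserves.
include hφ in
theorem pathFunctor_map_eq {A B : PathCategory k Q} (f g : A ⟶ B) (h : meshRel k P f g) :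
    (pathFunctor k φ).map f = (pathFunctor k φ).map g := by
  rw [← sub_eq_zero, ← Functor.map_sub]
  refine Submodule.span_induction (p := fun f _ => (pathFunctor k φ).map f = 0) ?_ ?_ ?_ ?_ h
  · rintro _ ⟨X, Z, t, p, q, rfl⟩
    obtain ⟨hfin, hsum⟩ := hφ t
    have := Fintype.ofFinite (Σ Y, (Y ⟶ Z))
    have : (pathFunctor k φ).map (meshRelation k P t) = 0 := by
      rw [meshRelation, finsum_eq_sum_of_fintype, Functor.map_sum]
      rw [finsum_eq_sum_of_fintype] at hsum
      refine Eq.trans ?_ hsum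
      refine Finset.sum_congr rfl fun a _ => ?_
      rw [pathHom_comp, Functor.map_comp, pathFunctor_map_toPath, pathFunctor_map_toPath]
      rfl
    rw [Functor.map_comp, Functor.map_comp, this, zero_comp, comp_zero]
  · rw [Functor.map_zero]
  · intro f g _ _ hf hg; rw [Functor.map_add, hf, hg, add_zero]
  · intro c f _ hf; rw [Functor.map_smul, hf, smul_zero]

/-- The functor on the mesh category given by its values on arrows. -/
def lift : MeshCategory k P ⥤ C :=
  CategoryTheory.Quotient.lift (meshRel k P) (pathFunctor k φ)
    (fun _ _ f g h => pathFunctor_map_eq k P φ hφ f g h)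

theorem lift_map_arrow {X Y : Q} (a : X ⟶ Y) :
    (lift k P φ hφ).map (arrow k P a) = φ X Y a := pathFunctor_map_toPath k φ a

instance : (lift k P φ hφ).Additive where
  map_add {A B f g} := by
    obtain ⟨f, rfl⟩ := (proj k P).map_surjective (X := A.as) (Y := B.as) f
    obtain ⟨g, rfl⟩ := (proj k P).map_surjective (X := A.as) (Y := B.as) g
    exact (pathFunctor k φ).map_add

instance : (lift k P φ hφ).Linear k where
  map_smul {A B} f c := by
    obtain ⟨f, rfl⟩ := (proj k P).map_surjective (X := A.as) (Y := B.as) f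
    exact (pathFunctor k φ).map_smul c f

end MeshCategory

end MeshCategory

/-! ### Inductive steps for bijectivity on morphism spaces. -/

section BijectiveSteps

variable {k : Type w} [Field k] {M : Type u'} [Category.{v'} M] [Preadditive M] [Linear k M]
  {C : Type u} [Category.{v} C] [Preadditive C] [Linear k C] (F : M ⥤ C) [F.Additive] [F.Linear k]
  {X Y : M} {A : Type*} [Fintype A] {E : A → M} (u : X ⟶ Y)

/-- A diagram chase: `hC` with surjectivity on the `E a` gives surjectivity, while `hk` says that
relations in the target lift to relations upstairs, so injectivity on the `E a` gives injectivity.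
The conclusion of `hu` is `c • u = 0` rather than `c = 0`, because `u` is zero in the application
when the two vertices differ. -/
theorem bijective_map_of_source (m : ∀ a, X ⟶ E a)
    (hM : ∀ h : X ⟶ Y, ∃ (c : k) (l : ∀ a, E a ⟶ Y), h = c • u + ∑ a, m a ≫ l a)
    (hC : ∀ h : F.obj X ⟶ F.obj Y, ∃ (c : k) (l : ∀ a, F.obj (E a) ⟶ F.obj Y),
      h = c • F.map u + ∑ a, F.map (m a) ≫ l a)
    (hu : ∀ (c : k) (l : ∀ a, F.obj (E a) ⟶ F.obj Y),
      c • F.map u + ∑ a, F.map (m a) ≫ l a = 0 → c • u = 0)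
    (hE : ∀ a, Function.Bijective (F.map : (E a ⟶ Y) → _))
    (hk : ∀ l : ∀ a, F.obj (E a) ⟶ F.obj Y, ∑ a, F.map (m a) ≫ l a = 0 →
      ∃ l' : ∀ a, E a ⟶ Y, (∀ a, F.map (l' a) = l a) ∧ ∑ a, m a ≫ l' a = 0) :
    Function.Bijective (F.map : (X ⟶ Y) → _) := by
  constructor
  · have : Function.Injective (F.mapAddHom : (X ⟶ Y) →+ _) := by
      rw [injective_iff_map_eq_zero]
      intro h hh
      obtain ⟨c, l, rfl⟩ := hM h
      have h₁ : c • F.map u + ∑ a, F.map (m a) ≫ F.map (l a) = 0 := by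
        simpa [Functor.map_sum, Functor.map_smul] using hh
      have h₂ := hu c _ h₁
      rw [← F.map_smul, h₂, F.map_zero, zero_add] at h₁
      obtain ⟨l', hl', h₃⟩ := hk _ h₁
      obtain rfl : l' = l := funext fun a => (hE a).1 (hl' a)
      rw [h₂, h₃, add_zero]
    exact this
  · intro h
    obtain ⟨c, l, rfl⟩ := hC h
    choose l' hl' using fun a => (hE a).2 (l a)
    exact ⟨c • u + ∑ a, m a ≫ l' a, by simp [Functor.map_sum, Functor.map_smul, hl']⟩

theorem bijective_map_of_sink (m : ∀ a, E a ⟶ Y)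
    (hM : ∀ h : X ⟶ Y, ∃ (c : k) (l : ∀ a, X ⟶ E a), h = c • u + ∑ a, l a ≫ m a)
    (hC : ∀ h : F.obj X ⟶ F.obj Y, ∃ (c : k) (l : ∀ a, F.obj X ⟶ F.obj (E a)),
      h = c • F.map u + ∑ a, l a ≫ F.map (m a))
    (hu : ∀ (c : k) (l : ∀ a, F.obj X ⟶ F.obj (E a)),
      c • F.map u + ∑ a, l a ≫ F.map (m a) = 0 → c • u = 0)
    (hE : ∀ a, Function.Bijective (F.map : (X ⟶ E a) → _))
    (hk : ∀ l : ∀ a, F.obj X ⟶ F.obj (E a), ∑ a, l a ≫ F.map (m a) = 0 →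
      ∃ l' : ∀ a, X ⟶ E a, (∀ a, F.map (l' a) = l a) ∧ ∑ a, l' a ≫ m a = 0) :
    Function.Bijective (F.map : (X ⟶ Y) → _) := by
  constructor
  · have : Function.Injective (F.mapAddHom : (X ⟶ Y) →+ _) := by
      rw [injective_iff_map_eq_zero]
      intro h hh
      obtain ⟨c, l, rfl⟩ := hM h
      have h₁ : c • F.map u + ∑ a, F.map (l a) ≫ F.map (m a) = 0 := by
        simpa [Functor.map_sum, Functor.map_smul] using hh
      have h₂ := hu c _ h₁
      rw [← F.map_smul, h₂, F.map_zero, zero_add] at h₁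
      obtain ⟨l', hl', h₃⟩ := hk _ h₁
      obtain rfl : l' = l := funext fun a => (hE a).1 (hl' a)
      rw [h₂, h₃, add_zero]
    exact this
  · intro h
    obtain ⟨c, l, rfl⟩ := hC h
    choose l' hl' using fun a => (hE a).2 (l a)
    exact ⟨c • u + ∑ a, l' a ≫ m a, by simp [Functor.map_sum, Functor.map_smul, hl']⟩

end BijectiveSteps

/-! ### Irreducible morphisms satisfying the mesh relations. -/

section Component

variable {k : Type w} [Field k] {C : Type u} [Category.{v} C] [Preadditive C] [Linear k C]
  [HasFiniteBiproducts C] [hfin : ∀ X Y : C, FiniteDimensional k (X ⟶ Y)]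
  (hKS : IsKrullSchmidt C) {V : Set C} (hV : IsCompleteSetOfIndecomposables V)
  {Γ : Set (ARQuiver k V)} (hΓ : IsTrivialComponent Γ) (P : Polarization (IsTranslateOn Γ))

include hKS hV hΓ

theorem IsTranslateOn.finite_source {X Z : FullSubquiver Γ} (t : IsTranslateOn Γ X Z) :
    Finite (Σ Y : FullSubquiver Γ, (X ⟶ Y)) := by
  obtain ⟨E, f, g, h⟩ := t
  exact IsSourceMorphism.finite_arrows (X := X) hKS hV hΓ h.source

theorem IsTranslateOn.finite_sink {X Z : FullSubquiver Γ} (t : IsTranslateOn Γ X Z) :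
    Finite (Σ Y : FullSubquiver Γ, (Y ⟶ Z)) := by
  obtain ⟨E, f, g, h⟩ := t
  exact IsSinkMorphism.finite_arrows (Z := Z) hKS hV hΓ h.sink

theorem IsTranslateOn.exists_sink_family {X Z : FullSubquiver Γ} (t : IsTranslateOn Γ X Z)
    {φ : ∀ Y : FullSubquiver Γ, (X ⟶ Y) → (vertexObj X ⟶ vertexObj Y)}
    (hφ : ∀ Y, IsIrrBasis k (φ Y)) :
    ∃ ψ : ∀ Y : FullSubquiver Γ, (Y ⟶ Z) → (vertexObj Y ⟶ vertexObj Z),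
      (∀ Y, IsIrrBasis k (ψ Y)) ∧
      ∑ᶠ a : Σ Y : FullSubquiver Γ, (Y ⟶ Z), φ a.1 (P.σ t a.1 a.2) ≫ ψ a.1 a.2 = 0 := by
  have := t.finite_source hKS hV hΓ
  have := Fintype.ofFinite (Σ Y : FullSubquiver Γ, (X ⟶ Y))
  have t' := t
  obtain ⟨E, f, g, h⟩ := t'
  obtain ⟨ψ, hψ, h'⟩ := IsAlmostSplitSeq.exists_desc (X := X) (Z := Z) hKS hV hΓ h hφ
  refine ⟨fun Y a => ψ Y (P.σ t Y a), fun Y => (hψ Y).reindex (P.σ t Y), ?_⟩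
  refine (finsum_comp_equiv (Equiv.sigmaCongrRight (P.σ t))
    (f := fun b : Σ Y : FullSubquiver Γ, (X ⟶ Y) => φ b.1 b.2 ≫ ψ b.1 b.2)).trans ?_
  rw [finsum_eq_sum_of_fintype, ← biproduct_lift_desc]
  exact h'.comp_eq_zero

theorem IsTranslateOn.exists_source_family {X Z : FullSubquiver Γ} (t : IsTranslateOn Γ X Z)
    {ψ : ∀ Y : FullSubquiver Γ, (Y ⟶ Z) → (vertexObj Y ⟶ vertexObj Z)}
    (hψ : ∀ Y, IsIrrBasis k (ψ Y)) :
    ∃ φ : ∀ Y : FullSubquiver Γ, (X ⟶ Y) → (vertexObj X ⟶ vertexObj Y),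
      (∀ Y, IsIrrBasis k (φ Y)) ∧
      ∑ᶠ a : Σ Y : FullSubquiver Γ, (Y ⟶ Z), φ a.1 (P.σ t a.1 a.2) ≫ ψ a.1 a.2 = 0 := by
  have := t.finite_sink hKS hV hΓ
  have := Fintype.ofFinite (Σ Y : FullSubquiver Γ, (Y ⟶ Z))
  have t' := t
  obtain ⟨E, f, g, h⟩ := t'
  obtain ⟨φ, hφ, h'⟩ := IsAlmostSplitSeq.exists_lift (X := X) (Z := Z) hKS hV hΓ h hψ
  refine ⟨fun Y a => φ Y ((P.σ t Y).symm a), fun Y => (hφ Y).reindex (P.σ t Y).symm, ?_⟩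
  simp only [Equiv.symm_apply_apply]
  rw [finsum_eq_sum_of_fintype, ← biproduct_lift_desc]
  exact h'.comp_eq_zero

/-- Irreducible morphisms for the arrows of a component with a section that satisfy the mesh
relations. -/
theorem exists_mesh_family {D : Set (FullSubquiver Γ)}
    (h : IsSectionedQuiver (IsTranslateOn Γ) D) :
    ∃ φ : ∀ X Y : FullSubquiver Γ, (X ⟶ Y) → (vertexObj X ⟶ vertexObj Y),
      (∀ X Y, IsIrrBasis k (φ X Y)) ∧ ∀ {X Z : FullSubquiver Γ} (t : IsTranslateOn Γ X Z),
      ∑ᶠ a : Σ Y : FullSubquiver Γ, (Y ⟶ Z), φ X a.1 (P.σ t a.1 a.2) ≫ φ a.1 Z a.2 = 0 := by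
  classical
  choose β hβ using fun X Y => hΓ.exists_isIrrBasis X Y
  have below {Y Z : FullSubquiver Γ} (hZ : 0 < h.level Z) (a : Y ⟶ Z) : h.Below Y Z :=
    h.below_of_arrow a hZ.le (by have := h.arrow_cases ⟨a⟩; lia)
  have above {X Y : FullSubquiver Γ} (hX : h.level X < 0) (a : X ⟶ Y) : h.Above Y X :=
    h.above_of_arrow a hX.le (by have := h.arrow_cases ⟨a⟩; lia)
  -- Upward recursion: at a vertex `Z` of positive level, all maps into the middle vertices are
  -- already fixed, so the maps into `Z` are chosen to complete the mesh ending at `Z`. At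
  -- non-positive levels the default basis `β` is kept.
  obtain ⟨S, hS⟩ := exists_forall_of_wellFounded h.wellFounded_below
    (A := fun Z => {s : ∀ Y : FullSubquiver Γ, (Y ⟶ Z) → (vertexObj Y ⟶ vertexObj Z) //
      ∀ Y, IsIrrBasis k (s Y)})
    (fun Z f s => (∀ (hZ : 0 < h.level Z) (X : FullSubquiver Γ) (t : IsTranslateOn Γ X Z),
      ∑ᶠ a : Σ Y : FullSubquiver Γ, (Y ⟶ Z),
        (f a.1 (below hZ a.2)).1 X (P.σ t a.1 a.2) ≫ s.1 a.1 a.2 = 0) ∧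
      (h.level Z ≤ 0 → ∀ Y a, s.1 Y a = β Y Z a)) (fun Z f => by
    by_cases hZ : 0 < h.level Z
    · obtain ⟨X, t⟩ := h.exists_translate_of_pos hZ
      let φ (Y : FullSubquiver Γ) : (X ⟶ Y) → (vertexObj X ⟶ vertexObj Y) :=
        if hY : Nonempty (Y ⟶ Z) then (f Y (below hZ hY.some)).1 X else β X Y
      have hφ (Y : FullSubquiver Γ) : IsIrrBasis k (φ Y) := by
        simp only [φ]
        split_ifs with hY
        · exact (f Y _).2 X
        · exact hβ X Y
      obtain ⟨ψ, hψ, hsum⟩ := t.exists_sink_family hKS hV hΓ P hφ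
      refine ⟨⟨ψ, hψ⟩, fun hZ X' t' => ?_, fun hZ' => absurd hZ hZ'.not_gt⟩
      obtain rfl := t.left_unique hKS hV t'
      rw [← hsum]
      refine finsum_congr fun a => ?_
      have hY : Nonempty (a.1 ⟶ Z) := ⟨a.2⟩
      simp only [φ, dif_pos hY]
    · exact ⟨⟨fun Y => β Y Z, fun Y => hβ Y Z⟩, fun hZ' => absurd hZ' hZ, fun _ _ _ => rfl⟩)
  -- The dual downward recursion chooses the maps out of each vertex of negative level, with `β` at
  -- the other vertices.
  obtain ⟨R, hR⟩ := exists_forall_of_wellFounded h.wellFounded_above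
    (A := fun X => {s : ∀ Y : FullSubquiver Γ, (X ⟶ Y) → (vertexObj X ⟶ vertexObj Y) //
      ∀ Y, IsIrrBasis k (s Y)})
    (fun X f s => (∀ (hX : h.level X < 0) (Z : FullSubquiver Γ) (t : IsTranslateOn Γ X Z),
      ∑ᶠ a : Σ Y : FullSubquiver Γ, (Y ⟶ Z),
        s.1 a.1 (P.σ t a.1 a.2) ≫ (f a.1 (above hX (P.σ t a.1 a.2))).1 Z a.2 = 0) ∧
      (0 ≤ h.level X → ∀ Y a, s.1 Y a = β X Y a)) (fun X f => by
    by_cases hX : h.level X < 0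
    · obtain ⟨Z, t⟩ := h.exists_translate_of_neg hX
      let ψ (Y : FullSubquiver Γ) : (Y ⟶ Z) → (vertexObj Y ⟶ vertexObj Z) :=
        if hY : Nonempty (X ⟶ Y) then (f Y (above hX hY.some)).1 Z else β Y Z
      have hψ (Y : FullSubquiver Γ) : IsIrrBasis k (ψ Y) := by
        simp only [ψ]
        split_ifs with hY
        · exact (f Y _).2 Z
        · exact hβ Y Z
      obtain ⟨φ, hφ, hsum⟩ := t.exists_source_family hKS hV hΓ P hψ
      refine ⟨⟨φ, hφ⟩, fun hX Z' t' => ?_, fun hX' => absurd hX hX'.not_gt⟩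
      obtain rfl := t.right_unique hKS hV t'
      rw [← hsum]
      refine finsum_congr fun a => ?_
      have hY : Nonempty (X ⟶ a.1) := ⟨P.σ t a.1 a.2⟩
      simp only [ψ, dif_pos hY]
    · exact ⟨⟨β X, hβ X⟩, fun hX' => absurd hX' hX, fun _ _ _ => rfl⟩)
  -- The level of the target selects the family. Meshes ending at non-positive level use only `R`,
  -- and those ending at positive level use `S`, up to arrows within level zero.
  refine ⟨fun X Y => if 0 < h.level Y then (S Y).1 X else (R X).1 Y, fun X Y => ?_,
    fun {X Z} t => ?_⟩
  · dsimp only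
    split_ifs
    · exact (S Y).2 X
    · exact (R X).2 Y
  · have hl := h.level_of_translate t
    by_cases hZ : 0 < h.level Z
    · rw [← (hS Z).1 hZ X t]
      refine finsum_congr fun a => ?_
      simp only [if_pos hZ]
      split_ifs with hY
      · rfl
      -- At the interface, `X` has level at least zero and the middle vertex at most zero, so both
      -- families agree with `β`.
      · rw [(hS a.1).2 (not_lt.1 hY), (hR X).2 (by lia)]
    · rw [← (hR X).1 (by lia) Z t]
      refine finsum_congr fun a => ?_
      have := h.arrow_cases ⟨a.2⟩
      simp only [if_neg hZ, if_neg (show ¬ 0 < h.level a.1 by lia)]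

variable {φ : ∀ X Y : FullSubquiver Γ, (X ⟶ Y) → (vertexObj X ⟶ vertexObj Y)}
  (hφ : ∀ X Y, IsIrrBasis k (φ X Y))

include hφ

theorem IsSourceMorphism.exists_eq_sum {X : FullSubquiver Γ}
    [Fintype (Σ Y : FullSubquiver Γ, (X ⟶ Y))] {E : C} {f : vertexObj X ⟶ E}
    (hf : IsSourceMorphism f) {N : C} {r : vertexObj X ⟶ N} (hr : r ∈ rad k _ _) :
    ∃ l : ∀ a : Σ Y : FullSubquiver Γ, (X ⟶ Y), vertexObj a.1 ⟶ N,
      r = ∑ a, φ X a.1 a.2 ≫ l a := by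
  obtain ⟨e, he⟩ := hf.exists_iso_lift hKS hV hΓ (hφ X)
  obtain ⟨l, rfl⟩ := hf.almostSplit.exists_of_mem_rad hr
  refine ⟨fun a => biproduct.ι (fun a : Σ Y : FullSubquiver Γ, (X ⟶ Y) => vertexObj a.1) a ≫
    e.inv ≫ l, ?_⟩
  rw [← biproduct_lift_desc, ← he, Category.assoc]
  have : (biproduct.desc fun a : Σ Y : FullSubquiver Γ, (X ⟶ Y) =>
    biproduct.ι (fun a : Σ Y : FullSubquiver Γ, (X ⟶ Y) => vertexObj a.1) a ≫ e.inv ≫ l) =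
      e.inv ≫ l := by
    ext; simp
  rw [this]; simp

theorem IsSinkMorphism.exists_eq_sum {Z : FullSubquiver Γ}
    [Fintype (Σ Y : FullSubquiver Γ, (Y ⟶ Z))] {E : C} {g : E ⟶ vertexObj Z}
    (hg : IsSinkMorphism g) {N : C} {r : N ⟶ vertexObj Z} (hr : r ∈ rad k _ _) :
    ∃ l : ∀ a : Σ Y : FullSubquiver Γ, (Y ⟶ Z), N ⟶ vertexObj a.1,
      r = ∑ a, l a ≫ φ a.1 Z a.2 := by
  obtain ⟨e, he⟩ := hg.exists_iso_desc hKS hV hΓ (fun Y => hφ Y Z)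
  obtain ⟨l, rfl⟩ := hg.almostSplit.exists_of_mem_rad hr
  refine ⟨fun a => l ≫ e.hom ≫
    biproduct.π (fun a : Σ Y : FullSubquiver Γ, (Y ⟶ Z) => vertexObj a.1) a, ?_⟩
  rw [← biproduct_lift_desc, ← he]
  have : (biproduct.lift fun a : Σ Y : FullSubquiver Γ, (Y ⟶ Z) => l ≫ e.hom ≫
    biproduct.π (fun a : Σ Y : FullSubquiver Γ, (Y ⟶ Z) => vertexObj a.1) a) = l ≫ e.hom := by
    ext; simp
  rw [this]; simp

theorem eq_zero_of_sum_comp_eq_zero {X : FullSubquiver Γ}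
    [Fintype (Σ Y : FullSubquiver Γ, (X ⟶ Y))] {E : C} {f : vertexObj X ⟶ E}
    (hf : IsSourceMorphism f) (hepi : Epi f) {N : C}
    {l : ∀ a : Σ Y : FullSubquiver Γ, (X ⟶ Y), vertexObj a.1 ⟶ N}
    (hl : ∑ a, φ X a.1 a.2 ≫ l a = 0) (a) : l a = 0 := by
  obtain ⟨e, he⟩ := hf.exists_iso_lift hKS hV hΓ (hφ X)
  rw [← biproduct_lift_desc, ← he, Category.assoc] at hl
  have h₁ : biproduct.desc l = 0 := by
    rw [← cancel_epi e.hom, ← cancel_epi f, hl]; simp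
  rw [← biproduct.ι_desc l a, h₁, comp_zero]

theorem eq_zero_of_sum_comp_eq_zero' {Z : FullSubquiver Γ}
    [Fintype (Σ Y : FullSubquiver Γ, (Y ⟶ Z))] {E : C} {g : E ⟶ vertexObj Z}
    (hg : IsSinkMorphism g) (hmono : Mono g) {N : C}
    {l : ∀ a : Σ Y : FullSubquiver Γ, (Y ⟶ Z), N ⟶ vertexObj a.1}
    (hl : ∑ a, l a ≫ φ a.1 Z a.2 = 0) (a) : l a = 0 := by
  obtain ⟨e, he⟩ := hg.exists_iso_desc hKS hV hΓ (fun Y => hφ Y Z)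
  rw [← biproduct_lift_desc, ← he] at hl
  have h₁ : biproduct.lift l = 0 := by
    rw [← cancel_mono e.inv, ← cancel_mono g, Category.assoc, hl]; simp
  rw [← biproduct.lift_π l a, h₁, zero_comp]

variable (hmesh : ∀ {X Z : FullSubquiver Γ} (t : IsTranslateOn Γ X Z),
      ∑ᶠ a : Σ Y : FullSubquiver Γ, (Y ⟶ Z), φ X a.1 (P.σ t a.1 a.2) ≫ φ a.1 Z a.2 = 0)

include hmesh

omit hKS hV hΓ hφ [HasFiniteBiproducts C] hfin in
theorem sum_comp_symm_eq_zero {X Z : FullSubquiver Γ} (t : IsTranslateOn Γ X Z)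
    [Fintype (Σ Y : FullSubquiver Γ, (X ⟶ Y))] :
    ∑ a : Σ Y : FullSubquiver Γ, (X ⟶ Y), φ X a.1 a.2 ≫ φ a.1 Z ((P.σ t a.1).symm a.2) = 0 := by
  rw [← hmesh t, ← finsum_eq_sum_of_fintype, ← finsum_comp_equiv
    (Equiv.sigmaCongrRight (P.σ t))]
  exact finsum_congr fun a => congrArg (fun b => φ X a.1 (P.σ t a.1 a.2) ≫ φ a.1 Z b)
    ((P.σ t a.1).symm_apply_apply a.2)

/-- Exactness of the chosen mesh at its middle term. The sink family `ψ` completing `φ X` need not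
be the chosen `φ`, but the pseudo-cokernel compares the two by an endomorphism `s` of `Z`, through
which the factor `w` is corrected. -/
theorem IsTranslateOn.exists_of_sum_comp_eq_zero {X Z : FullSubquiver Γ}
    (t : IsTranslateOn Γ X Z) [Fintype (Σ Y : FullSubquiver Γ, (X ⟶ Y))] {N : C}
    {l : ∀ a : Σ Y : FullSubquiver Γ, (X ⟶ Y), vertexObj a.1 ⟶ N}
    (hl : ∑ a, φ X a.1 a.2 ≫ l a = 0) :
    ∃ w : vertexObj Z ⟶ N, ∀ a : Σ Y : FullSubquiver Γ, (X ⟶ Y),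
      l a = φ a.1 Z ((P.σ t a.1).symm a.2) ≫ w := by
  have hsum := sum_comp_symm_eq_zero P hmesh t
  have hloc := hV.isLocalRing_end hKS (vertexObj_mem Z)
  have t' := t
  obtain ⟨E, f, g, h⟩ := t'
  obtain ⟨ψ, hψ, h'⟩ := IsAlmostSplitSeq.exists_desc (X := X) (Z := Z) hKS hV hΓ h (hφ X)
  rw [← biproduct_lift_desc] at hsum hl
  obtain ⟨s, hs⟩ := h'.pseudoCokernel _ hsum
  obtain ⟨w, hw⟩ := h'.pseudoCokernel _ hl
  have hs' (a : Σ Y : FullSubquiver Γ, (X ⟶ Y)) :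
      ψ a.1 a.2 ≫ s = φ a.1 Z ((P.σ t a.1).symm a.2) := by
    simpa using congrArg (biproduct.ι
      (fun a : Σ Y : FullSubquiver Γ, (X ⟶ Y) => vertexObj a.1) a ≫ ·) hs
  have hw' (a : Σ Y : FullSubquiver Γ, (X ⟶ Y)) : ψ a.1 a.2 ≫ w = l a := by
    simpa using congrArg (biproduct.ι
      (fun a : Σ Y : FullSubquiver Γ, (X ⟶ Y) => vertexObj a.1) a ≫ ·) hw
  by_cases hmono : IsSplitMono s
  · have := isIso_of_comp_eq_id (IsSplitMono.id s)
    exact ⟨inv s ≫ w, fun a => by rw [← hs', ← hw']; simp⟩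
  -- If `s` is not invertible it is radical, which would put every chosen map into `Z` in rad². So
  -- the mesh has no arrows and the claim is vacuous.
  · have : IsEmpty (Σ Y : FullSubquiver Γ, (X ⟶ Y)) := ⟨fun a => by
      refine (hφ a.1 Z).notMem_radSq ((P.σ t a.1).symm a.2) ?_
      rw [← hs']
      exact comp_mem_radSq ((hψ _).mem_rad _) (mem_rad_of_not_isSplitMono hmono)⟩
    exact ⟨0, fun a => isEmptyElim a⟩

theorem IsTranslateOn.exists_of_sum_comp_eq_zero' {X Z : FullSubquiver Γ}
    (t : IsTranslateOn Γ X Z) [Fintype (Σ Y : FullSubquiver Γ, (Y ⟶ Z))] {N : C}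
    {l : ∀ a : Σ Y : FullSubquiver Γ, (Y ⟶ Z), N ⟶ vertexObj a.1}
    (hl : ∑ a, l a ≫ φ a.1 Z a.2 = 0) :
    ∃ w : N ⟶ vertexObj X, ∀ a : Σ Y : FullSubquiver Γ, (Y ⟶ Z),
      l a = w ≫ φ X a.1 (P.σ t a.1 a.2) := by
  have hsum := hmesh t
  have hloc := hV.isLocalRing_end hKS (vertexObj_mem X)
  have t' := t
  obtain ⟨E, f, g, h⟩ := t'
  obtain ⟨ψ, hψ, h'⟩ := IsAlmostSplitSeq.exists_lift (X := X) (Z := Z) hKS hV hΓ h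
    (fun Y => hφ Y Z)
  rw [finsum_eq_sum_of_fintype] at hsum
  rw [← biproduct_lift_desc] at hsum hl
  obtain ⟨s, hs⟩ := h'.pseudoKernel _ hsum
  obtain ⟨w, hw⟩ := h'.pseudoKernel _ hl
  have hs' (a : Σ Y : FullSubquiver Γ, (Y ⟶ Z)) :
      s ≫ ψ a.1 a.2 = φ X a.1 (P.σ t a.1 a.2) := by
    simpa using congrArg (· ≫ biproduct.π
      (fun a : Σ Y : FullSubquiver Γ, (Y ⟶ Z) => vertexObj a.1) a) hs
  have hw' (a : Σ Y : FullSubquiver Γ, (Y ⟶ Z)) : w ≫ ψ a.1 a.2 = l a := by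
    simpa using congrArg (· ≫ biproduct.π
      (fun a : Σ Y : FullSubquiver Γ, (Y ⟶ Z) => vertexObj a.1) a) hw
  by_cases hmono : IsSplitMono s
  · have := isIso_of_comp_eq_id (IsSplitMono.id s)
    exact ⟨w ≫ inv s, fun a => by rw [← hs', ← hw']; simp⟩
  · have : IsEmpty (Σ Y : FullSubquiver Γ, (Y ⟶ Z)) := ⟨fun a => by
      refine (hφ X a.1).notMem_radSq (P.σ t a.1 a.2) ?_
      rw [← hs']
      exact comp_mem_radSq (mem_rad_of_not_isSplitMono hmono) ((hψ _).mem_rad _)⟩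
    exact ⟨0, fun a => isEmptyElim a⟩

end Component

/-! ### The section in the component, and the criterion for standardness. -/

section Component

variable {k : Type w} [Field k] {C : Type u} [Category.{v} C] [Preadditive C] [Linear k C]
  [HasFiniteBiproducts C] [hfin : ∀ X Y : C, FiniteDimensional k (X ⟶ Y)]
  (hKS : IsKrullSchmidt C) {V : Set C} (hV : IsCompleteSetOfIndecomposables V)
  {Γ : Set (ARQuiver k V)} (hΓ : IsTrivialComponent Γ)

-- Convexity puts every vertex of a path between section vertices into Δ, so a cycle in Γ through Δ
-- becomes one that acyclicity of Δ excludes.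
omit [HasFiniteBiproducts C] hfin in
theorem nonempty_path_of_forall_mem {Δ : Set (ARQuiver k V)} (hc : IsConvexIn Δ Γ)
    {X Y : FullSubquiver Γ} (p : Quiver.Path X Y)
    (hX : (Subtype.val X : ARQuiver k V) ∈ Δ) (hY : (Subtype.val Y : ARQuiver k V) ∈ Δ) :
    Nonempty (@Quiver.Path (FullSubquiver Δ) _ ⟨X.1, hX⟩ ⟨Y.1, hY⟩) := by
  induction p with
  | nil => exact ⟨.nil⟩
  | @cons Z W q a ih =>
    have hZ := hc X Z W hX hY ⟨q⟩ ⟨a.toPath⟩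
    exact ⟨(ih hZ).some.cons a⟩

include hKS hV hΓ

theorem IsSection.isSectionedQuiver {Δ : Set (ARQuiver k V)} (hΔ : IsSection IsTranslate Δ Γ)
    (hpath : HasNoInfinitePath Δ) : IsSectionedQuiver (IsTranslateOn Γ)
      {X : FullSubquiver Γ | (Subtype.val X : ARQuiver k V) ∈ Δ} where
  left_unique h h' := h.left_unique hKS hV h'
  right_unique h h' := h.right_unique hKS hV h'
  nonempty_iff t Y := ((hΓ.polarization hKS hV).σ t Y).nonempty_congr
  exists_middle {X Z} t := by
    obtain ⟨E, f, g, h⟩ := t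
    obtain ⟨Y, hY, -⟩ := h.exists_arrows hKS hV (hΓ.trivial _ X.2) (hΓ.trivial _ Z.2)
    exact ⟨⟨Y, (hΓ.mem_iff hY).1 X.2⟩, hY⟩
  convex {X Y Z} := hΔ.convex X Y Z
  acyclic {X Y} hX hY := by
    rintro ⟨a⟩ ⟨p⟩
    obtain ⟨q⟩ := nonempty_path_of_forall_mem hΔ.convex p hY hX
    exact absurd (hΔ.acyclic _ (q.cons a)) (Nat.succ_ne_zero _)
  exists_shift X := by
    obtain ⟨x, ⟨hx, hXx⟩, -⟩ := hΔ.meets_orbit X.1 X.2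
    obtain ⟨n, hn⟩ := (IsShift.exists_of_eqvGen hKS hV hΓ hXx).2 X.2 (hΔ.subset hx)
    exact ⟨⟨x, hΔ.subset hx⟩, hx, _, hn.symm⟩
  eq_of_shift {x y n} hx hy h := by
    have hxy {x y : FullSubquiver Γ} (h : Relation.EqvGen (IsTranslateOn Γ) x y) :
        Relation.EqvGen IsTranslate (Subtype.val x : ARQuiver k V) (Subtype.val y) := by
      induction h with
      | rel _ _ h => exact .rel _ _ h
      | refl => exact .refl _
      | symm _ _ _ ih => exact .symm _ _ ih
      | trans _ _ _ _ _ ih₁ ih₂ => exact .trans _ _ _ ih₁ ih₂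
    exact Subtype.ext ((hΔ.meets_orbit x.1 x.2).unique ⟨hx, .refl _⟩ ⟨hy, hxy h.eqvGen⟩)
  -- A descending chain here is a path without starting point; for `wf_swap` it is one without
  -- ending point.
  wf := by
    rw [wellFounded_iff_isEmpty_descending_chain]
    exact ⟨fun f => hpath.1 ⟨fun n => ⟨(f.1 n).1, (f.2 n).2.1⟩, fun n => (f.2 n).2.2⟩⟩
  wf_swap := by
    rw [wellFounded_iff_isEmpty_descending_chain]
    exact ⟨fun f => hpath.2 ⟨fun n => ⟨(f.1 n).1, (f.2 n).2.1⟩, fun n => (f.2 n).2.2⟩⟩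

theorem IsShift.exists_of_transGen {X Y : ARQuiver k V} (h : Relation.TransGen IsTranslate X Y) :
    (X ∈ Γ ↔ Y ∈ Γ) ∧ ∀ (hX : X ∈ Γ) (hY : Y ∈ Γ),
      ∃ n > 0, IsShift (IsTranslateOn Γ) n (⟨X, hX⟩ : FullSubquiver Γ) ⟨Y, hY⟩ := by
  induction h with
  | single t =>
    exact ⟨isTranslate_mem_iff hKS hV hΓ t,
      fun hX hY => ⟨0 + 1, by simp, (IsShift.refl _).up t⟩⟩
  | tail _ t ih =>
    refine ⟨ih.1.trans (isTranslate_mem_iff hKS hV hΓ t), fun hX hY => ?_⟩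
    obtain ⟨n, hn, hs⟩ := ih.2 hX (ih.1.1 hX)
    exact ⟨n + 1, by lia, hs.up t⟩

theorem mem_sectionPlus_iff {Δ : Set (ARQuiver k V)} (hΔ : Δ ⊆ Γ)
    (h : IsSectionedQuiver (IsTranslateOn Γ)
      {X : FullSubquiver Γ | (Subtype.val X : ARQuiver k V) ∈ Δ}) (X : ARQuiver k V) :
    X ∈ sectionPlus IsTranslate Δ ↔
      ∃ hX : X ∈ Γ, 0 < h.level (⟨X, hX⟩ : FullSubquiver Γ) := by
  constructor
  · rintro ⟨x, hx, hX⟩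
    obtain ⟨h₁, h₂⟩ := IsShift.exists_of_transGen hKS hV hΓ hX
    obtain ⟨n, hn, hs⟩ := h₂ (hΔ hx) (h₁.1 (hΔ hx))
    exact ⟨h₁.1 (hΔ hx), by rw [(h.eq_of_isShift hx hs).1]; exact hn⟩
  · rintro ⟨hX, hl⟩
    obtain ⟨m, hm, hs⟩ := h.exists_translatePow_of_nonneg hl.le
    cases m with
    | zero => lia
    | succ m =>
      exact ⟨_, h.base_mem _, hs.transGen.lift Subtype.val fun _ _ t => t⟩

theorem mem_sectionMinus_iff {Δ : Set (ARQuiver k V)} (hΔ : Δ ⊆ Γ)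
    (h : IsSectionedQuiver (IsTranslateOn Γ)
      {X : FullSubquiver Γ | (Subtype.val X : ARQuiver k V) ∈ Δ}) (X : ARQuiver k V) :
    X ∈ sectionMinus IsTranslate Δ ↔
      ∃ hX : X ∈ Γ, h.level (⟨X, hX⟩ : FullSubquiver Γ) < 0 := by
  constructor
  · rintro ⟨x, hx, hX⟩
    obtain ⟨h₁, h₂⟩ := IsShift.exists_of_transGen hKS hV hΓ hX
    obtain ⟨n, hn, hs⟩ := h₂ (h₁.2 (hΔ hx)) (hΔ hx)
    exact ⟨h₁.2 (hΔ hx), by rw [(h.eq_of_isShift hx hs.symm).1]; lia⟩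
  · rintro ⟨hX, hl⟩
    obtain ⟨m, hm, hs⟩ := h.exists_translatePow_of_nonpos hl.le
    cases m with
    | zero => lia
    | succ m =>
      exact ⟨_, h.base_mem _, hs.transGen.lift Subtype.val fun _ _ t => t⟩

omit hΓ in
theorem IsAlmostSplitSeq.exists_isTranslateOn_right (hΓ : IsTrivialComponent Γ)
    {X : FullSubquiver Γ} {E Z : C} {f : vertexObj X ⟶ E} {g : E ⟶ Z}
    (h : IsAlmostSplitSeq f g) : ∃ Z : FullSubquiver Γ, IsTranslateOn Γ X Z := by
  have := hasBinaryBiproducts_of_finite_biproducts C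
  obtain ⟨Z', ⟨hZ', ⟨i⟩⟩, -⟩ := hV.2 Z h.sink.almostSplit.indecomposable
  have t : IsTranslate (Subtype.val X : ARQuiver k V) (⟨Z', hZ'⟩ : V) :=
    ⟨E, _, _, h.transport (Iso.refl _) (Iso.refl _) i⟩
  exact ⟨⟨_, (isTranslate_mem_iff hKS hV hΓ t).1 X.2⟩, t⟩

omit hΓ in
theorem IsAlmostSplitSeq.exists_isTranslateOn_left (hΓ : IsTrivialComponent Γ)
    {Z : FullSubquiver Γ} {E X : C} {f : X ⟶ E} {g : E ⟶ vertexObj Z}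
    (h : IsAlmostSplitSeq f g) : ∃ X : FullSubquiver Γ, IsTranslateOn Γ X Z := by
  have := hasBinaryBiproducts_of_finite_biproducts C
  obtain ⟨X', ⟨hX', ⟨i⟩⟩, -⟩ := hV.2 X h.source.almostSplit.indecomposable
  have t : IsTranslate (⟨X', hX'⟩ : V) (Subtype.val Z : ARQuiver k V) :=
    ⟨E, _, _, h.transport i.symm (Iso.refl _) (Iso.refl _)⟩
  exact ⟨⟨_, (isTranslate_mem_iff hKS hV hΓ t).2 Z.2⟩, t⟩

variable (P : Polarization (IsTranslateOn Γ))
  {φ : ∀ X Y : FullSubquiver Γ, (X ⟶ Y) → (vertexObj X ⟶ vertexObj Y)}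
  (hφ : ∀ X Y, IsIrrBasis k (φ X Y))
  (hmesh : ∀ {X Z : FullSubquiver Γ} (t : IsTranslateOn Γ X Z),
      Finite (Σ Y : FullSubquiver Γ, (Y ⟶ Z)) ∧
      ∑ᶠ a : Σ Y : FullSubquiver Γ, (Y ⟶ Z), φ X a.1 (P.σ t a.1 a.2) ≫ φ a.1 Z a.2 = 0)

include hφ

/-- Maps out of `X` are generated by the identity and the arrows out of `X`, in both categories.
Their relations are controlled by `τ⁻X`, or absent when the source morphism is epi; so bijectivity
at the direct successors and at `τ⁻X` gives it at `X`. -/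
theorem bijective_lift_of_source {X Y : FullSubquiver Γ}
    (hX : HasProperSourceMorphism (vertexObj X))
    (h₁ : ∀ X' : FullSubquiver Γ, (X ⟶ X') → Function.Bijective
      ((MeshCategory.lift k P φ hmesh).map : (MeshCategory.of k P X' ⟶ .of k P Y) → _))
    (h₂ : ∀ Z : FullSubquiver Γ, IsTranslateOn Γ X Z → Function.Bijective
      ((MeshCategory.lift k P φ hmesh).map : (MeshCategory.of k P Z ⟶ .of k P Y) → _)) :
    Function.Bijective
      ((MeshCategory.lift k P φ hmesh).map : (MeshCategory.of k P X ⟶ .of k P Y) → _) := by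
  obtain ⟨E, f, hf, hfE⟩ := hX
  have := hf.finite_arrows hKS hV hΓ
  have := Fintype.ofFinite (Σ Y : FullSubquiver Γ, (X ⟶ Y))
  have hrad {N : C} (l : ∀ a : Σ Y : FullSubquiver Γ, (X ⟶ Y), vertexObj a.1 ⟶ N) :
      ∑ a, φ X a.1 a.2 ≫ l a ∈ rad k _ _ :=
    sum_mem fun a _ => rad_comp ((hφ _ _).mem_rad _) _
  have hid (X : FullSubquiver Γ) : (MeshCategory.lift k P φ hmesh).map
      (MeshCategory.idOrZero k P X X) = 𝟙 (vertexObj X) :=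
    (congrArg _ (MeshCategory.idOrZero_self k P X)).trans
      ((MeshCategory.lift k P φ hmesh).map_id _)
  have hX0 : ¬ IsZero (vertexObj X) := (hΓ.isScalarFamily hKS hV).not_isZero X
  refine bijective_map_of_source (MeshCategory.lift k P φ hmesh) (MeshCategory.idOrZero k P X Y)
    (fun a : Σ Y : FullSubquiver Γ, (X ⟶ Y) => MeshCategory.arrow k P a.2)
    (MeshCategory.exists_eq_sum_arrow_comp k P) ?_ ?_ (fun a => h₁ a.1 a.2) ?_
  · intro r
    simp only [MeshCategory.lift_map_arrow]
    by_cases hXY : X = Y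
    · subst hXY
      obtain ⟨c, hc⟩ := (hΓ.isScalarFamily hKS hV).exists_sub_mem X r
      obtain ⟨l, hl⟩ := hf.exists_eq_sum hKS hV hΓ hφ hc
      refine ⟨c, l, ?_⟩
      exact (sub_eq_iff_eq_add'.1 hl).trans (congrArg (fun z => c • z + _) (hid X).symm)
    · obtain ⟨l, hl⟩ := hf.exists_eq_sum hKS hV hΓ hφ
        ((hΓ.isScalarFamily hKS hV).mem_rad X Y hXY r)
      refine ⟨0, l, ?_⟩
      rw [zero_smul, zero_add]
      exact hl
  · intro c l hcl
    simp only [MeshCategory.lift_map_arrow] at hcl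
    by_cases hXY : X = Y
    · subst hXY
      have hc (l : ∀ a : Σ Y : FullSubquiver Γ, (X ⟶ Y), vertexObj a.1 ⟶ vertexObj X)
          (h : c • 𝟙 (vertexObj X) + ∑ a, φ X a.1 a.2 ≫ l a = 0) : c = 0 := by
        refine smul_id_mem_rad hX0 ?_
        rw [eq_neg_of_add_eq_zero_left h]
        exact neg_mem (hrad l)
      rw [hc l ((congrArg (fun z => c • z + _) (hid X).symm).trans hcl), zero_smul]
    · rw [MeshCategory.idOrZero_of_ne k P hXY, smul_zero]
  · intro l hl
    simp only [MeshCategory.lift_map_arrow] at hl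
    obtain hepi | ⟨Z, g, hfg⟩ := hfE
    · refine ⟨fun a => 0, fun a => ?_, by simp⟩
      rw [Functor.map_zero]
      exact (eq_zero_of_sum_comp_eq_zero hKS hV hΓ hφ hf hepi hl a).symm
    · obtain ⟨Z, t⟩ := IsAlmostSplitSeq.exists_isTranslateOn_right hKS hV hΓ hfg
      -- A relation in `C` is the mesh relation followed by `w`; surjectivity at `τ⁻X` lifts `w`,
      -- and the mesh relation upstairs gives the lifted relation.
      obtain ⟨w, hw⟩ := t.exists_of_sum_comp_eq_zero hKS hV hΓ P hφ (fun t => (hmesh t).2) hl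
      obtain ⟨w, rfl⟩ := (h₂ Z t).2 w
      refine ⟨fun a => MeshCategory.arrow k P ((P.σ t a.1).symm a.2) ≫ w, fun a => ?_, ?_⟩
      · rw [hw a, Functor.map_comp, MeshCategory.lift_map_arrow]
        rfl
      · have := (hmesh t).1
        have := Fintype.ofFinite (Σ Y : FullSubquiver Γ, (Y ⟶ Z))
        have hs := MeshCategory.sum_arrow_comp_arrow k P t
        simp only [← Category.assoc]
        rw [← Preadditive.sum_comp]
        refine (congrArg (· ≫ w) ?_).trans zero_comp
        rw [← hs, ← (Equiv.sigmaCongrRight (P.σ t)).sum_comp]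
        exact Finset.sum_congr rfl fun a _ => congrArg (fun b =>
          MeshCategory.arrow k P (P.σ t a.1 a.2) ≫ MeshCategory.arrow k P b)
          ((P.σ t a.1).symm_apply_apply a.2)

theorem bijective_lift_of_sink {X Z : FullSubquiver Γ}
    (hZ : HasProperSinkMorphism (vertexObj Z))
    (h₁ : ∀ Z' : FullSubquiver Γ, (Z' ⟶ Z) → Function.Bijective
      ((MeshCategory.lift k P φ hmesh).map : (MeshCategory.of k P X ⟶ .of k P Z') → _))
    (h₂ : ∀ Y : FullSubquiver Γ, IsTranslateOn Γ Y Z → Function.Bijective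
      ((MeshCategory.lift k P φ hmesh).map : (MeshCategory.of k P X ⟶ .of k P Y) → _)) :
    Function.Bijective
      ((MeshCategory.lift k P φ hmesh).map : (MeshCategory.of k P X ⟶ .of k P Z) → _) := by
  obtain ⟨E, g, hg, hgE⟩ := hZ
  have := hg.finite_arrows hKS hV hΓ
  have := Fintype.ofFinite (Σ Y : FullSubquiver Γ, (Y ⟶ Z))
  have hrad {N : C} (l : ∀ a : Σ Y : FullSubquiver Γ, (Y ⟶ Z), N ⟶ vertexObj a.1) :
      ∑ a, l a ≫ φ a.1 Z a.2 ∈ rad k _ _ :=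
    sum_mem fun a _ => comp_rad _ ((hφ _ _).mem_rad _)
  have hid (X : FullSubquiver Γ) : (MeshCategory.lift k P φ hmesh).map
      (MeshCategory.idOrZero k P X X) = 𝟙 (vertexObj X) :=
    (congrArg _ (MeshCategory.idOrZero_self k P X)).trans
      ((MeshCategory.lift k P φ hmesh).map_id _)
  have hZ0 : ¬ IsZero (vertexObj Z) := (hΓ.isScalarFamily hKS hV).not_isZero Z
  refine bijective_map_of_sink (MeshCategory.lift k P φ hmesh) (MeshCategory.idOrZero k P X Z)
    (fun a : Σ Y : FullSubquiver Γ, (Y ⟶ Z) => MeshCategory.arrow k P a.2)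
    (MeshCategory.exists_eq_sum_comp_arrow k P) ?_ ?_ (fun a => h₁ a.1 a.2) ?_
  · intro r
    simp only [MeshCategory.lift_map_arrow]
    by_cases hXZ : X = Z
    · subst hXZ
      obtain ⟨c, hc⟩ := (hΓ.isScalarFamily hKS hV).exists_sub_mem X r
      obtain ⟨l, hl⟩ := hg.exists_eq_sum hKS hV hΓ hφ hc
      refine ⟨c, l, ?_⟩
      exact (sub_eq_iff_eq_add'.1 hl).trans (congrArg (fun z => c • z + _) (hid X).symm)
    · obtain ⟨l, hl⟩ := hg.exists_eq_sum hKS hV hΓ hφ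
        ((hΓ.isScalarFamily hKS hV).mem_rad X Z hXZ r)
      refine ⟨0, l, ?_⟩
      rw [zero_smul, zero_add]
      exact hl
  · intro c l hcl
    simp only [MeshCategory.lift_map_arrow] at hcl
    by_cases hXZ : X = Z
    · subst hXZ
      have hc (l : ∀ a : Σ Y : FullSubquiver Γ, (Y ⟶ X), vertexObj X ⟶ vertexObj a.1)
          (h : c • 𝟙 (vertexObj X) + ∑ a, l a ≫ φ a.1 X a.2 = 0) : c = 0 := by
        refine smul_id_mem_rad hZ0 ?_
        rw [eq_neg_of_add_eq_zero_left h]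
        exact neg_mem (hrad l)
      rw [hc l ((congrArg (fun z => c • z + _) (hid X).symm).trans hcl), zero_smul]
    · rw [MeshCategory.idOrZero_of_ne k P hXZ, smul_zero]
  · intro l hl
    simp only [MeshCategory.lift_map_arrow] at hl
    obtain hmono | ⟨Y, f, hfg⟩ := hgE
    · refine ⟨fun a => 0, fun a => ?_, by simp⟩
      rw [Functor.map_zero]
      exact (eq_zero_of_sum_comp_eq_zero' hKS hV hΓ hφ hg hmono hl a).symm
    · obtain ⟨Y, t⟩ := IsAlmostSplitSeq.exists_isTranslateOn_left hKS hV hΓ hfg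
      obtain ⟨w, hw⟩ := t.exists_of_sum_comp_eq_zero' hKS hV hΓ P hφ (fun t => (hmesh t).2) hl
      obtain ⟨w, rfl⟩ := (h₂ Y t).2 w
      refine ⟨fun a => w ≫ MeshCategory.arrow k P (P.σ t a.1 a.2), fun a => ?_, ?_⟩
      · rw [hw a, Functor.map_comp, MeshCategory.lift_map_arrow]
        rfl
      · simp only [Category.assoc]
        rw [← Preadditive.comp_sum, MeshCategory.sum_arrow_comp_arrow, comp_zero]

-- The order of the inductions matters: proper source morphisms are at hand only at levels at most
-- zero, and proper sink morphisms only at levels at least zero. So first `Y` is kept negative while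
-- `X` varies; then `X` is arbitrary while `Y` climbs.
omit hφ in
theorem bijective_lift {Δ : Set (ARQuiver k V)} (hΔ : Δ ⊆ Γ)
    (h : IsSectionedQuiver (IsTranslateOn Γ)
      {X : FullSubquiver Γ | (Subtype.val X : ARQuiver k V) ∈ Δ})
    (hφ : ∀ X Y, IsIrrBasis k (φ X Y))
    (hsink : ∀ X ∈ Δ, HasProperSinkMorphism X.obj)
    (hsource : ∀ X ∈ Δ, HasProperSourceMorphism X.obj)
    (hvan : HomVanishes (sectionPlus IsTranslate Δ) (sectionMinus IsTranslate Δ))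
    (X Y : FullSubquiver Γ) : Function.Bijective
      ((MeshCategory.lift k P φ hmesh).map : (MeshCategory.of k P X ⟶ .of k P Y) → _) := by
  -- On the section this is a hypothesis; below it, `τ⁻X` exists and supplies an almost split
  -- sequence.
  have hso (X : FullSubquiver Γ) (hX : h.level X ≤ 0) :
      HasProperSourceMorphism (vertexObj X) := by
    obtain hX | hX := hX.lt_or_eq
    · obtain ⟨Z, E, f, g, hfg⟩ := h.exists_translate_of_neg hX
      exact ⟨E, f, hfg.source, .inr ⟨_, g, hfg⟩⟩
    · exact hsource _ (h.mem_of_level_eq_zero hX)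
  have hsi (X : FullSubquiver Γ) (hX : 0 ≤ h.level X) :
      HasProperSinkMorphism (vertexObj X) := by
    obtain hX | hX := hX.lt_or_eq
    · obtain ⟨Z, E, f, g, hfg⟩ := h.exists_translate_of_pos hX
      exact ⟨E, g, hfg.sink, .inr ⟨_, f, hfg⟩⟩
    · exact hsink _ (h.mem_of_level_eq_zero hX.symm)
  have base (X Y : FullSubquiver Γ) (hX : 0 < h.level X) (hY : h.level Y < 0) :
      Function.Bijective
        ((MeshCategory.lift k P φ hmesh).map : (MeshCategory.of k P X ⟶ .of k P Y) → _) := by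
    have h₁ := MeshCategory.eq_zero_of_isEmpty k P (X := X) (Y := Y)
      ⟨fun p => by have := h.level_le_of_path p; lia⟩
    have h₂ (f : vertexObj X ⟶ vertexObj Y) : f = 0 :=
      hvan _ ((mem_sectionPlus_iff hKS hV hΓ hΔ h _).2 ⟨X.2, hX⟩) _
        ((mem_sectionMinus_iff hKS hV hΓ hΔ h _).2 ⟨Y.2, hY⟩) f
    exact ⟨fun f g _ => by rw [h₁ f, h₁ g],
      fun f => ⟨0, ((MeshCategory.lift k P φ hmesh).map_zero _ _).trans (h₂ f).symm⟩⟩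
  -- Direct successors and `τ⁻X` either have positive level, where `base` applies, or still have
  -- level at most zero and precede `X` in `Above`.
  have neg (Y : FullSubquiver Γ) (hY : h.level Y < 0) (X : FullSubquiver Γ) :
      Function.Bijective
        ((MeshCategory.lift k P φ hmesh).map : (MeshCategory.of k P X ⟶ .of k P Y) → _) := by
    induction X using h.wellFounded_above.induction with
    | _ X ih =>
      obtain hX | hX := lt_or_ge 0 (h.level X)
      · exact base X Y hX hY
      · refine bijective_lift_of_source hKS hV hΓ P hφ hmesh (hso X hX) (fun X' a => ?_)
          (fun Z t => ?_)
        · obtain hX' | hX' := lt_or_ge 0 (h.level X')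
          · exact base X' Y hX' hY
          · exact ih X' (h.above_of_arrow a hX hX')
        · obtain hZ | hZ := lt_or_ge 0 (h.level Z)
          · exact base Z Y hZ hY
          · exact ih Z (h.above_of_translate t hX hZ)
  induction Y using h.wellFounded_below.induction with
  | _ Y ih =>
    obtain hY | hY := lt_or_ge (h.level Y) 0
    · exact neg Y hY X
    · refine bijective_lift_of_sink hKS hV hΓ P hφ hmesh (hsi Y hY) (fun Y' a => ?_)
        (fun Z t => ?_)
      · obtain hY' | hY' := lt_or_ge (h.level Y') 0
        · exact neg Y' hY' X
        · exact ih Y' (h.below_of_arrow a hY hY')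
      · obtain hZ | hZ := lt_or_ge (h.level Z) 0
        · exact neg Z hZ X
        · exact ih Z (h.below_of_translate t hY hZ)

omit hφ in
theorem isStandard_of_homVanishes {Δ : Set (ARQuiver k V)} (hΔ : Δ ⊆ Γ)
    (h : IsSectionedQuiver (IsTranslateOn Γ)
      {X : FullSubquiver Γ | (Subtype.val X : ARQuiver k V) ∈ Δ})
    (hsink : ∀ X ∈ Δ, HasProperSinkMorphism X.obj)
    (hsource : ∀ X ∈ Δ, HasProperSourceMorphism X.obj)
    (hvan : HomVanishes (sectionPlus IsTranslate Δ) (sectionMinus IsTranslate Δ)) :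
    IsStandard Γ := by
  let P := hΓ.polarization hKS hV
  obtain ⟨φ, hφ, hmesh⟩ := exists_mesh_family hKS hV hΓ P h
  have hmesh' {X Z : FullSubquiver Γ} (t : IsTranslateOn Γ X Z) :=
    And.intro (t.finite_sink hKS hV hΓ) (hmesh t)
  let F := MeshCategory.lift k P φ hmesh'
  have hF (X Y : FullSubquiver Γ) : Function.Bijective
      (F.map : (MeshCategory.of k P X ⟶ .of k P Y) → _) :=
    bijective_lift hKS hV hΓ P hmesh' hΔ h hφ hsink hsource hvan X Y
  have hfull : F.Full := ⟨fun {A B} => (hF A.as B.as).2⟩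
  have hfaith : F.Faithful := ⟨fun {A B} _ _ h => (hF A.as B.as).1 h⟩
  let F' : MeshCategory k P ⥤ FullSubcat Γ :=
    ObjectProperty.lift _ F fun A => ⟨_, (show FullSubquiver Γ from A.as).2, rfl⟩
  refine ⟨hΓ.trivial, P, F', ⟨?_⟩, ⟨?_⟩, ⟨inferInstance, inferInstance, ⟨?_⟩⟩, fun X => rfl⟩
  · intro A B f g
    exact ObjectProperty.hom_ext _ F.map_add
  · intro A B f c
    exact ObjectProperty.hom_ext _ (F.map_smul c f)
  · rintro ⟨_, X, hX, rfl⟩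
    exact ⟨MeshCategory.of k P (⟨X, hX⟩ : FullSubquiver Γ), ⟨Iso.refl _⟩⟩

-- By fullness, a morphism from positive to negative level comes from the mesh category, where it is
-- zero because levels never decrease along paths.
omit hφ in
theorem homVanishes_of_isStandard {Δ : Set (ARQuiver k V)} (hΔ : Δ ⊆ Γ)
    (h : IsSectionedQuiver (IsTranslateOn Γ)
      {X : FullSubquiver Γ | (Subtype.val X : ARQuiver k V) ∈ Δ}) (hst : IsStandard Γ) :
    HomVanishes (sectionPlus IsTranslate Δ) (sectionMinus IsTranslate Δ) := by
  intro X hX Y hY f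
  obtain ⟨hX, hlX⟩ := (mem_sectionPlus_iff hKS hV hΓ hΔ h X).1 hX
  obtain ⟨hY, hlY⟩ := (mem_sectionMinus_iff hKS hV hΓ hΔ h Y).1 hY
  obtain ⟨-, P, F, hadd, hlin, heq, hobj⟩ := hst
  have eX := hobj (⟨X, hX⟩ : FullSubquiver Γ)
  have eY := hobj (⟨Y, hY⟩ : FullSubquiver Γ)
  obtain ⟨g, hg⟩ := F.map_surjective (X := MeshCategory.of k P (⟨X, hX⟩ : FullSubquiver Γ))
    (Y := MeshCategory.of k P (⟨Y, hY⟩ : FullSubquiver Γ))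
    -- The functor acts identically on objects only up to propositional equality, hence the
    -- `eqToHom` transports.
    (ObjectProperty.homMk (eqToHom eX ≫ f ≫ eqToHom eY.symm))
  have h₁ := MeshCategory.eq_zero_of_isEmpty k P
    ⟨fun p => by have := h.level_le_of_path p; lia⟩ g
  rw [h₁, Functor.map_zero] at hg
  have h₂ : 0 = eqToHom eX ≫ f ≫ eqToHom eY.symm := congrArg (fun m => m.hom) hg
  rw [← cancel_epi (eqToHom eX), ← cancel_mono (eqToHom eY.symm), Category.assoc, ← h₂]
  simp

end Component

end ARTheory

end

theorem theorem1p6 {k : Type w} [Field k] {C : Type u} [Category.{v} C] [Preadditive C]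
    [Linear k C] [HasFiniteBiproducts C]
    (hfin : ∀ X Y : C, FiniteDimensional k (X ⟶ Y))
    (hKS : IsKrullSchmidt C)
    (V : Set C) (hV : IsCompleteSetOfIndecomposables V)
    (Γ : Set (ARQuiver k V)) (hΓ : IsConnectedComponent Γ)
    (Δ : Set (ARQuiver k V)) (hΔ : IsSection IsTranslate Δ Γ)
    (haut : ∀ X ∈ Δ, HasTrivialAutField k X.obj)
    (hsink : ∀ X ∈ Δ, HasProperSinkMorphism X.obj)
    (hsource : ∀ X ∈ Δ, HasProperSourceMorphism X.obj)
    (hpath : HasNoInfinitePath Δ) :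
    IsStandard Γ ↔ HomVanishes (sectionPlus IsTranslate Δ) (sectionMinus IsTranslate Δ) := by
  have hΓ' := hΔ.isTrivialComponent hKS hV hΓ haut
  have h := hΔ.isSectionedQuiver hKS hV hΓ' hpath
  exact ⟨homVanishes_of_isStandard hKS hV hΓ' hΔ.subset h,
    isStandard_of_homVanishes hKS hV hΓ' hΔ.subset h hsink hsource⟩
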